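/- **Notation.** For a real number or a point of $\mathbf{R}^3$ write $\langle x\rangle=(1+|x|^2)^{1/2}$; let $\hat f(\xi)=\int_{\mathbf{R}^3} f(x)e^{-2\pi i x\cdot\xi}\,dx$, extended unitarily to $L^2(\mathbf{R}^3)$. For $s\in\mathbf{R}$ and $r>0$ let $$\|f\|_{H^s_r}=\Big(\int_{\mathbf{R}^3}\big(|\xi|^2+r^{-2}\big)^s|\hat f(\xi)|^2\,d\xi\Big)^{1/2},\qquad H^s=H^s_1 .$$ Let $e^{it\Delta}$ be the free Schrödinger propagator on $L^2(\mathbf{R}^3)$, i.e. the Fourier multiplier with symbol $e^{-4\pi^2 i t|\xi|^2}$. For $u\in L^2(\mathbf{R}^3)$ and $U$ open, $\|\nabla u\|_{L^2(U)}$ is the $L^2(U)$ norm of the weak gradient ($+\infty$ if there is no square-integrable weak gradient on $U$). A test function is a smooth compactly supported function $\mathbf{R}^3\to\mathbf{C}$, and $B(0,r)$ is the open ball (empty for $r=0$). **Proposition.** Let $\delta>0$ and $c>0$. There are finite constants $C$, $C_\alpha$ ($\alpha\ge 0$), $C_{\alpha,\beta}$ ($\alpha,\beta\geq 0$), depending only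 on $\delta$, $c$ and the displayed indices, such that for every $R$ with $R=0$ or $R\geq c$ one can assign to every spherically symmetric test function $f$ supported on $\{x:|x|\ge R\}$ functions $f_+,f_-,f_{smooth}\in L^2(\mathbf{R}^3)$ with $$f=f_++f_-+f_{smooth}$$ and the following properties. 1. ($L^2$-boundedness) $\|f_+\|_{L^2},\ \|f_-\|_{L^2},\ \|f_{smooth}\|_{L^2}\le C\|f\|_{L^2}$. 2. (Smooth error) For all $\alpha\ge0$, $$\|\nabla f_{smooth}\|_{L^2(\mathbf{R}^3)}\le C_\alpha\langle R\rangle^{(\delta-1)(1+\alpha)}\|f\|_{H^{-\alpha}_{\langle R\rangle}}.$$ 3. (Asymptotic decay of incoming waves) For every $u_0\in L^2(\mathbf{R}^3)$ and $\varepsilon>0$ there is a time $T>0$, not depending on $f$, such that $$|\langle e^{it\Delta}u_0,f_-\rangle_{L^2}|\le\varepsilon\|f\|_{L^2}$$ for all $t\ge T$ and all spherically symmetric test functions $f$ supported on $\{x:|x|\ge R\}$. 4. (Decay near the origin in the favorable time direction) For all $\alpha,\beta\ge0$ and $t_0\in\mathbf{R}$, $$\int_{t_0}^{\infty}\|\nabla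 e^{i(t-t_0)\Delta}f_+\|_{L^2(B(0,R/8))}\,dt\le C_{\alpha,\beta}\langle R\rangle^{-\beta}\|f\|_{H^{-\alpha}},$$ $$\int_{-\infty}^{t_0}\|\nabla e^{i(t-t_0)\Delta}f_-\|_{L^2(B(0,R/8))}\,dt\le C_{\alpha,\beta}\langle R\rangle^{-\beta}\|f\|_{H^{-\alpha}}.$$ 5. (Local smoothing in the favorable time direction) For all $\alpha\ge0$ and $t_0\in\mathbf{R}$, $$\int_{t_0}^{\infty}\|\langle x\rangle^{-2}e^{i(t-t_0)\Delta}f_+\|_{H^{-\alpha}_{\langle R\rangle}}\,dt\le C_\alpha\langle R\rangle^{-1+\delta}\|f\|_{H^{-\alpha-1+\delta}_{\langle R\rangle}},$$ $$\int_{-\infty}^{t_0}\|\langle x\rangle^{-2}e^{i(t-t_0)\Delta}f_-\|_{H^{-\alpha}_{\langle R\rangle}}\,dt\le C_\alpha\langle R\rangle^{-1+\delta}\|f\|_{H^{-\alpha-1+\delta}_{\langle R\rangle}}.$$ -/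

import Mathlib

open MeasureTheory SchwartzMap FourierTransform
open scoped NNReal ENNReal ContDiff

noncomputable section

/-- Three-dimensional Euclidean space. -/
abbrev R3 : Type := EuclideanSpace ℝ (Fin 3)

/-- The complex Hilbert space `L²(ℝ³)`. Its Fourier transform `𝓕` is the unitary extension of
`f ↦ ∫ f(x) exp(-2πi x·ξ) dx`. -/
abbrev L2R3 : Type := Lp (α := R3) ℂ 2 volume

/-- The bracket `⟨x⟩ = (1 + |x|²)^{1/2}`, used for real numbers and for points of `ℝ³`. -/
def bracket {V : Type*} [NormedAddCommGroup V] (x : V) : ℝ := √(1 + ‖x‖ ^ 2)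

theorem memLp_mul_of_le_one {m : R3 → ℂ} (hm : Continuous m) (hb : ∀ x, ‖m x‖ ≤ 1) (u : L2R3) :
    MemLp (fun x => m x * u x) 2 (volume : Measure R3) := by
  refine (Lp.memLp u).of_le (hm.aestronglyMeasurable.mul (Lp.aestronglyMeasurable u)) ?_
  refine Filter.Eventually.of_forall fun x => ?_
  calc ‖m x * u x‖ = ‖m x‖ * ‖u x‖ := norm_mul _ _
    _ ≤ 1 * ‖u x‖ := mul_le_mul_of_nonneg_right (hb x) (norm_nonneg _)
    _ = ‖u x‖ := one_mul _

/-- Multiplication of an `L²` function by a continuous function bounded by `1`. -/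
def mulL2 (m : R3 → ℂ) (hm : Continuous m) (hb : ∀ x, ‖m x‖ ≤ 1) (u : L2R3) : L2R3 :=
  (memLp_mul_of_le_one hm hb u).toLp

/-- The Fourier symbol `exp(-4π² i t |ξ|²)` of `e^{itΔ}`. -/
def schrodingerSymbol (t : ℝ) (ξ : R3) : ℂ :=
  Complex.exp (((-(4 * Real.pi ^ 2 * t * ‖ξ‖ ^ 2) : ℝ) : ℂ) * Complex.I)

theorem continuous_schrodingerSymbol (t : ℝ) : Continuous (schrodingerSymbol t) := by
  unfold schrodingerSymbol
  fun_prop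

theorem norm_schrodingerSymbol_le (t : ℝ) (ξ : R3) : ‖schrodingerSymbol t ξ‖ ≤ 1 := by
  unfold schrodingerSymbol
  rw [Complex.norm_exp_ofReal_mul_I]

/-- The free Schrödinger propagator `e^{itΔ}` on `L²(ℝ³)`. -/
def freeSchrodinger (t : ℝ) (u : L2R3) : L2R3 :=
  𝓕⁻ (mulL2 (schrodingerSymbol t) (continuous_schrodingerSymbol t)
    (norm_schrodingerSymbol_le t) (𝓕 u))

/-- The weight `⟨x⟩^{-2}`. -/
def inverseSquareWeight (x : R3) : ℂ := ((bracket x ^ (-2 : ℝ) : ℝ) : ℂ)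

theorem one_le_bracket {V : Type*} [NormedAddCommGroup V] (x : V) : 1 ≤ bracket x := by
  unfold bracket
  rw [Real.one_le_sqrt]
  nlinarith [sq_nonneg ‖x‖]

theorem continuous_inverseSquareWeight : Continuous inverseSquareWeight := by
  unfold inverseSquareWeight
  refine Complex.continuous_ofReal.comp ?_
  refine Continuous.rpow_const (by unfold bracket; fun_prop) fun x => Or.inl ?_
  exact (zero_lt_one.trans_le (one_le_bracket x)).ne'

theorem norm_inverseSquareWeight_le (x : R3) : ‖inverseSquareWeight x‖ ≤ 1 := by
  have h := one_le_bracket x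
  unfold inverseSquareWeight
  rw [Complex.norm_real, Real.norm_of_nonneg (Real.rpow_nonneg (zero_le_one.trans h) _)]
  exact Real.rpow_le_one_of_one_le_of_nonpos h (by norm_num)

/-- The function `⟨x⟩^{-2} u(x)`. -/
def weighted (u : L2R3) : L2R3 :=
  mulL2 inverseSquareWeight continuous_inverseSquareWeight norm_inverseSquareWeight_le u

/-- The scaled Sobolev norm
`‖u‖_{H^s_r} = (∫ (|ξ|² + 1/r²)^s |û(ξ)|² dξ)^{1/2} ∈ [0, ∞]` of an `L²` function, at the spatial
scale `r > 0`. For `r = 1` this is the ordinary inhomogeneous `H^s` norm. -/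
def sobolevNorm (s r : ℝ) (u : L2R3) : ℝ≥0∞ :=
  (∫⁻ ξ : R3, ENNReal.ofReal ((‖ξ‖ ^ 2 + 1 / r ^ 2) ^ s) *
    ‖(𝓕 u : L2R3) ξ‖ₑ ^ (2 : ℝ)) ^ (1 / 2 : ℝ)

/-- `G` is a square-integrable weak gradient of `u` on the open set `U`. -/
def IsWeakGradient (u : L2R3) (U : Set R3) (G : R3 → EuclideanSpace ℂ (Fin 3)) : Prop :=
  MemLp G 2 (volume.restrict U) ∧
    ∀ φ : R3 → ℂ, ContDiff ℝ ∞ φ → HasCompactSupport φ → tsupport φ ⊆ U → ∀ j : Fin 3,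
      ∫ x, u x * fderiv ℝ φ x (EuclideanSpace.single j 1) = - ∫ x in U, G x j * φ x

/-- `‖∇u‖_{L²(U)} ∈ [0, ∞]` on an open set `U`: the `L²(U)` norm of the weak gradient of `u` on `U`
(which is unique almost everywhere on `U`), and `∞` if `u` has no square-integrable weak gradient
on `U`. -/
def gradNorm (u : L2R3) (U : Set R3) : ℝ≥0∞ :=
  ⨅ (G : R3 → EuclideanSpace ℂ (Fin 3)) (_ : IsWeakGradient u U G),
    eLpNorm G 2 (volume.restrict U)

/-- `f` is a spherically symmetric test function supported on `{x : |x| ≥ R}`. -/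
structure IsRadialTestFunction (R : ℝ) (f : 𝓢(R3, ℂ)) : Prop where
  hasCompactSupport : HasCompactSupport f
  radial : ∀ x y : R3, ‖x‖ = ‖y‖ → f x = f y
  support_subset : tsupport f ⊆ {x | R ≤ ‖x‖}

end

/-! If f is radial then r f(r) extends to an odd function F on the line, and the radial Laplacian
acts on it as the second derivative. Conversely, `radialLift` sends H to (H(r) - H(-r))/r. It
intertwines the Fourier transforms of ℝ³ and ℝ up to the factor i (`fourier_radialLift`), so it
carries the line propagator, the scaled Sobolev norms and multiplication by even weights over to ℝ³.
Everything becomes one-dimensional.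

On the line choose a cutoff χ to the side r > 0 with χ(r) + χ(-r) = 1 for r ≥ R. Then χF still lifts
to f, but it lives on one side only, so the sign of the frequency decides the direction of motion.
Put ρ = ⟨R⟩. The frequencies of χF above ρ^(δ-1) move right and lift to f_+; those below -ρ^(δ-1)
move left and lift to f_-; the remaining low frequencies lift to f_smooth, whose gradient is small
because its frequency is.

The dispersive estimate concerns a dyadic piece of frequency N, evolved in its favorable direction.
It moves away from the origin at speed at least 4πN, so at time t it has left the region x ≤ τ + ℓ +
Nt. There the phase of the kernel is not stationary, and integration by parts gives O((ND)^(-K)) for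
every K, where D = ρ + Nt (`norm_kernel_le`, `eLpNorm_near_le`). The threshold makes Nρ ≥ ρ^δ, so
powers of Nρ pay for any power of ρ. Beyond that region the weight ⟨x⟩⁻² is itself O(D⁻²)
(`weightBound_decaying`).

Negative Sobolev norms cost nothing essential. On the data side F is written as a polynomial of
degree k in ∂/N applied to an L² function, and the derivatives are moved through the cutoff onto the
multiplier (`WeightBound.cutoff`). On the output side the piece is N⁻¹ times a derivative of a
similar piece (`IsSymbol.lineSobolev_cutoff_le`). Since the time integral of D⁻² is (Nρ)⁻¹, the
local smoothing bound is a convergent geometric series over dyadic N. Decay near the origin uses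
only the rapidly decaying region. Weak decay of incoming waves follows by duality: u₀ is
approximated by ⟨x⟩⁻²w, and the weighted norm of the wave decays like t⁻². -/

noncomputable section

/-! ### Temperate growth, amplitudes, and non-stationary phase -/

/-- A function on the line all of whose derivatives are bounded has temperate growth. -/
theorem hasTemperateGrowth_of_bounded_derivatives {b : ℕ → ℝ → ℂ} (c : ℂ)
    (hd : ∀ i x, HasDerivAt (b i) (c * b (i + 1) x) x) (hb : ∀ i, ∃ C, ∀ x, ‖b i x‖ ≤ C) (i : ℕ) :
    (b i).HasTemperateGrowth := by
  have hder : ∀ i, deriv (b i) = fun x => c * b (i + 1) x := fun i => funext fun x => (hd i x).deriv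
  have hit : ∀ n i, iteratedDeriv n (b i) = fun x => c ^ n * b (i + n) x := by
    intro n
    induction n with
    | zero => intro i; simp
    | succ n ih =>
      intro i
      rw [iteratedDeriv_succ, ih]
      funext x
      have := ((hd (i + n) x).const_mul (c ^ n)).deriv
      rw [this, pow_succ]
      simp only [add_assoc, mul_assoc]
  have hsm : ∀ (n : ℕ) i, ContDiff ℝ n (b i) := by
    intro n
    induction n with
    | zero =>
      intro i
      exact contDiff_zero.2 (continuous_iff_continuousAt.2 fun x => (hd i x).continuousAt)
    | succ n ih =>
      intro i
      rw [show ((n + 1 : ℕ) : WithTop ℕ∞) = (n : WithTop ℕ∞) + 1 by simp, contDiff_succ_iff_deriv]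
      refine ⟨fun x => (hd i x).differentiableAt, by simp, ?_⟩
      rw [hder]
      exact contDiff_const.mul (ih (i + 1))
  refine ⟨contDiff_infty.2 fun n => hsm n i, fun n => ?_⟩
  obtain ⟨C, hC⟩ := hb (i + n)
  refine ⟨0, ‖c‖ ^ n * C, fun x => ?_⟩
  rw [norm_iteratedFDeriv_eq_norm_iteratedDeriv, hit]
  simp only [norm_mul, norm_pow, pow_zero, mul_one]
  exact mul_le_mul_of_nonneg_left (hC x) (by positivity)

theorem hasTemperateGrowth_cexp_ofReal_mul_I :
    (fun y : ℝ => Complex.exp (y * Complex.I)).HasTemperateGrowth := by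
  refine hasTemperateGrowth_of_bounded_derivatives (b := fun _ y => Complex.exp (y * Complex.I))
    Complex.I (fun i x => ?_) (fun i => ⟨1, fun x => by rw [Complex.norm_exp_ofReal_mul_I]⟩) 0
  have h := ((Complex.ofRealCLM.hasDerivAt (x := x)).mul_const Complex.I).cexp
  simpa [mul_comm] using h

/-- Smooth functions supported in `[1, 4]`. -/
structure Amplitude where
  toFun : ℝ → ℂ
  smooth : ContDiff ℝ ∞ toFun
  eq_zero : ∀ x, x ∉ Set.Icc (1 : ℝ) 4 → toFun x = 0

instance : CoeFun Amplitude (fun _ => ℝ → ℂ) := ⟨Amplitude.toFun⟩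

namespace Amplitude

variable (a : Amplitude)

theorem hasCompactSupport : HasCompactSupport a :=
  HasCompactSupport.intro isCompact_Icc a.eq_zero

theorem continuous : Continuous a := a.smooth.continuous

theorem exists_bound : ∃ C : ℝ, 0 ≤ C ∧ ∀ x, ‖a x‖ ≤ C := by
  obtain ⟨C, hC⟩ := a.hasCompactSupport.exists_bound_of_continuous a.continuous
  exact ⟨C, (norm_nonneg _).trans (hC 0), hC⟩

theorem eq_zero_left : a 1 = 0 := by
  have h : Set.EqOn a 0 (closure (Set.Iio 1)) := by
    refine Set.EqOn.closure (fun x hx => a.eq_zero x fun h => ?_) a.continuous continuous_const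
    exact absurd h.1 (not_le.2 hx)
  exact h (by rw [closure_Iio]; exact Set.mem_Iic.2 le_rfl)

theorem eq_zero_right : a 4 = 0 := by
  have h : Set.EqOn a 0 (closure (Set.Ioi 4)) := by
    refine Set.EqOn.closure (fun x hx => a.eq_zero x fun h => ?_) a.continuous continuous_const
    exact absurd h.2 (not_le.2 hx)
  exact h (by rw [closure_Ioi]; exact Set.mem_Ici.2 le_rfl)

/-- The derivative of an amplitude. -/
def derivative : Amplitude where
  toFun := deriv a
  smooth := (contDiff_infty_iff_deriv.1 a.smooth).2
  eq_zero := by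
    intro x hx
    have h : a =ᶠ[nhds x] fun _ => (0 : ℂ) := by
      filter_upwards [isClosed_Icc.isOpen_compl.mem_nhds hx] with y hy using a.eq_zero y hy
    rw [h.deriv_eq]
    simp

/-- The amplitude `2πiη a(η)`. -/
def mulFreq : Amplitude where
  toFun η := (2 * Real.pi * Complex.I * η) * a η
  smooth := by
    have h := a.smooth
    have h2 : ContDiff ℝ ∞ (fun η : ℝ => (η : ℂ)) := Complex.ofRealCLM.contDiff
    fun_prop
  eq_zero x hx := by rw [a.eq_zero x hx, mul_zero]

/-- The amplitude `a(η) / (2πiη)`. -/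
def divFreq : Amplitude where
  toFun η := a η / (2 * Real.pi * Complex.I * η)
  smooth := by
    rw [contDiff_iff_contDiffAt]
    intro x
    rcases eq_or_ne x 0 with rfl | hx
    · have h : (fun η : ℝ => a η / (2 * Real.pi * Complex.I * η)) =ᶠ[nhds 0] fun _ => (0 : ℂ) := by
        filter_upwards [isClosed_Icc.isOpen_compl.mem_nhds
          (show (0 : ℝ) ∈ (Set.Icc (1 : ℝ) 4)ᶜ by simp)] with y hy
        rw [a.eq_zero y hy, zero_div]
      exact contDiffAt_const.congr_of_eventuallyEq h
    · have h2 : ContDiff ℝ ∞ (fun η : ℝ => (η : ℂ)) := Complex.ofRealCLM.contDiff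
      simp only [div_eq_mul_inv]
      refine a.smooth.contDiffAt.mul ((contDiffAt_const.mul h2.contDiffAt).inv ?_)
      simp [hx, Real.pi_ne_zero]
  eq_zero x hx := by rw [a.eq_zero x hx, zero_div]

theorem divFreq_mul (η : ℝ) : (2 * Real.pi * Complex.I * η) * a.divFreq η = a η := by
  rcases eq_or_ne η 0 with rfl | h
  · rw [a.eq_zero 0 (by simp)]; simp
  · have : (2 * Real.pi * Complex.I * η : ℂ) ≠ 0 := by simp [h, Real.pi_ne_zero]
    exact mul_div_cancel₀ _ this

/-- Non-stationary phase: repeated integration by parts against a quadratic phase without critical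
points in the support of the amplitude. -/
theorem norm_oscillatory_le (K : ℕ) : ∀ (a : Amplitude) (k : ℕ), ∃ C : ℝ, 0 ≤ C ∧
    ∀ A T σ : ℝ, 0 ≤ T → 0 < A + 4 * Real.pi * T → T ≤ 8 * (A + 4 * Real.pi * T) →
      (σ = 1 ∨ σ = -1) →
      ‖∫ η in (1 : ℝ)..4, a η * (((A + 4 * Real.pi * T * η)⁻¹ ^ k : ℝ) : ℂ) *
        Complex.exp ((-(2 * Real.pi * σ * (A * η + 2 * Real.pi * T * η ^ 2)) : ℝ) * Complex.I)‖ ≤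
      C * (A + 4 * Real.pi * T)⁻¹ ^ (k + K) := by
  -- Up to the factor 2πσ the phase has derivative A + 4πTη, which is smallest at the left endpoint
  -- η = 1 of the support.
  have hq : ∀ A T η : ℝ, 0 ≤ T → 1 ≤ η → A + 4 * Real.pi * T ≤ A + 4 * Real.pi * T * η := by
    intro A T η hT hη
    have : 0 ≤ 4 * Real.pi * T := by positivity
    nlinarith
  induction K with
  | zero =>
    intro a k
    obtain ⟨C, hC0, hC⟩ := a.exists_bound
    refine ⟨C * 3, by positivity, fun A T σ hT hE _ _ => ?_⟩
    have := intervalIntegral.norm_integral_le_of_norm_le_const (a := (1 : ℝ)) (b := 4)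
      (C := C * (A + 4 * Real.pi * T)⁻¹ ^ k)
      (f := fun η => a η * (((A + 4 * Real.pi * T * η)⁻¹ ^ k : ℝ) : ℂ) *
        Complex.exp ((-(2 * Real.pi * σ * (A * η + 2 * Real.pi * T * η ^ 2)) : ℝ) * Complex.I)) ?_
    · refine this.trans (le_of_eq ?_)
      rw [add_zero]; norm_num; ring
    · intro η hη
      rw [Set.uIoc_of_le (by norm_num)] at hη
      have h1 := hq A T η hT hη.1.le
      rw [norm_mul, Complex.norm_exp_ofReal_mul_I, mul_one, norm_mul, Complex.norm_real,
        Real.norm_of_nonneg (pow_nonneg (inv_nonneg.2 (hE.le.trans h1)) _)]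
      have h2 : (A + 4 * Real.pi * T * η)⁻¹ ≤ (A + 4 * Real.pi * T)⁻¹ := inv_anti₀ hE h1
      have h3 : 0 ≤ (A + 4 * Real.pi * T * η)⁻¹ := inv_nonneg.2 (hE.le.trans h1)
      gcongr
      exact hC η
  | succ K ih =>
    intro a k
    -- Carrying the power `k` of the reciprocal phase derivative `q` closes the induction. Dividing
    -- by the phase derivative and integrating by parts yields `a' q^(k+1)` and `T a q^(k+2)`. The
    -- second term has one power too many, and T ≤ 8E turns `T E⁻¹` into the constant 8.
    obtain ⟨C1, hC1, h1⟩ := ih a.derivative (k + 1)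
    obtain ⟨C2, hC2, h2⟩ := ih a (k + 2)
    refine ⟨C1 + 4 * Real.pi * (k + 1) * 8 * C2, by positivity, fun A T σ hT hE hTE hσ => ?_⟩
    specialize h1 A T σ hT hE hTE hσ
    specialize h2 A T σ hT hE hTE hσ
    set E := A + 4 * Real.pi * T with hEdef
    set e : ℝ → ℂ := fun η =>
      Complex.exp ((-(2 * Real.pi * σ * (A * η + 2 * Real.pi * T * η ^ 2)) : ℝ) * Complex.I) with he
    set q : ℝ → ℝ := fun η => (A + 4 * Real.pi * T * η)⁻¹ with hqd
    have hpos : ∀ η ∈ Set.uIcc (1 : ℝ) 4, 0 < A + 4 * Real.pi * T * η := by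
      intro η hη
      rw [Set.uIcc_of_le (by norm_num)] at hη
      exact hE.trans_le (hq A T η hT hη.1)
    have hqder : ∀ η ∈ Set.uIcc (1 : ℝ) 4, HasDerivAt q (-(4 * Real.pi * T) * q η ^ 2) η := by
      intro η hη
      have h := (((hasDerivAt_id η).const_mul (4 * Real.pi * T)).const_add A).inv (hpos η hη).ne'
      refine h.congr_deriv ?_
      simp only [hqd, id, mul_one, inv_pow]
      rw [div_eq_mul_inv]
    have hqcont : ContinuousOn q (Set.uIcc 1 4) := fun η hη =>
      (hqder η hη).continuousAt.continuousWithinAt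
    have hecont : Continuous e := by
      rw [he]; fun_prop
    have heder : ∀ η, HasDerivAt e (-(2 * Real.pi * σ * (A + 4 * Real.pi * T * η) : ℝ) *
        Complex.I * e η) η := by
      intro η
      have h0 : HasDerivAt (fun η : ℝ => -(2 * Real.pi * σ * (A * η + 2 * Real.pi * T * η ^ 2)))
          (-(2 * Real.pi * σ * (A + 4 * Real.pi * T * η))) η := by
        have := ((((hasDerivAt_id η).const_mul A).add
          (((hasDerivAt_id η).pow 2).const_mul (2 * Real.pi * T))).const_mul (2 * Real.pi * σ)).neg
        refine this.congr_deriv ?_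
        simp only [id, Nat.cast_ofNat, Nat.reduceSub, pow_one]; ring
      have := (h0.ofReal_comp.mul_const Complex.I).cexp
      refine this.congr_deriv ?_
      simp only [he]; push_cast; ring
    have haq : ∀ η ∈ Set.uIcc (1 : ℝ) 4, HasDerivAt (fun η => a η * ((q η ^ (k + 1) : ℝ) : ℂ))
        (a.derivative η * ((q η ^ (k + 1) : ℝ) : ℂ) -
          (4 * Real.pi * T * (k + 1) : ℝ) * (a η * ((q η ^ (k + 2) : ℝ) : ℂ))) η := by
      intro η hη
      have ha : HasDerivAt a (a.derivative η) η :=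
        (a.smooth.differentiable (by simp) η).hasDerivAt
      have := ha.mul ((hqder η hη).pow (k + 1)).ofReal_comp
      refine this.congr_deriv ?_
      push_cast; simp; ring
    have hcont1 : ∀ (b : Amplitude) (j : ℕ),
        ContinuousOn (fun η => b η * ((q η ^ j : ℝ) : ℂ)) (Set.uIcc 1 4) := fun b j =>
      b.continuous.continuousOn.mul (Complex.continuous_ofReal.comp_continuousOn (hqcont.pow j))
    have hibp := intervalIntegral.integral_mul_deriv_eq_deriv_mul (a := (1 : ℝ)) (b := 4)
      haq (fun η _ => heder η)
      (((hcont1 a.derivative (k + 1)).sub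
        (continuousOn_const.mul (hcont1 a (k + 2)))).intervalIntegrable)
      (Continuous.intervalIntegrable (by fun_prop) _ _)
    -- The boundary terms vanish because the amplitude is zero at both endpoints.
    rw [a.eq_zero_left, a.eq_zero_right] at hibp
    simp only [zero_mul, sub_self, zero_sub] at hibp
    have hL : ∫ η in (1 : ℝ)..4, a η * ((q η ^ (k + 1) : ℝ) : ℂ) *
        (-(2 * Real.pi * σ * (A + 4 * Real.pi * T * η) : ℝ) * Complex.I * e η) =
        (-(2 * Real.pi * σ : ℝ) * Complex.I) *
          ∫ η in (1 : ℝ)..4, a η * ((q η ^ k : ℝ) : ℂ) * e η := by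
      rw [← intervalIntegral.integral_const_mul]
      refine intervalIntegral.integral_congr fun η hη => ?_
      have h0 : ((A + 4 * Real.pi * T * η : ℝ) : ℂ) ≠ 0 := by
        exact_mod_cast (hpos η hη).ne'
      have hq1 : ((q η ^ (k + 1) : ℝ) : ℂ) * ((A + 4 * Real.pi * T * η : ℝ) : ℂ) =
          ((q η ^ k : ℝ) : ℂ) := by
        rw [← Complex.ofReal_mul, pow_succ, mul_assoc, hqd]
        simp only
        rw [inv_mul_cancel₀ (hpos η hη).ne', mul_one]
      rw [← hq1]
      push_cast; ring
    have hR : ∫ η in (1 : ℝ)..4, (a.derivative η * ((q η ^ (k + 1) : ℝ) : ℂ) -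
          (4 * Real.pi * T * (k + 1) : ℝ) * (a η * ((q η ^ (k + 2) : ℝ) : ℂ))) * e η =
        (∫ η in (1 : ℝ)..4, a.derivative η * ((q η ^ (k + 1) : ℝ) : ℂ) * e η) -
          (4 * Real.pi * T * (k + 1) : ℝ) *
            ∫ η in (1 : ℝ)..4, a η * ((q η ^ (k + 2) : ℝ) : ℂ) * e η := by
      rw [← intervalIntegral.integral_const_mul, ← intervalIntegral.integral_sub]
      · refine intervalIntegral.integral_congr fun η _ => ?_
        ring
      · exact ((hcont1 _ _).mul hecont.continuousOn).intervalIntegrable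
      · exact (continuousOn_const.mul
          ((hcont1 _ _).mul hecont.continuousOn)).intervalIntegrable
    rw [hL, hR] at hibp
    have hn := congrArg norm hibp
    rw [norm_mul, norm_neg] at hn
    have hσ1 : |σ| = 1 := by rcases hσ with rfl | rfl <;> simp
    have hc : ‖(-(2 * Real.pi * σ : ℝ) * Complex.I : ℂ)‖ = 2 * Real.pi := by
      rw [norm_mul, norm_neg, Complex.norm_I, mul_one, Complex.norm_real, Real.norm_eq_abs,
        abs_mul, hσ1, mul_one, abs_of_pos (by positivity)]
    rw [hc] at hn
    have hE1 : 0 < E⁻¹ := inv_pos.2 hE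
    have hTE' : T * E⁻¹ ≤ 8 := by
      rw [← div_eq_mul_inv, div_le_iff₀ hE]; exact hTE
    calc ‖∫ η in (1 : ℝ)..4, a η * ((q η ^ k : ℝ) : ℂ) * e η‖
        ≤ 2 * Real.pi * ‖∫ η in (1 : ℝ)..4, a η * ((q η ^ k : ℝ) : ℂ) * e η‖ := by
          have : 1 ≤ 2 * Real.pi := by linarith [Real.pi_gt_three]
          nlinarith [norm_nonneg (∫ η in (1 : ℝ)..4, a η * ((q η ^ k : ℝ) : ℂ) * e η)]
      _ ≤ C1 * E⁻¹ ^ (k + 1 + K) + (4 * Real.pi * T * (k + 1)) * (C2 * E⁻¹ ^ (k + 2 + K)) := by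
          rw [hn]
          refine (norm_sub_le _ _).trans (add_le_add h1 ?_)
          rw [norm_mul, Complex.norm_real, Real.norm_of_nonneg (by positivity)]
          exact mul_le_mul_of_nonneg_left h2 (by positivity)
      _ = C1 * E⁻¹ ^ (k + (K + 1)) +
          4 * Real.pi * (k + 1) * C2 * E⁻¹ ^ (k + (K + 1)) * (T * E⁻¹) := by
          ring
      _ ≤ C1 * E⁻¹ ^ (k + (K + 1)) +
          4 * Real.pi * (k + 1) * C2 * E⁻¹ ^ (k + (K + 1)) * 8 := by
          gcongr
      _ = _ := by ring

end Amplitude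

/-! ### Dyadic pieces of waves and their kernels -/

/-- The parameters of a dyadic piece of an outgoing (`σ = 1`) or incoming (`σ = -1`) wave: `ρ` is
the spatial scale, `N` the frequency, `t` the time elapsed in the favorable direction; the data
live in `{y | τ + 2 * ℓ ≤ y}`, where the length `ℓ` is comparable to `ρ`. -/
structure Regime (δ κ : ℝ) where
  ρ : ℝ
  N : ℝ
  τ : ℝ
  ℓ : ℝ
  t : ℝ
  σ : ℝ
  δ_pos : 0 < δ
  κ_pos : 0 < κ
  one_le_ρ : 1 ≤ ρ
  le_N : ρ ^ (δ - 1) ≤ N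
  le_ℓ : κ * ρ ≤ ℓ
  ℓ_le : ℓ ≤ ρ
  t_nonneg : 0 ≤ t
  sign : σ = 1 ∨ σ = -1
  position : τ = 0 ∨ τ = -3 ∧ ρ = 1

/-- The symbol of the propagator localized to frequencies `N ≤ σ ξ ≤ 4 N`. -/
def waveSymbol (σ N t : ℝ) (a : ℝ → ℂ) (ξ : ℝ) : ℂ :=
  a (σ / N * ξ) * Complex.exp ((-(4 * Real.pi ^ 2 * (σ * t) * ξ ^ 2) : ℝ) * Complex.I)

theorem hasTemperateGrowth_schrodinger (t : ℝ) : (fun ξ : ℝ =>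
    Complex.exp ((-(4 * Real.pi ^ 2 * t * ξ ^ 2) : ℝ) * Complex.I)).HasTemperateGrowth := by
  refine hasTemperateGrowth_cexp_ofReal_mul_I.comp
    (f := fun ξ : ℝ => -(4 * Real.pi ^ 2 * t * ξ ^ 2)) ?_
  fun_prop

theorem hasTemperateGrowth_waveSymbol (σ N t : ℝ) {a : ℝ → ℂ} (ha : a.HasTemperateGrowth) :
    (waveSymbol σ N t a).HasTemperateGrowth := by
  unfold waveSymbol
  refine Function.HasTemperateGrowth.mul (ha.comp (f := fun ξ : ℝ => σ / N * ξ) (by fun_prop))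
    (hasTemperateGrowth_schrodinger (σ * t))

theorem Amplitude.hasTemperateGrowth (a : Amplitude) : (a : ℝ → ℂ).HasTemperateGrowth :=
  a.hasCompactSupport.hasTemperateGrowth a.smooth

/-- The multiplier operator with symbol `waveSymbol σ N t a`. -/
def wavePiece (σ N t : ℝ) (a : ℝ → ℂ) : 𝓢(ℝ, ℂ) →L[ℂ] 𝓢(ℝ, ℂ) :=
  fourierMultiplierCLM ℂ (waveSymbol σ N t a)

namespace Regime

variable {δ κ : ℝ} (G : Regime δ κ)

/-- The distance `ρ + N t` from the origin of a wave of frequency `N` at time `t`. -/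
def D : ℝ := G.ρ + G.N * G.t

/-- The dyadic piece of the propagator. -/
def U (a : Amplitude) : 𝓢(ℝ, ℂ) →L[ℂ] 𝓢(ℝ, ℂ) := wavePiece G.σ G.N G.t a

theorem ρ_pos : 0 < G.ρ := zero_lt_one.trans_le G.one_le_ρ

theorem N_pos : 0 < G.N := (Real.rpow_pos_of_pos G.ρ_pos _).trans_le G.le_N

theorem Nt_nonneg : 0 ≤ G.N * G.t := mul_nonneg G.N_pos.le G.t_nonneg

theorem one_le_D : 1 ≤ G.D := by
  have := G.one_le_ρ
  have := G.Nt_nonneg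
  unfold D; linarith

theorem D_pos : 0 < G.D := zero_lt_one.trans_le G.one_le_D

theorem ρ_le_D : G.ρ ≤ G.D := by
  have := G.Nt_nonneg
  unfold D; linarith

theorem rpow_le_N_mul_ρ : G.ρ ^ δ ≤ G.N * G.ρ := by
  have h := mul_le_mul_of_nonneg_right G.le_N G.ρ_pos.le
  rwa [← Real.rpow_add_one G.ρ_pos.ne', sub_add_cancel] at h

theorem one_le_N_mul_ρ : 1 ≤ G.N * G.ρ :=
  (Real.one_le_rpow G.one_le_ρ G.δ_pos.le).trans G.rpow_le_N_mul_ρ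

theorem N_mul_ρ_le : G.N * G.ρ ≤ G.N * G.D := mul_le_mul_of_nonneg_left G.ρ_le_D G.N_pos.le

theorem one_le_N_mul_D : 1 ≤ G.N * G.D := G.one_le_N_mul_ρ.trans G.N_mul_ρ_le

theorem inv_N_le_ρ : G.N⁻¹ ≤ G.ρ := by
  rw [inv_le_iff_one_le_mul₀ G.N_pos, mul_comm]
  exact G.one_le_N_mul_ρ

theorem inv_ρ_le_N : G.ρ⁻¹ ≤ G.N := by
  rw [inv_le_iff_one_le_mul₀ G.ρ_pos]
  exact G.one_le_N_mul_ρ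

/-- The purpose of the threshold `ρ ^ (δ - 1)`: since `Nρ ≥ ρ^δ`, a loss of any fixed power of `ρ`
is recovered by a bounded number of extra integrations by parts. This is where δ > 0 enters. -/
theorem ρ_le_pow : G.ρ ≤ (G.N * G.ρ) ^ ⌈δ⁻¹⌉₊ := by
  have h1 : G.ρ = (G.ρ ^ δ) ^ δ⁻¹ := by
    rw [← Real.rpow_mul G.ρ_pos.le, mul_inv_cancel₀ G.δ_pos.ne', Real.rpow_one]
  calc G.ρ = (G.ρ ^ δ) ^ δ⁻¹ := h1
    _ ≤ (G.N * G.ρ) ^ δ⁻¹ := Real.rpow_le_rpow (Real.rpow_nonneg G.ρ_pos.le _)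
        G.rpow_le_N_mul_ρ (inv_nonneg.2 G.δ_pos.le)
    _ ≤ (G.N * G.ρ) ^ ((⌈δ⁻¹⌉₊ : ℕ) : ℝ) :=
        Real.rpow_le_rpow_of_exponent_le G.one_le_N_mul_ρ (Nat.le_ceil _)
    _ = _ := Real.rpow_natCast _ _

theorem κ_le_one {δ κ : ℝ} (G : Regime δ κ) : κ ≤ 1 := by
  have := G.le_ℓ.trans G.ℓ_le
  have := G.ρ_pos
  by_contra! h
  nlinarith

theorem σ_sq : G.σ * G.σ = 1 := by rcases G.sign with h | h <;> rw [h] <;> norm_num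

theorem abs_σ : |G.σ| = 1 := by rcases G.sign with h | h <;> rw [h] <;> norm_num

theorem norm_symbol (σ N t : ℝ) (a : ℝ → ℂ) (ξ : ℝ) :
    ‖waveSymbol σ N t a ξ‖ = ‖a (σ / N * ξ)‖ := by
  unfold waveSymbol
  rw [norm_mul, Complex.norm_exp_ofReal_mul_I, mul_one]

theorem integrable_symbol (a : Amplitude) : Integrable (waveSymbol G.σ G.N G.t a) := by
  have hne : G.σ / G.N ≠ 0 := div_ne_zero (fun h => by simpa [h] using G.abs_σ) G.N_pos.ne'
  refine Continuous.integrable_of_hasCompactSupport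
    (hasTemperateGrowth_waveSymbol _ _ _ a.hasTemperateGrowth).1.continuous ?_
  unfold waveSymbol
  refine HasCompactSupport.mul_right ?_
  exact a.hasCompactSupport.comp_homeomorph (Homeomorph.mulLeft₀ _ hne)

/-- The convolution kernel of `U a`. -/
def kernel (a : Amplitude) (z : ℝ) : ℂ :=
  ∫ ξ : ℝ, Complex.exp ((2 * Real.pi * (z * ξ) : ℝ) * Complex.I) * waveSymbol G.σ G.N G.t a ξ

/-- The self-adjointness of the Fourier transform, applied to `g` and to the integrable symbol times
a character, moves the transform from `g` to the symbol. -/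
theorem U_apply (a : Amplitude) (g : 𝓢(ℝ, ℂ)) (x : ℝ) :
    G.U a g x = ∫ y, G.kernel a (x - y) * g y := by
  have h1 : G.U a g x = ∫ ξ : ℝ, (Complex.exp ((2 * Real.pi * (ξ * x) : ℝ) * Complex.I) *
      waveSymbol G.σ G.N G.t a ξ) * 𝓕 (g : ℝ → ℂ) ξ := by
    unfold U wavePiece
    rw [fourierMultiplierCLM_apply, fourierInv_coe, Real.fourierInv_eq']
    refine integral_congr_ae (Filter.Eventually.of_forall fun ξ => ?_)
    simp only [smul_eq_mul]
    rw [smulLeftCLM_apply_apply (hasTemperateGrowth_waveSymbol _ _ _ a.hasTemperateGrowth),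
      smul_eq_mul, fourier_coe]
    simp only [RCLike.inner_apply, conj_trivial]
    rw [mul_comm x ξ]; ring
  have hint : Integrable fun ξ : ℝ => Complex.exp ((2 * Real.pi * (ξ * x) : ℝ) * Complex.I) *
      waveSymbol G.σ G.N G.t a ξ := by
    refine (G.integrable_symbol a).bdd_mul (c := 1) (by fun_prop) ?_
    exact Filter.Eventually.of_forall fun ξ => by rw [Complex.norm_exp_ofReal_mul_I]
  have h2 := VectorFourier.integral_bilin_fourierIntegral_eq_flip (ContinuousLinearMap.mul ℂ ℂ)
    (μ := volume) (ν := volume) (L := innerₗ ℝ) Real.continuous_fourierChar continuous_inner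
    hint g.integrable
  simp only [ContinuousLinearMap.mul_apply', flip_innerₗ] at h2
  rw [h1]
  refine h2.symm.trans (integral_congr_ae (Filter.Eventually.of_forall fun y => ?_))
  simp only
  congr 1
  unfold kernel
  refine integral_congr_ae (Filter.Eventually.of_forall fun ξ => ?_)
  simp only [innerₗ_apply_apply, Circle.smul_def, Real.fourierChar_apply, smul_eq_mul]
  rw [← mul_assoc, ← Complex.exp_add]
  congr 2
  simp only [RCLike.inner_apply, conj_trivial]
  push_cast; ring

/-- The substitution `ξ = σNη` treats both directions of motion at once: after it, `σ` only
conjugates the phase. -/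
theorem kernel_eq (a : Amplitude) (z : ℝ) :
    G.kernel a z = G.N * ∫ η in (1 : ℝ)..4, a η * Complex.exp ((-(2 * Real.pi * G.σ *
      (-z * G.N * η + 2 * Real.pi * (G.t * G.N ^ 2) * η ^ 2)) : ℝ) * Complex.I) := by
  have hN := G.N_pos
  have hσ := G.σ_sq
  have hs : ∫ η in (1 : ℝ)..4, a η * Complex.exp ((-(2 * Real.pi * G.σ *
      (-z * G.N * η + 2 * Real.pi * (G.t * G.N ^ 2) * η ^ 2)) : ℝ) * Complex.I) =
      ∫ η : ℝ, a η * Complex.exp ((-(2 * Real.pi * G.σ *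
      (-z * G.N * η + 2 * Real.pi * (G.t * G.N ^ 2) * η ^ 2)) : ℝ) * Complex.I) := by
    rw [intervalIntegral.integral_of_le (by norm_num), ← integral_Icc_eq_integral_Ioc]
    refine setIntegral_eq_integral_of_forall_compl_eq_zero fun x hx => ?_
    rw [a.eq_zero x hx, zero_mul]
  have hc := Measure.integral_comp_mul_left (fun η : ℝ => a η * Complex.exp ((-(2 * Real.pi * G.σ *
      (-z * G.N * η + 2 * Real.pi * (G.t * G.N ^ 2) * η ^ 2)) : ℝ) * Complex.I)) (G.σ / G.N)
  have hNabs : |(G.σ / G.N)⁻¹| = G.N := by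
    rw [abs_inv, abs_div, G.abs_σ, abs_of_pos hN, one_div, inv_inv]
  rw [hNabs] at hc
  rw [hs, ← Complex.real_smul, ← hc]
  unfold kernel waveSymbol
  refine integral_congr_ae (Filter.Eventually.of_forall fun ξ => ?_)
  simp only
  rw [mul_left_comm, ← Complex.exp_add]
  congr 2
  rw [← add_mul]
  congr 1
  rw [← Complex.ofReal_add]
  congr 1
  have e1 : G.σ * (-z * G.N * (G.σ / G.N * ξ) + 2 * Real.pi * (G.t * G.N ^ 2) *
      (G.σ / G.N * ξ) ^ 2) = -z * ξ + 2 * Real.pi * G.t * G.σ * ξ ^ 2 := by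
    have : G.σ * (-z * G.N * (G.σ / G.N * ξ) + 2 * Real.pi * (G.t * G.N ^ 2) *
      (G.σ / G.N * ξ) ^ 2) = (G.σ * G.σ) * (-z * (G.N / G.N) * ξ) + (G.σ * G.σ) * (2 * Real.pi *
        G.t * (G.N / G.N) ^ 2 * G.σ * ξ ^ 2) := by ring
    rw [this, hσ, div_self hN.ne']; ring
  linear_combination (2 * Real.pi) * e1

end Regime

/-! ### L² bounds: product kernels, Plancherel, and the region left by the wave -/

theorem memLp_inv_one_add_abs : MemLp (fun x : ℝ => (1 + |x|)⁻¹) 2 := by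
  have hc : Continuous fun x : ℝ => (1 + |x|)⁻¹ :=
    (continuous_const.add continuous_abs).inv₀ fun x =>
      (show 0 < 1 + |x| by positivity).ne'
  rw [memLp_two_iff_integrable_sq hc.aestronglyMeasurable]
  have h := integrable_one_add_norm (E := ℝ) (μ := volume) (r := 2) (by simp)
  refine h.congr (Filter.Eventually.of_forall fun x => ?_)
  simp only [Real.norm_eq_abs]
  rw [Real.rpow_neg (by positivity), inv_pow]
  norm_cast

/-- An integral operator with a kernel bounded by a product `B / ((1 + |x|) (1 + |y|))`. -/
theorem eLpNorm_le_of_product_bound {u g : ℝ → ℂ} (τ B : ℝ) (hB : 0 ≤ B) (hg : Measurable g)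
    (h : ∀ x, ‖u x‖ₑ ≤ ENNReal.ofReal (B * (1 + |x - τ|)⁻¹) *
      ∫⁻ y, ENNReal.ofReal ((1 + |y - τ|)⁻¹) * ‖g y‖ₑ) :
    eLpNorm u 2 volume ≤ eLpNorm (fun x : ℝ => (1 + |x|)⁻¹) 2 volume ^ 2 * ENNReal.ofReal B *
      eLpNorm g 2 volume := by
  set w : ℝ → ℝ := fun x => (1 + |x|)⁻¹ with hw
  have hwm : Measurable w := by
    rw [hw]; fun_prop
  have hw0 : ∀ x, 0 ≤ w x := fun x => by rw [hw]; positivity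
  have htr : eLpNorm (fun x => w (x - τ)) 2 volume = eLpNorm w 2 volume :=
    eLpNorm_comp_measurePreserving hwm.aestronglyMeasurable (measurePreserving_sub_right volume τ)
  have hI : ∫⁻ y, ENNReal.ofReal (w (y - τ)) * ‖g y‖ₑ ≤ eLpNorm w 2 volume * eLpNorm g 2 volume := by
    have := ENNReal.lintegral_mul_le_Lp_mul_Lq (volume : Measure ℝ) (p := 2) (q := 2)
      (f := fun y => ENNReal.ofReal (w (y - τ))) (g := fun y => ‖g y‖ₑ)
      ⟨by norm_num, by norm_num, by norm_num⟩
      ((hwm.comp (measurable_id.sub_const τ)).ennreal_ofReal.aemeasurable) hg.enorm.aemeasurable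
    refine this.trans (le_of_eq ?_)
    rw [← htr, eLpNorm_eq_lintegral_rpow_enorm_toReal (by norm_num) (by norm_num),
      eLpNorm_eq_lintegral_rpow_enorm_toReal (by norm_num) (by norm_num)]
    simp only [ENNReal.toReal_ofNat, Real.enorm_of_nonneg (hw0 _)]
  set I := ∫⁻ y, ENNReal.ofReal (w (y - τ)) * ‖g y‖ₑ
  -- If `g` has infinite norm the bound is trivial, except when B = 0, where `u` itself vanishes.
  by_cases hIt : eLpNorm w 2 volume * eLpNorm g 2 volume = ⊤
  · have hg' : eLpNorm g 2 volume = ⊤ := by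
      rcases ENNReal.mul_eq_top.1 hIt with h | h
      · exact h.2
      · exact absurd h.1 memLp_inv_one_add_abs.2.ne
    rcases hB.eq_or_lt with rfl | hB
    · have : ∀ x, ‖u x‖ₑ ≤ 0 := fun x => by simpa using h x
      have hu : u = 0 := funext fun x => by simpa using this x
      simp [hu]
    · have hw0 : eLpNorm w 2 volume ≠ 0 := by
        intro h0
        simp [h0] at hIt
      rw [hg', ENNReal.mul_top (by simp [hw0, hB])]
      exact le_top
  · have hI' : I ≠ ⊤ := ne_top_of_le_ne_top hIt hI
    have hpt : ∀ x, ‖u x‖ₑ ≤ ‖(B * I.toReal) * w (x - τ)‖ₑ := by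
      intro x
      refine (h x).trans (le_of_eq ?_)
      rw [Real.enorm_of_nonneg (mul_nonneg (mul_nonneg hB ENNReal.toReal_nonneg) (hw0 _)),
        mul_right_comm, ENNReal.ofReal_mul (mul_nonneg hB (hw0 _)), ENNReal.ofReal_toReal hI']
    calc eLpNorm u 2 volume ≤ eLpNorm (fun x => (B * I.toReal) * w (x - τ)) 2 volume :=
          eLpNorm_mono_enorm hpt
      _ = ENNReal.ofReal B * I * eLpNorm w 2 volume := by
          have := eLpNorm_const_smul (B * I.toReal) (fun x => w (x - τ)) 2 (volume : Measure ℝ)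
          rw [htr, Real.enorm_of_nonneg (mul_nonneg hB ENNReal.toReal_nonneg), ENNReal.ofReal_mul hB,
            ENNReal.ofReal_toReal hI'] at this
          exact this
      _ ≤ ENNReal.ofReal B * (eLpNorm w 2 volume * eLpNorm g 2 volume) * eLpNorm w 2 volume := by
          gcongr
      _ = _ := by ring

/-- Plancherel's identity. -/
theorem eLpNorm_fourier (g : 𝓢(ℝ, ℂ)) : eLpNorm (𝓕 g : 𝓢(ℝ, ℂ)) 2 volume = eLpNorm g 2 volume := by
  have h := norm_fourier_toL2_eq g
  rw [norm_toLp, norm_toLp] at h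
  exact (ENNReal.toReal_eq_toReal_iff' ((𝓕 g).eLpNorm_lt_top 2 volume).ne
    (g.eLpNorm_lt_top 2 volume).ne).1 h

theorem fourier_fourierMultiplierCLM {m : ℝ → ℂ} (hm : m.HasTemperateGrowth) (g : 𝓢(ℝ, ℂ)) (ξ : ℝ) :
    (𝓕 (fourierMultiplierCLM ℂ m g) : 𝓢(ℝ, ℂ)) ξ = m ξ * (𝓕 g : 𝓢(ℝ, ℂ)) ξ := by
  rw [fourierMultiplierCLM_apply, FourierTransform.fourier_fourierInv_eq,
    smulLeftCLM_apply_apply hm, smul_eq_mul]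

theorem eLpNorm_fourierMultiplierCLM_le {m : ℝ → ℂ} (hm : m.HasTemperateGrowth) {C : ℝ≥0}
    (hC : ∀ ξ, ‖m ξ‖ ≤ C) (g : 𝓢(ℝ, ℂ)) :
    eLpNorm (fourierMultiplierCLM ℂ m g) 2 volume ≤ C * eLpNorm g 2 volume := by
  rw [← eLpNorm_fourier, ← eLpNorm_fourier g]
  have := eLpNorm_le_nnreal_smul_eLpNorm_of_ae_le_mul 
    (f := (𝓕 (fourierMultiplierCLM ℂ m g) : 𝓢(ℝ, ℂ))) (g := (𝓕 g : 𝓢(ℝ, ℂ)))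
    (c := C) (μ := volume) (Filter.Eventually.of_forall fun ξ => ?_) 2
  · exact this
  · rw [fourier_fourierMultiplierCLM hm, nnnorm_mul]
    gcongr
    exact hC ξ

namespace Regime

variable {δ κ : ℝ}

theorem eLpNorm_U_le (a : Amplitude) : ∃ C : ℝ≥0, ∀ (δ κ : ℝ) (G : Regime δ κ) (g : 𝓢(ℝ, ℂ)),
    eLpNorm (G.U a g) 2 volume ≤ C * eLpNorm g 2 volume := by
  obtain ⟨C, hC0, hC⟩ := a.exists_bound
  refine ⟨⟨C, hC0⟩, fun δ κ G g => ?_⟩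
  refine eLpNorm_fourierMultiplierCLM_le
    (hasTemperateGrowth_waveSymbol _ _ _ a.hasTemperateGrowth) (fun ξ => ?_) g
  rw [norm_symbol]
  exact hC _

/-- The right side is the separation `y - x` plus a lower bound `4πNt` for the distance travelled.
As `4π > 12`, the margin over `Nt` also dominates the distances of both points from `τ`, which makes
the kernel integrable against all of space. -/
theorem phase_lower_bound (G : Regime δ κ) {x y : ℝ} (hy : G.τ + 2 * G.ℓ ≤ y)
    (hx : x ≤ G.τ + G.ℓ + G.N * G.t) :
    κ / 8 * (G.D + |x - G.τ| + |y - G.τ|) ≤ (y - x) + 4 * Real.pi * (G.N * G.t) := by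
  have hNt := G.Nt_nonneg
  have hρ := G.ρ_pos
  have hκ := G.κ_pos
  have hℓ := G.le_ℓ
  have hκ1 := G.κ_le_one
  have hκρ : 0 < κ * G.ρ := mul_pos hκ hρ
  have hy0 : 0 ≤ y - G.τ := by linarith
  have hpi : 12 * (G.N * G.t) ≤ 4 * Real.pi * (G.N * G.t) := by
    have := Real.pi_gt_three
    nlinarith
  have h1 : κ / 8 * (G.D + |x - G.τ| + |y - G.τ|) ≤
      1 / 8 * (G.ℓ + G.N * G.t + |x - G.τ| + |y - G.τ|) := by
    unfold D
    have := mul_le_mul_of_nonneg_right hκ1 hNt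
    have := mul_le_mul_of_nonneg_right hκ1 (abs_nonneg (x - G.τ))
    have := mul_le_mul_of_nonneg_right hκ1 (abs_nonneg (y - G.τ))
    nlinarith
  refine h1.trans ?_
  rw [abs_of_nonneg hy0]
  rcases abs_cases (x - G.τ) with ⟨h, _⟩ | ⟨h, _⟩ <;> rw [h] <;> linarith

theorem norm_kernel_le (hκ : 0 < κ) (a : Amplitude) (K : ℕ) :
    ∃ C : ℝ, 0 ≤ C ∧ ∀ (G : Regime δ κ) (x y : ℝ),
    G.τ + 2 * G.ℓ ≤ y → x ≤ G.τ + G.ℓ + G.N * G.t →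
    ‖G.kernel a (x - y)‖ ≤ C * G.N * (G.N * (G.D + |x - G.τ| + |y - G.τ|))⁻¹ ^ K := by
  obtain ⟨C, hC0, hC⟩ := a.norm_oscillatory_le K 0
  refine ⟨C * (8 / κ) ^ K, by positivity, fun G x y hy hx => ?_⟩
  have hN := G.N_pos
  have hD := G.D_pos
  have hph := G.phase_lower_bound hy hx
  set S := G.D + |x - G.τ| + |y - G.τ| with hS
  have hS0 : 0 < S := by positivity
  set E := -(x - y) * G.N + 4 * Real.pi * (G.t * G.N ^ 2) with hE
  have hES : κ / 8 * (G.N * S) ≤ E := by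
    have : E = G.N * ((y - x) + 4 * Real.pi * (G.N * G.t)) := by rw [hE]; ring
    rw [this]
    calc κ / 8 * (G.N * S) = G.N * (κ / 8 * S) := by ring
      _ ≤ _ := mul_le_mul_of_nonneg_left hph hN.le
  have hE0 : 0 < E := lt_of_lt_of_le (by positivity) hES
  have hT0 : 0 ≤ G.t * G.N ^ 2 := mul_nonneg G.t_nonneg (by positivity)
  -- The side condition of `norm_oscillatory_le`: `y - x ≥ -Nt` uses up at most one of the more than
  -- twelve multiples of `Nt` available.
  have hTE : G.t * G.N ^ 2 ≤ 8 * E := by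
    have h1 : y - x ≥ -(G.N * G.t) := by
      have := G.le_ℓ
      have := mul_pos hκ G.ρ_pos
      linarith
    have h2 : E = G.N * ((y - x) + 4 * Real.pi * (G.N * G.t)) := by rw [hE]; ring
    have h3 : G.N * G.t ≤ 8 * ((y - x) + 4 * Real.pi * (G.N * G.t)) := by
      have := Real.pi_gt_three
      have := G.Nt_nonneg
      nlinarith
    rw [h2]
    nlinarith [mul_le_mul_of_nonneg_left h3 hN.le]
  have h := hC (-(x - y) * G.N) (G.t * G.N ^ 2) G.σ hT0 hE0 hTE G.sign
  simp only [pow_zero, Complex.ofReal_one, mul_one, zero_add] at h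
  rw [kernel_eq, norm_mul, Complex.norm_real, Real.norm_of_nonneg hN.le]
  calc _ ≤ G.N * (C * E⁻¹ ^ K) := mul_le_mul_of_nonneg_left h hN.le
    _ ≤ G.N * (C * ((κ / 8 * (G.N * S))⁻¹) ^ K) := by
        have : E⁻¹ ≤ (κ / 8 * (G.N * S))⁻¹ := inv_anti₀ (by positivity) hES
        have : 0 ≤ E⁻¹ := inv_nonneg.2 hE0.le
        gcongr
    _ = _ := by
        rw [mul_inv, mul_pow, inv_div]; ring

/-- Rapid decay of the dyadic piece in the region that the wave leaves. -/
theorem eLpNorm_near_le (hκ : 0 < κ) (a : Amplitude) (K : ℕ) :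
    ∃ C : ℝ≥0, ∀ (G : Regime δ κ) (g : 𝓢(ℝ, ℂ)), (∀ y < G.τ + 2 * G.ℓ, g y = 0) →
    eLpNorm (Set.indicator (Set.Iic (G.τ + G.ℓ + G.N * G.t)) (G.U a g)) 2 volume ≤
      C * ENNReal.ofReal ((G.N * G.D)⁻¹ ^ K) * eLpNorm g 2 volume := by
  set m := ⌈δ⁻¹⌉₊ with hm
  -- Of these powers `K` are kept for the decay, two supply the square-integrable factors in `x` and
  -- `y`, and `m` absorb the remaining `N⁻¹`, which may be as large as `ρ^(1-δ)`.
  obtain ⟨C, hC0, hC⟩ := norm_kernel_le (δ := δ) hκ a (K + m + 2)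
  set M := eLpNorm (fun x : ℝ => (1 + |x|)⁻¹) 2 volume with hM
  have hMt : M ≠ ⊤ := memLp_inv_one_add_abs.2.ne
  lift C to ℝ≥0 using hC0
  have hC0 := C.coe_nonneg
  refine ⟨(M ^ 2).toNNReal * C, fun G g hg => ?_⟩
  have hN := G.N_pos
  have hD := G.D_pos
  have hND := G.one_le_N_mul_D
  set B : ℝ := C * (G.N * G.D)⁻¹ ^ K with hB
  have hB0 : 0 ≤ B := by positivity
  have key := eLpNorm_le_of_product_bound
    (u := Set.indicator (Set.Iic (G.τ + G.ℓ + G.N * G.t)) (G.U a g)) (g := g) G.τ B hB0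
    g.continuous.measurable ?_
  · refine key.trans (le_of_eq ?_)
    rw [← hM, hB, ENNReal.ofReal_mul hC0, ENNReal.coe_mul,
      ENNReal.coe_toNNReal (ENNReal.pow_ne_top hMt), ENNReal.ofReal_coe_nnreal]
    ring
  intro x
  by_cases hx : x ∈ Set.Iic (G.τ + G.ℓ + G.N * G.t)
  swap
  · rw [Set.indicator_of_notMem hx, enorm_zero]; exact zero_le
  rw [Set.indicator_of_mem hx, U_apply]
  have hker : ∀ y, G.τ + 2 * G.ℓ ≤ y →
      ‖G.kernel a (x - y)‖ ≤ B * (1 + |x - G.τ|)⁻¹ * (1 + |y - G.τ|)⁻¹ := by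
    intro y hy
    refine (hC G x y hy hx).trans ?_
    set X := |x - G.τ| with hX
    set Y := |y - G.τ| with hY
    have hX0 : 0 ≤ X := abs_nonneg _
    have hY0 : 0 ≤ Y := abs_nonneg _
    have h1D := G.one_le_D
    have hS1 : G.D ≤ G.D + X + Y := by linarith
    have e1 : (G.N * (G.D + X + Y))⁻¹ ≤ (G.N * G.D)⁻¹ :=
      inv_anti₀ (by positivity) (by gcongr)
    have e2 : (G.N * (G.D + X + Y))⁻¹ ≤ (G.N * (1 + X))⁻¹ :=
      inv_anti₀ (by positivity) (mul_le_mul_of_nonneg_left (by linarith) hN.le)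
    have e3 : (G.N * (G.D + X + Y))⁻¹ ≤ (G.N * (1 + Y))⁻¹ :=
      inv_anti₀ (by positivity) (mul_le_mul_of_nonneg_left (by linarith) hN.le)
    have hv0 : 0 ≤ (G.N * (G.D + X + Y))⁻¹ := by positivity
    have e4 : G.N⁻¹ * (G.N * G.D)⁻¹ ^ m ≤ 1 := by
      rw [inv_pow, ← div_eq_mul_inv, div_le_one (by positivity)]
      exact G.inv_N_le_ρ.trans (G.ρ_le_pow.trans
        (pow_le_pow_left₀ (by have := G.ρ_pos; positivity) G.N_mul_ρ_le _))
    calc C * G.N * (G.N * (G.D + X + Y))⁻¹ ^ (K + m + 2)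
        = C * G.N * ((G.N * (G.D + X + Y))⁻¹ ^ K * (G.N * (G.D + X + Y))⁻¹ ^ m *
          (G.N * (G.D + X + Y))⁻¹ * (G.N * (G.D + X + Y))⁻¹) := by ring
      _ ≤ C * G.N * ((G.N * G.D)⁻¹ ^ K * (G.N * G.D)⁻¹ ^ m * (G.N * (1 + X))⁻¹ *
          (G.N * (1 + Y))⁻¹) := by gcongr
      _ = B * (1 + X)⁻¹ * (1 + Y)⁻¹ * (G.N⁻¹ * (G.N * G.D)⁻¹ ^ m) * (G.N * G.N⁻¹) := by
          rw [hB, mul_inv, mul_inv, mul_inv]; ring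
      _ ≤ B * (1 + X)⁻¹ * (1 + Y)⁻¹ * 1 * 1 := by
          rw [mul_inv_cancel₀ hN.ne']
          gcongr
      _ = _ := by ring
  calc ‖∫ y, G.kernel a (x - y) * g y‖ₑ ≤ ∫⁻ y, ‖G.kernel a (x - y) * g y‖ₑ :=
        enorm_integral_le_lintegral_enorm _
    _ ≤ ∫⁻ y, ENNReal.ofReal (B * (1 + |x - G.τ|)⁻¹) *
        (ENNReal.ofReal ((1 + |y - G.τ|)⁻¹) * ‖g y‖ₑ) := by
        refine lintegral_mono fun y => ?_
        rcases lt_or_ge y (G.τ + 2 * G.ℓ) with hy | hy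
        · simp [hg y hy]
        · rw [enorm_mul, ← mul_assoc, ← ENNReal.ofReal_mul (by positivity)]
          gcongr
          rw [← ofReal_norm]
          exact ENNReal.ofReal_le_ofReal (hker y hy)
    _ = _ := by
        rw [lintegral_const_mul]
        have := g.continuous.measurable
        fun_prop

end Regime

/-! ### Scaled Sobolev norms on the line -/

theorem ext_of_fourier {f g : 𝓢(ℝ, ℂ)} (h : ∀ ξ, (𝓕 f : 𝓢(ℝ, ℂ)) ξ = (𝓕 g : 𝓢(ℝ, ℂ)) ξ) : f = g := by
  have h' : (𝓕 f : 𝓢(ℝ, ℂ)) = 𝓕 g := SchwartzMap.ext h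
  simpa using congrArg (fun f : 𝓢(ℝ, ℂ) => (𝓕⁻ f : 𝓢(ℝ, ℂ))) h'

/-- The scaled Sobolev norm of a Schwartz function on the line. -/
def lineSobolev (s ρ : ℝ) (h : 𝓢(ℝ, ℂ)) : ℝ≥0∞ :=
  eLpNorm (fun ξ : ℝ => (((ξ ^ 2 + 1 / ρ ^ 2) ^ (s / 2) : ℝ) : ℂ) * (𝓕 h : 𝓢(ℝ, ℂ)) ξ) 2 volume

theorem measurable_lineSobolev_weight (s ρ : ℝ) :
    Measurable fun ξ : ℝ => (((ξ ^ 2 + 1 / ρ ^ 2) ^ (s / 2) : ℝ) : ℂ) := by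
  fun_prop

theorem aestronglyMeasurable_lineSobolev (s ρ : ℝ) (h : 𝓢(ℝ, ℂ)) : AEStronglyMeasurable
    (fun ξ : ℝ => (((ξ ^ 2 + 1 / ρ ^ 2) ^ (s / 2) : ℝ) : ℂ) * (𝓕 h : 𝓢(ℝ, ℂ)) ξ) volume :=
  ((measurable_lineSobolev_weight s ρ).mul (𝓕 h : 𝓢(ℝ, ℂ)).continuous.measurable).aestronglyMeasurable

/-- By the definition of the norm on the Fourier side, comparisons of norms reduce to pointwise
inequalities between symbols. -/
theorem lineSobolev_le_of_symbol {s s' ρ ρ' c : ℝ} {h h' : 𝓢(ℝ, ℂ)}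
    (hc : ∀ ξ : ℝ, (ξ ^ 2 + 1 / ρ ^ 2) ^ (s / 2) * ‖(𝓕 h : 𝓢(ℝ, ℂ)) ξ‖ ≤
      c * ((ξ ^ 2 + 1 / ρ' ^ 2) ^ (s' / 2) * ‖(𝓕 h' : 𝓢(ℝ, ℂ)) ξ‖)) :
    lineSobolev s ρ h ≤ ENNReal.ofReal c * lineSobolev s' ρ' h' := by
  refine eLpNorm_le_mul_eLpNorm_of_ae_le_mul (Filter.Eventually.of_forall fun ξ => ?_) 2
  rw [norm_mul, norm_mul, Complex.norm_real, Complex.norm_real,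
    Real.norm_of_nonneg (by positivity), Real.norm_of_nonneg (by positivity)]
  exact hc ξ

/-- Besides Plancherel, this lends the triangle inequality and homogeneity of `lineSobolev` to plain
L² norms; the scale is then immaterial. -/
theorem lineSobolev_zero (ρ : ℝ) (h : 𝓢(ℝ, ℂ)) : lineSobolev 0 ρ h = eLpNorm h 2 volume := by
  rw [← eLpNorm_fourier]
  simp [lineSobolev]

theorem lineSobolev_add_le (s ρ : ℝ) (h h' : 𝓢(ℝ, ℂ)) :
    lineSobolev s ρ (h + h') ≤ lineSobolev s ρ h + lineSobolev s ρ h' := by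
  refine le_trans (le_of_eq ?_) (eLpNorm_add_le (aestronglyMeasurable_lineSobolev s ρ h)
    (aestronglyMeasurable_lineSobolev s ρ h') (by norm_num))
  unfold lineSobolev
  congr 1
  funext ξ
  rw [FourierTransform.fourier_add]
  simp [mul_add]

theorem lineSobolev_smul (s ρ : ℝ) (c : ℂ) (h : 𝓢(ℝ, ℂ)) :
    lineSobolev s ρ (c • h) = ‖c‖ₑ * lineSobolev s ρ h := by
  unfold lineSobolev
  rw [← eLpNorm_const_smul]
  congr 1
  funext ξ
  rw [FourierTransform.fourier_smul]
  simp only [smul_apply, Pi.smul_apply, smul_eq_mul]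
  ring

theorem lineSobolev_sub_le (s ρ : ℝ) (h h' : 𝓢(ℝ, ℂ)) :
    lineSobolev s ρ (h - h') ≤ lineSobolev s ρ h + lineSobolev s ρ h' := by
  have := lineSobolev_add_le s ρ h ((-1 : ℂ) • h')
  rw [lineSobolev_smul] at this
  simpa [sub_eq_add_neg] using this

theorem fourier_derivCLM (h : 𝓢(ℝ, ℂ)) (ξ : ℝ) :
    (𝓕 (derivCLM ℂ ℂ h) : 𝓢(ℝ, ℂ)) ξ = (2 * Real.pi * Complex.I * ξ) * (𝓕 h : 𝓢(ℝ, ℂ)) ξ := by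
  rw [fourier_coe, fourier_coe]
  have h1 : ⇑(derivCLM ℂ ℂ h) = deriv h := funext fun x => derivCLM_apply _ _ _
  rw [h1, Real.fourier_deriv h.integrable h.differentiable (h1 ▸ (derivCLM ℂ ℂ h).integrable)]
  simp

theorem derivCLM_smulLeftCLM {b b' : ℝ → ℂ} (hb : b.HasTemperateGrowth)
    (hb' : b'.HasTemperateGrowth) (hd : ∀ x, HasDerivAt b (b' x) x) (h : 𝓢(ℝ, ℂ)) :
    derivCLM ℂ ℂ (smulLeftCLM ℂ b h) =
      smulLeftCLM ℂ b' h + smulLeftCLM ℂ b (derivCLM ℂ ℂ h) := by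
  ext x
  rw [derivCLM_apply]
  have h1 : ⇑(smulLeftCLM ℂ b h) = fun x => b x * h x := by
    funext x; rw [smulLeftCLM_apply_apply hb, smul_eq_mul]
  have h2 := ((hd x).mul (h.hasDerivAt x)).deriv
  rw [h1]
  refine h2.trans ?_
  simp only [add_apply, smulLeftCLM_apply_apply hb, smulLeftCLM_apply_apply hb',
    smul_eq_mul, derivCLM_apply]

theorem lineSobolev_derivCLM_le {s ρ : ℝ} (hρ : 0 < ρ) (h : 𝓢(ℝ, ℂ)) :
    lineSobolev (s - 1) ρ (derivCLM ℂ ℂ h) ≤ ENNReal.ofReal (2 * Real.pi) * lineSobolev s ρ h := by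
  refine lineSobolev_le_of_symbol fun ξ => ?_
  have hp : 0 < ξ ^ 2 + 1 / ρ ^ 2 := by positivity
  rw [fourier_derivCLM, norm_mul, sub_div, Real.rpow_sub hp]
  have h1 : ‖(2 * Real.pi * Complex.I * ξ : ℂ)‖ = 2 * Real.pi * |ξ| := by
    simp [abs_of_pos Real.pi_pos]
  have h2 : |ξ| ≤ (ξ ^ 2 + 1 / ρ ^ 2) ^ (1 / 2 : ℝ) := by
    rw [← Real.sqrt_eq_rpow, ← Real.sqrt_sq_eq_abs]
    exact Real.sqrt_le_sqrt (by have : 0 < 1 / ρ ^ 2 := by positivity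
                                linarith)
  have h3 : 0 < (ξ ^ 2 + 1 / ρ ^ 2) ^ (1 / 2 : ℝ) := by positivity
  rw [h1]
  calc (ξ ^ 2 + 1 / ρ ^ 2) ^ (s / 2) / (ξ ^ 2 + 1 / ρ ^ 2) ^ (1 / 2 : ℝ) *
        (2 * Real.pi * |ξ| * ‖(𝓕 h : 𝓢(ℝ, ℂ)) ξ‖)
      = 2 * Real.pi * ((ξ ^ 2 + 1 / ρ ^ 2) ^ (s / 2) * ‖(𝓕 h : 𝓢(ℝ, ℂ)) ξ‖) *
        (|ξ| / (ξ ^ 2 + 1 / ρ ^ 2) ^ (1 / 2 : ℝ)) := by ring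
    _ ≤ 2 * Real.pi * ((ξ ^ 2 + 1 / ρ ^ 2) ^ (s / 2) * ‖(𝓕 h : 𝓢(ℝ, ℂ)) ξ‖) * 1 := by
        gcongr
        exact (div_le_one h3).2 h2
    _ = _ := mul_one _

theorem lineSobolev_sub_one_le {s ρ : ℝ} (hρ : 0 < ρ) (h : 𝓢(ℝ, ℂ)) :
    lineSobolev (s - 1) ρ h ≤ ENNReal.ofReal ρ * lineSobolev s ρ h := by
  refine lineSobolev_le_of_symbol fun ξ => ?_
  have hp : 0 < ξ ^ 2 + 1 / ρ ^ 2 := by positivity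
  rw [sub_div, Real.rpow_sub hp]
  have h2 : ρ⁻¹ ≤ (ξ ^ 2 + 1 / ρ ^ 2) ^ (1 / 2 : ℝ) := by
    rw [← Real.sqrt_eq_rpow]
    refine Real.le_sqrt_of_sq_le ?_
    rw [inv_pow, one_div]
    nlinarith [sq_nonneg ξ]
  have h3 : 0 < (ξ ^ 2 + 1 / ρ ^ 2) ^ (1 / 2 : ℝ) := by positivity
  have h4 : ((ξ ^ 2 + 1 / ρ ^ 2) ^ (1 / 2 : ℝ))⁻¹ ≤ ρ := inv_le_of_inv_le₀ hρ h2
  rw [div_eq_mul_inv]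
  calc (ξ ^ 2 + 1 / ρ ^ 2) ^ (s / 2) * ((ξ ^ 2 + 1 / ρ ^ 2) ^ (1 / 2 : ℝ))⁻¹ *
        ‖(𝓕 h : 𝓢(ℝ, ℂ)) ξ‖ ≤ (ξ ^ 2 + 1 / ρ ^ 2) ^ (s / 2) * ρ * ‖(𝓕 h : 𝓢(ℝ, ℂ)) ξ‖ := by
        gcongr
    _ = _ := by ring

/-- Interpolation between the orders `0` and `-k` at frequency `N`. -/
theorem lineSobolev_neg_le {α ρ N : ℝ} {k : ℕ} (hα : 0 ≤ α) (hk : α ≤ k) (hρ : 0 < ρ) (hN : 0 < N)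
    (h : 𝓢(ℝ, ℂ)) : lineSobolev (-α) ρ h ≤ ENNReal.ofReal (N ^ (-α)) *
      (lineSobolev 0 ρ h + ENNReal.ofReal (N ^ k) * lineSobolev (-k) ρ h) := by
  have hm := measurable_lineSobolev_weight
  have hF := (𝓕 h : 𝓢(ℝ, ℂ)).continuous.measurable
  have e1 : ENNReal.ofReal (N ^ k) * lineSobolev (-k) ρ h = eLpNorm (fun ξ : ℝ => ((N ^ k : ℝ) : ℂ) *
      ((((ξ ^ 2 + 1 / ρ ^ 2) ^ (-(k : ℝ) / 2) : ℝ) : ℂ) * (𝓕 h : 𝓢(ℝ, ℂ)) ξ)) 2 volume := by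
    have := eLpNorm_const_smul ((N ^ k : ℝ) : ℂ) (fun ξ : ℝ =>
      (((ξ ^ 2 + 1 / ρ ^ 2) ^ (-(k : ℝ) / 2) : ℝ) : ℂ) * (𝓕 h : 𝓢(ℝ, ℂ)) ξ) 2 (volume : Measure ℝ)
    rw [← ofReal_norm, Complex.norm_real, Real.norm_of_nonneg (by positivity)] at this
    exact this.symm
  have hAm : AEStronglyMeasurable (fun ξ : ℝ => ‖(((ξ ^ 2 + 1 / ρ ^ 2) ^ ((0 : ℝ) / 2) : ℝ) : ℂ) *
      (𝓕 h : 𝓢(ℝ, ℂ)) ξ‖) volume := (aestronglyMeasurable_lineSobolev 0 ρ h).norm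
  have hBm : AEStronglyMeasurable (fun ξ : ℝ => ‖((N ^ k : ℝ) : ℂ) *
      ((((ξ ^ 2 + 1 / ρ ^ 2) ^ (-(k : ℝ) / 2) : ℝ) : ℂ) * (𝓕 h : 𝓢(ℝ, ℂ)) ξ)‖) volume :=
    ((aestronglyMeasurable_lineSobolev (-k) ρ h).const_mul _).norm
  have e2 := eLpNorm_add_le hAm hBm (p := 2) (by norm_num)
  rw [eLpNorm_norm, eLpNorm_norm, ← e1] at e2
  refine le_trans ?_ (mul_le_mul_right e2 _)
  refine eLpNorm_le_mul_eLpNorm_of_ae_le_mul (Filter.Eventually.of_forall fun ξ => ?_) 2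
  have hp : 0 < ξ ^ 2 + 1 / ρ ^ 2 := by positivity
  set X := ξ ^ 2 + 1 / ρ ^ 2
  simp only [Pi.add_apply, norm_mul, Complex.norm_real, zero_div, Real.rpow_zero, norm_one, one_mul]
  rw [Real.norm_of_nonneg (by positivity), Real.norm_of_nonneg (by positivity),
    Real.norm_of_nonneg (by positivity), Real.norm_of_nonneg (by positivity)]
  have hY : 0 < N * X ^ (-(1 / 2) : ℝ) := by positivity
  have h1 : ∀ r : ℝ, X ^ (-r / 2) = N ^ (-r) * (N * X ^ (-(1 / 2) : ℝ)) ^ r := by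
    intro r
    rw [Real.mul_rpow hN.le (by positivity), ← mul_assoc, ← Real.rpow_add hN, neg_add_cancel,
      Real.rpow_zero, one_mul, ← Real.rpow_mul hp.le]
    congr 1; ring
  have h2 : N ^ k * X ^ (-(k : ℝ) / 2) = (N * X ^ (-(1 / 2) : ℝ)) ^ (k : ℝ) := by
    rw [h1 k, ← mul_assoc, Real.rpow_neg hN.le, Real.rpow_natCast, mul_inv_cancel₀ (by positivity),
      one_mul]
  -- The pointwise form of the interpolation: for `0 ≤ α ≤ k` a power `Y^α` is at most `1` or at
  -- most `Y^k`, according to whether `Y ≤ 1`.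
  have h3 : (N * X ^ (-(1 / 2) : ℝ)) ^ α ≤ 1 + (N * X ^ (-(1 / 2) : ℝ)) ^ (k : ℝ) := by
    rcases le_total (N * X ^ (-(1 / 2) : ℝ)) 1 with h | h
    · have := Real.rpow_le_one hY.le h hα
      have : 0 ≤ (N * X ^ (-(1 / 2) : ℝ)) ^ (k : ℝ) := by positivity
      linarith
    · have := Real.rpow_le_rpow_of_exponent_le h hk
      linarith
  rw [← mul_assoc, h2, h1 α]
  calc _ ≤ N ^ (-α) * (1 + (N * X ^ (-(1 / 2) : ℝ)) ^ (k : ℝ)) * ‖(𝓕 h : 𝓢(ℝ, ℂ)) ξ‖ := by gcongr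
    _ = _ := by ring

/-! ### Trading derivatives for powers of the frequency -/

namespace Regime

variable {δ κ : ℝ}

/-- A derivative costs exactly `N`: in the rescaled variable `η = σξ/N` its symbol is `σN · 2πiη`,
which only changes the amplitude. -/
theorem U_derivCLM (G : Regime δ κ) (a : Amplitude) (g : 𝓢(ℝ, ℂ)) :
    G.U a (derivCLM ℂ ℂ g) = ((G.σ * G.N : ℝ) : ℂ) • G.U a.mulFreq g := by
  refine ext_of_fourier fun ξ => ?_
  simp only [U, wavePiece]
  rw [FourierTransform.fourier_smul, smul_apply,
    fourier_fourierMultiplierCLM (hasTemperateGrowth_waveSymbol _ _ _ a.hasTemperateGrowth),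
    fourier_fourierMultiplierCLM (hasTemperateGrowth_waveSymbol _ _ _ a.mulFreq.hasTemperateGrowth),
    fourier_derivCLM]
  simp only [waveSymbol, Amplitude.mulFreq, smul_eq_mul]
  have h : ((G.σ * G.N : ℝ) : ℂ) * ((G.σ / G.N * ξ : ℝ) : ℂ) = ξ := by
    rw [← Complex.ofReal_mul]
    congr 1
    have := G.N_pos.ne'
    have := G.σ_sq
    field_simp
    linear_combination ξ * this
  linear_combination (-2 * Real.pi * Complex.I * a.toFun (G.σ / G.N * ξ) *
    Complex.exp ((-(4 * Real.pi ^ 2 * (G.σ * G.t) * ξ ^ 2) : ℝ) * Complex.I) *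
    (𝓕 g : 𝓢(ℝ, ℂ)) ξ) * h

/-- The converse exchange, possible because `η ≥ 1` on the support of the amplitude. It is the
source of negative-order gains on the output side. -/
theorem U_eq_derivCLM (G : Regime δ κ) (a : Amplitude) (g : 𝓢(ℝ, ℂ)) :
    G.U a g = ((G.σ * G.N⁻¹ : ℝ) : ℂ) • derivCLM ℂ ℂ (G.U a.divFreq g) := by
  refine ext_of_fourier fun ξ => ?_
  simp only [U, wavePiece]
  rw [FourierTransform.fourier_smul, smul_apply, fourier_derivCLM,
    fourier_fourierMultiplierCLM (hasTemperateGrowth_waveSymbol _ _ _ a.hasTemperateGrowth),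
    fourier_fourierMultiplierCLM (hasTemperateGrowth_waveSymbol _ _ _ a.divFreq.hasTemperateGrowth)]
  have h := a.divFreq_mul (G.σ / G.N * ξ)
  simp only [waveSymbol, smul_eq_mul]
  rw [← h]
  push_cast
  rw [div_eq_mul_inv]
  ring

/-- `b` is a weight for which the dyadic pieces of waves emanating from data supported in
`{y | τ + 2 * ℓ ≤ y}` are bounded in `L²` by `Q`. -/
def WeightBound (b : Regime δ κ → ℝ → ℂ) (Q : Regime δ κ → ℝ≥0∞) : Prop :=
  ∀ a : Amplitude, ∃ C : ℝ≥0, ∀ (G : Regime δ κ) (g : 𝓢(ℝ, ℂ)), (∀ y < G.τ + 2 * G.ℓ, g y = 0) →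
    eLpNorm (fun x => b G x * G.U a g x) 2 volume ≤ C * Q G * eLpNorm g 2 volume

/-- `χ i` is `N⁻ⁱ` times the `i`-th derivative of a cutoff function to `{y | τ + 2 * ℓ ≤ y}`. -/
structure IsCutoff (G : Regime δ κ) (B : ℕ → ℝ) (χ : ℕ → ℝ → ℂ) : Prop where
  hasDerivAt : ∀ i x, HasDerivAt (χ i) (G.N * χ (i + 1) x) x
  bound : ∀ i x, ‖χ i x‖ ≤ B i
  eq_zero : ∀ i, ∀ x < G.τ + 2 * G.ℓ, χ i x = 0

theorem IsCutoff.hasTemperateGrowth {G : Regime δ κ} {B : ℕ → ℝ} {χ : ℕ → ℝ → ℂ}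
    (h : G.IsCutoff B χ) (i : ℕ) : (χ i).HasTemperateGrowth :=
  hasTemperateGrowth_of_bounded_derivatives (G.N : ℂ) h.hasDerivAt (fun i => ⟨B i, h.bound i⟩) i

/-- The symbol of the resolvent `(1 + ∂ / (2πN))⁻¹`. -/
def resolventSymbol (N : ℝ) (ξ : ℝ) : ℂ :=
  (1 - Complex.I * ((N⁻¹ * ξ : ℝ) : ℂ)) * (((1 + ‖N⁻¹ * ξ‖ ^ 2) ^ (-1 : ℝ) : ℝ) : ℂ)

theorem hasTemperateGrowth_resolventSymbol (N : ℝ) : (resolventSymbol N).HasTemperateGrowth := by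
  have h := (Function.hasTemperateGrowth_one_add_norm_sq_rpow ℝ (-1)).comp
    (f := fun ξ : ℝ => N⁻¹ * ξ) (by fun_prop)
  have h2 := Function.Complex.hasTemperateGrowth_ofReal.comp h
  unfold resolventSymbol
  refine Function.HasTemperateGrowth.mul ?_ h2
  fun_prop

theorem resolventSymbol_mul (N ξ : ℝ) :
    (1 + Complex.I * ((N⁻¹ * ξ : ℝ) : ℂ)) * resolventSymbol N ξ = 1 := by
  unfold resolventSymbol
  set X := N⁻¹ * ξ
  have h : (0 : ℝ) < 1 + ‖X‖ ^ 2 := by positivity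
  rw [Real.rpow_neg_one, ← mul_assoc]
  have e : (1 + Complex.I * (X : ℂ)) * (1 - Complex.I * X) = ((1 + ‖X‖ ^ 2 : ℝ) : ℂ) := by
    rw [Real.norm_eq_abs, sq_abs]
    push_cast
    linear_combination (-(X : ℂ) ^ 2) * Complex.I_sq
  rw [e, ← Complex.ofReal_mul, mul_inv_cancel₀ h.ne', Complex.ofReal_one]

theorem norm_resolventSymbol (N ξ : ℝ) :
    ‖resolventSymbol N ξ‖ = (1 + (N⁻¹ * ξ) ^ 2) ^ (-(1 / 2) : ℝ) := by
  have h := congrArg norm (resolventSymbol_mul N ξ)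
  set X := N⁻¹ * ξ
  have h1 : ‖1 + Complex.I * (X : ℂ)‖ = (1 + X ^ 2) ^ (1 / 2 : ℝ) := by
    rw [← Real.sqrt_eq_rpow, Complex.norm_eq_sqrt_sq_add_sq]
    simp
  have h2 : 0 < (1 + X ^ 2) ^ (1 / 2 : ℝ) := by positivity
  rw [norm_mul, h1, norm_one] at h
  rw [Real.rpow_neg (by positivity)]
  exact eq_inv_of_mul_eq_one_right h

/-- The resolvent `(1 + ∂ / (2πN))⁻¹` on Schwartz functions. -/
def resolvent (N : ℝ) : 𝓢(ℝ, ℂ) →L[ℂ] 𝓢(ℝ, ℂ) := fourierMultiplierCLM ℂ (resolventSymbol N)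

/-- Recovers the data from a smoother function at the price of one derivative weighted by `N⁻¹`.
Each use gains one negative order in the data. -/
theorem resolvent_add_deriv {N : ℝ} (hN : 0 < N) (F : 𝓢(ℝ, ℂ)) :
    F = resolvent N F + (((2 * Real.pi * N)⁻¹ : ℝ) : ℂ) • derivCLM ℂ ℂ (resolvent N F) := by
  refine ext_of_fourier fun ξ => ?_
  rw [FourierTransform.fourier_add, FourierTransform.fourier_smul, add_apply, smul_apply,
    fourier_derivCLM, resolvent, fourier_fourierMultiplierCLM (hasTemperateGrowth_resolventSymbol N)]
  have h := resolventSymbol_mul N ξ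
  have h2 : (((2 * Real.pi * N)⁻¹ : ℝ) : ℂ) * (2 * Real.pi * Complex.I * ξ) =
      Complex.I * ((N⁻¹ * ξ : ℝ) : ℂ) := by
    have : (Real.pi : ℂ) ≠ 0 := by exact_mod_cast Real.pi_ne_zero
    have : (N : ℂ) ≠ 0 := by exact_mod_cast hN.ne'
    push_cast
    field_simp
  rw [smul_eq_mul]
  linear_combination (-(𝓕 F : 𝓢(ℝ, ℂ)) ξ) * h -
    (resolventSymbol N ξ * (𝓕 F : 𝓢(ℝ, ℂ)) ξ) * h2

theorem fourier_iterate_resolvent (N : ℝ) (k : ℕ) (F : 𝓢(ℝ, ℂ)) (ξ : ℝ) :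
    (𝓕 ((resolvent N)^[k] F) : 𝓢(ℝ, ℂ)) ξ = resolventSymbol N ξ ^ k * (𝓕 F : 𝓢(ℝ, ℂ)) ξ := by
  induction k with
  | zero => simp
  | succ k ih =>
    rw [Function.iterate_succ_apply', resolvent,
      fourier_fourierMultiplierCLM (hasTemperateGrowth_resolventSymbol N), ← resolvent, ih]
    ring

/-- Each resolvent has symbol of modulus `N (N² + ξ²)^(-1/2)`, and `N² + ξ² ≥ ξ² + ρ⁻²` because the
frequency exceeds `ρ⁻¹`. Rounding the order `s` up to an integer number of resolvents is harmless
since the symbol is bounded by `1`. -/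
theorem eLpNorm_iterate_resolvent_le {ρ N s : ℝ} {k : ℕ} (hρ : 0 < ρ) (hN : 0 < N) (h : ρ⁻¹ ≤ N)
    (hs : 0 ≤ s) (hk : s ≤ k) (F : 𝓢(ℝ, ℂ)) : eLpNorm ((resolvent N)^[k] F) 2 volume ≤
      ENNReal.ofReal (N ^ s) * lineSobolev (-s) ρ F := by
  rw [← lineSobolev_zero ρ]
  refine lineSobolev_le_of_symbol fun ξ => ?_
  have hp : 0 < ξ ^ 2 + 1 / ρ ^ 2 := by positivity
  have hq : 1 ≤ 1 + (N⁻¹ * ξ) ^ 2 := by nlinarith [sq_nonneg (N⁻¹ * ξ)]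
  have hq0 : 0 < 1 + (N⁻¹ * ξ) ^ 2 := by linarith
  rw [fourier_iterate_resolvent, norm_mul, norm_pow, norm_resolventSymbol, zero_div, Real.rpow_zero,
    one_mul, ← mul_assoc, ← Real.rpow_natCast, ← Real.rpow_mul (by positivity)]
  refine mul_le_mul_of_nonneg_right ?_ (norm_nonneg _)
  have h1 : ξ ^ 2 + 1 / ρ ^ 2 ≤ N ^ 2 * (1 + (N⁻¹ * ξ) ^ 2) := by
    have e : N ^ 2 * (1 + (N⁻¹ * ξ) ^ 2) = N ^ 2 + ξ ^ 2 := by field_simp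
    have : 1 / ρ ^ 2 ≤ N ^ 2 := by
      rw [one_div, ← inv_pow]
      exact pow_le_pow_left₀ (by positivity) h 2
    linarith
  calc (1 + (N⁻¹ * ξ) ^ 2) ^ (-(1 / 2) * (k : ℝ))
      ≤ (1 + (N⁻¹ * ξ) ^ 2) ^ (-s / 2) :=
        Real.rpow_le_rpow_of_exponent_le hq (by linarith)
    _ = N ^ s * (N ^ 2 * (1 + (N⁻¹ * ξ) ^ 2)) ^ (-s / 2) := by
        rw [Real.mul_rpow (by positivity) hq0.le, ← Real.rpow_natCast N 2, ← Real.rpow_mul hN.le,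
          ← mul_assoc, ← Real.rpow_add hN]
        norm_num
        rw [show s + 2 * (-s / 2) = 0 by ring, Real.rpow_zero, one_mul]
    _ ≤ N ^ s * (ξ ^ 2 + 1 / ρ ^ 2) ^ (-s / 2) := by
        refine mul_le_mul_of_nonneg_left ?_ (by positivity)
        exact Real.rpow_le_rpow_of_nonpos hp h1 (by linarith)

end Regime

/-! ### Weighted bounds between negative Sobolev spaces -/

namespace Regime

variable {δ κ : ℝ}

theorem WeightBound.measurable_mul {b : ℝ → ℂ} (hb : Measurable b) (g : 𝓢(ℝ, ℂ)) :
    AEStronglyMeasurable (fun x => b x * g x) volume :=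
  (hb.mul g.continuous.measurable).aestronglyMeasurable

theorem eLpNorm_mul_add_le {b : ℝ → ℂ} (hb : Measurable b) (g h : 𝓢(ℝ, ℂ)) :
    eLpNorm (fun x => b x * (g + h) x) 2 volume ≤
      eLpNorm (fun x => b x * g x) 2 volume + eLpNorm (fun x => b x * h x) 2 volume := by
  refine le_trans (le_of_eq ?_) (eLpNorm_add_le (WeightBound.measurable_mul hb g)
    (WeightBound.measurable_mul hb h) (by norm_num))
  congr 1
  funext x
  simp [mul_add]

theorem eLpNorm_mul_smul (b : ℝ → ℂ) (c : ℂ) (g : 𝓢(ℝ, ℂ)) :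
    eLpNorm (fun x => b x * (c • g) x) 2 volume = ‖c‖ₑ * eLpNorm (fun x => b x * g x) 2 volume := by
  rw [← eLpNorm_const_smul]
  congr 1
  funext x
  simp only [smul_apply, smul_eq_mul, Pi.smul_apply]
  ring

theorem eLpNorm_smulLeftCLM_le {χ : ℝ → ℂ} (hχ : χ.HasTemperateGrowth) {B : ℝ} (hB : ∀ x, ‖χ x‖ ≤ B)
    (F : 𝓢(ℝ, ℂ)) : eLpNorm (smulLeftCLM ℂ χ F) 2 volume ≤ ENNReal.ofReal B * eLpNorm F 2 volume := by
  refine eLpNorm_le_mul_eLpNorm_of_ae_le_mul (Filter.Eventually.of_forall fun x => ?_) 2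
  rw [smulLeftCLM_apply_apply hχ, norm_smul]
  exact mul_le_mul_of_nonneg_right (hB x) (norm_nonneg _)

/-- The derivative from `resolvent_add_deriv` is moved to the left by the Leibniz rule: it falls on
the cutoff, advancing its index, or on the multiplier, changing its amplitude. The factors `N`
produced cancel the `N⁻¹`, and all three resulting terms have bounded coefficients. -/
theorem U_cutoff_eq (G : Regime δ κ) {B : ℕ → ℝ} {χ : ℕ → ℝ → ℂ} (hχ : G.IsCutoff B χ)
    (a : Amplitude) (i : ℕ) (F : 𝓢(ℝ, ℂ)) :
    G.U a (smulLeftCLM ℂ (χ i) F) = G.U a (smulLeftCLM ℂ (χ i) (resolvent G.N F)) +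
      ((((2 * Real.pi)⁻¹ * G.σ : ℝ) : ℂ) • G.U a.mulFreq (smulLeftCLM ℂ (χ i) (resolvent G.N F)) +
      ((-(2 * Real.pi)⁻¹ : ℝ) : ℂ) • G.U a (smulLeftCLM ℂ (χ (i + 1)) (resolvent G.N F))) := by
  have hN := G.N_pos
  set Φ := resolvent G.N F with hΦ
  have h1 := derivCLM_smulLeftCLM (b' := fun x => (G.N : ℂ) * χ (i + 1) x) (hχ.hasTemperateGrowth i)
    (Function.HasTemperateGrowth.mul (Function.HasTemperateGrowth.const _)
      (hχ.hasTemperateGrowth (i + 1))) (hχ.hasDerivAt i) Φ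
  have h2 : smulLeftCLM ℂ (fun x => (G.N : ℂ) * χ (i + 1) x) Φ =
      (G.N : ℂ) • smulLeftCLM ℂ (χ (i + 1)) Φ := by
    have := congrArg (fun T => T Φ) (smulLeftCLM_smul (F := ℂ) (hχ.hasTemperateGrowth (i + 1)) (G.N : ℂ))
    exact this
  rw [h2] at h1
  have h3 : smulLeftCLM ℂ (χ i) (derivCLM ℂ ℂ Φ) =
      derivCLM ℂ ℂ (smulLeftCLM ℂ (χ i) Φ) - (G.N : ℂ) • smulLeftCLM ℂ (χ (i + 1)) Φ := by
    rw [h1]; abel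
  conv_lhs => rw [resolvent_add_deriv hN F, ← hΦ]
  rw [map_add, map_smul, h3, map_add, map_smul, map_sub, map_smul, U_derivCLM, smul_sub, smul_smul,
    smul_smul, sub_eq_add_neg, ← neg_smul]
  congr 3
  · rw [← Complex.ofReal_mul]
    congr 1
    field_simp
  · rw [← Complex.ofReal_mul, ← Complex.ofReal_neg]
    congr 2
    field_simp

/-- The induction must run over all amplitudes and all derivatives of the cutoff simultaneously,
since one step of `U_cutoff_eq` changes either. Support in `{y | τ + 2 * ℓ ≤ y}` survives
throughout, so the hypothesis on the weight applies at the end. -/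
theorem WeightBound.cutoff_iterate {b : Regime δ κ → ℝ → ℂ} {Q : Regime δ κ → ℝ≥0∞}
    (hb : WeightBound b Q) (hbm : ∀ G, Measurable (b G)) (B : ℕ → ℝ) (k : ℕ) :
    ∀ (a : Amplitude) (i : ℕ), ∃ C : ℝ≥0, ∀ (G : Regime δ κ) (χ : ℕ → ℝ → ℂ), G.IsCutoff B χ →
      ∀ F : 𝓢(ℝ, ℂ), eLpNorm (fun x => b G x * G.U a (smulLeftCLM ℂ (χ i) F) x) 2 volume ≤
        C * Q G * eLpNorm ((resolvent G.N)^[k] F) 2 volume := by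
  induction k with
  | zero =>
    intro a i
    obtain ⟨C, hC⟩ := hb a
    refine ⟨C * (B i).toNNReal, fun G χ hχ F => ?_⟩
    refine (hC G _ fun y hy => ?_).trans ?_
    · rw [smulLeftCLM_apply_apply (hχ.hasTemperateGrowth i), hχ.eq_zero i y hy, zero_smul]
    · refine (mul_le_mul_right
        (eLpNorm_smulLeftCLM_le (hχ.hasTemperateGrowth i) (hχ.bound i) F) _).trans (le_of_eq ?_)
      rw [Function.iterate_zero, id, ENNReal.coe_mul, ENNReal.ofReal]
      ring
  | succ k ih =>
    intro a i
    obtain ⟨C1, h1⟩ := ih a i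
    obtain ⟨C2, h2⟩ := ih a.mulFreq i
    obtain ⟨C3, h3⟩ := ih a (i + 1)
    refine ⟨C1 + (C2 + C3), fun G χ hχ F => ?_⟩
    have hpi : (2 * Real.pi)⁻¹ ≤ 1 := inv_le_one_of_one_le₀ (by linarith [Real.pi_gt_three])
    have hpi0 : 0 ≤ (2 * Real.pi)⁻¹ := by positivity
    have hc : ∀ r : ℝ, |r| ≤ 1 → ‖(r : ℂ)‖ₑ ≤ 1 := fun r hr => by
      rw [← ofReal_norm, Complex.norm_real, Real.norm_eq_abs]
      exact ENNReal.ofReal_le_one.2 hr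
    rw [U_cutoff_eq G hχ, Function.iterate_succ_apply, ENNReal.coe_add, ENNReal.coe_add, add_mul,
      add_mul, add_mul, add_mul]
    refine (eLpNorm_mul_add_le (hbm G) _ _).trans (add_le_add (h1 G χ hχ _) ?_)
    refine (eLpNorm_mul_add_le (hbm G) _ _).trans (add_le_add ?_ ?_)
    · rw [eLpNorm_mul_smul]
      refine (mul_le_of_le_one_left zero_le (hc _ ?_)).trans (h2 G χ hχ _)
      rw [abs_mul, G.abs_σ, mul_one, abs_of_nonneg hpi0]
      exact hpi
    · rw [eLpNorm_mul_smul]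
      refine (mul_le_of_le_one_left zero_le (hc _ ?_)).trans (h3 G χ hχ _)
      rw [abs_neg, abs_of_nonneg hpi0]
      exact hpi

/-- Weighted bounds for the dyadic piece in terms of a negative Sobolev norm of the data. -/
theorem WeightBound.cutoff {b : Regime δ κ → ℝ → ℂ} {Q : Regime δ κ → ℝ≥0∞}
    (hb : WeightBound b Q) (hbm : ∀ G, Measurable (b G)) (B : ℕ → ℝ) {s : ℝ} (hs : 0 ≤ s)
    (a : Amplitude) : ∃ C : ℝ≥0, ∀ (G : Regime δ κ) (χ : ℕ → ℝ → ℂ), G.IsCutoff B χ →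
      ∀ F : 𝓢(ℝ, ℂ), eLpNorm (fun x => b G x * G.U a (smulLeftCLM ℂ (χ 0) F) x) 2 volume ≤
        C * Q G * (ENNReal.ofReal (G.N ^ s) * lineSobolev (-s) G.ρ F) := by
  obtain ⟨k, hk⟩ := exists_nat_ge s
  obtain ⟨C, hC⟩ := hb.cutoff_iterate hbm B k a 0
  exact ⟨C, fun G χ hχ F => (hC G χ hχ F).trans (mul_le_mul_right
    (eLpNorm_iterate_resolvent_le G.ρ_pos G.N_pos G.inv_ρ_le_N hs hk F) _)⟩

/-- `b i` is `ρⁱ` times the `i`-th derivative of a bounded weight. -/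
structure IsSymbol (b : ℕ → Regime δ κ → ℝ → ℂ) : Prop where
  hasDerivAt : ∀ i G x, HasDerivAt (b i G) ((G.ρ⁻¹ : ℝ) * b (i + 1) G x) x
  bound : ∀ i G, ∃ C, ∀ x, ‖b i G x‖ ≤ C

theorem IsSymbol.hasTemperateGrowth {b : ℕ → Regime δ κ → ℝ → ℂ} (hb : IsSymbol b) (i : ℕ)
    (G : Regime δ κ) : (b i G).HasTemperateGrowth :=
  hasTemperateGrowth_of_bounded_derivatives (b := fun i => b i G) ((G.ρ⁻¹ : ℝ) : ℂ)
    (fun i x => hb.hasDerivAt i G x) (fun i => hb.bound i G) i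

/-- The piece is written as a derivative, and the Leibniz rule pulls that derivative out past the
weight. The commutator costs `ρ⁻¹`. -/
theorem IsSymbol.smul_U_eq {b : ℕ → Regime δ κ → ℝ → ℂ} (hb : IsSymbol b) (i : ℕ)
    (G : Regime δ κ) (a : Amplitude) (g : 𝓢(ℝ, ℂ)) :
    smulLeftCLM ℂ (b i G) (G.U a g) = ((G.σ * G.N⁻¹ : ℝ) : ℂ) •
      (derivCLM ℂ ℂ (smulLeftCLM ℂ (b i G) (G.U a.divFreq g)) -
        ((G.ρ⁻¹ : ℝ) : ℂ) • smulLeftCLM ℂ (b (i + 1) G) (G.U a.divFreq g)) := by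
  have h1 := derivCLM_smulLeftCLM (b' := fun x => ((G.ρ⁻¹ : ℝ) : ℂ) * b (i + 1) G x)
    (hb.hasTemperateGrowth i G)
    (Function.HasTemperateGrowth.mul (Function.HasTemperateGrowth.const _)
      (hb.hasTemperateGrowth (i + 1) G)) (hb.hasDerivAt i G) (G.U a.divFreq g)
  have h2 : smulLeftCLM ℂ (fun x => ((G.ρ⁻¹ : ℝ) : ℂ) * b (i + 1) G x) (G.U a.divFreq g) =
      ((G.ρ⁻¹ : ℝ) : ℂ) • smulLeftCLM ℂ (b (i + 1) G) (G.U a.divFreq g) :=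
    congrArg (fun T => T (G.U a.divFreq g))
      (smulLeftCLM_smul (F := ℂ) (hb.hasTemperateGrowth (i + 1) G) ((G.ρ⁻¹ : ℝ) : ℂ))
  rw [h1, h2, add_sub_cancel_left, ← map_smul, ← U_eq_derivCLM]

/-- Each step gains `N⁻¹` and one negative order. In the commutator term the factor `ρ⁻¹` is
balanced by the cost `ρ` of lowering the order, so both terms have the same size. -/
theorem IsSymbol.lineSobolev_le {b : ℕ → Regime δ κ → ℝ → ℂ} (hb : IsSymbol b)
    (C : Amplitude → ℕ → ℝ≥0) (k : ℕ) : ∀ (a : Amplitude) (i : ℕ), ∃ C' : ℝ≥0,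
      ∀ (G : Regime δ κ) (g : 𝓢(ℝ, ℂ)) (A : ℝ≥0∞),
      (∀ a i, eLpNorm (fun x => b i G x * G.U a g x) 2 volume ≤ C a i * A) →
      ENNReal.ofReal (G.N ^ k) * lineSobolev (-k) G.ρ (smulLeftCLM ℂ (b i G) (G.U a g)) ≤ C' * A := by
  induction k with
  | zero =>
    intro a i
    refine ⟨C a i, fun G g A h => le_trans (le_of_eq ?_) (h a i)⟩
    rw [Nat.cast_zero, neg_zero, lineSobolev_zero, pow_zero, ENNReal.ofReal_one, one_mul]
    congr 1
    funext x
    rw [smulLeftCLM_apply_apply (hb.hasTemperateGrowth i G), smul_eq_mul]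
  | succ k ih =>
    intro a i
    obtain ⟨C1, h1⟩ := ih a.divFreq i
    obtain ⟨C2, h2⟩ := ih a.divFreq (i + 1)
    refine ⟨(2 * Real.pi).toNNReal * C1 + C2, fun G g A h => ?_⟩
    have hN := G.N_pos
    have hρ := G.ρ_pos
    specialize h1 G g A h
    specialize h2 G g A h
    set u := smulLeftCLM ℂ (b i G) (G.U a.divFreq g)
    set v := smulLeftCLM ℂ (b (i + 1) G) (G.U a.divFreq g)
    have e1 : ‖((G.σ * G.N⁻¹ : ℝ) : ℂ)‖ₑ = ENNReal.ofReal G.N⁻¹ := by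
      rw [← ofReal_norm, Complex.norm_real, Real.norm_eq_abs, abs_mul, G.abs_σ, one_mul,
        abs_of_pos (inv_pos.2 hN)]
    have e2 : ‖((G.ρ⁻¹ : ℝ) : ℂ)‖ₑ = ENNReal.ofReal G.ρ⁻¹ := by
      rw [← ofReal_norm, Complex.norm_real, Real.norm_of_nonneg (inv_nonneg.2 hρ.le)]
    have e3 : ENNReal.ofReal (G.N ^ (k + 1)) * ENNReal.ofReal G.N⁻¹ = ENNReal.ofReal (G.N ^ k) := by
      rw [← ENNReal.ofReal_mul (by positivity), pow_succ, mul_assoc, mul_inv_cancel₀ hN.ne', mul_one]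
    have e4 : ENNReal.ofReal G.ρ⁻¹ * ENNReal.ofReal G.ρ = 1 := by
      rw [← ENNReal.ofReal_mul (by positivity), inv_mul_cancel₀ hρ.ne', ENNReal.ofReal_one]
    have e5 : (-((k + 1 : ℕ) : ℝ)) = -k - 1 := by push_cast; ring
    rw [hb.smul_U_eq, lineSobolev_smul, e1, ← mul_assoc, e3, e5]
    calc ENNReal.ofReal (G.N ^ k) * lineSobolev (-k - 1) G.ρ (derivCLM ℂ ℂ u - ((G.ρ⁻¹ : ℝ) : ℂ) • v)
        ≤ ENNReal.ofReal (G.N ^ k) * (ENNReal.ofReal (2 * Real.pi) * lineSobolev (-k) G.ρ u +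
          ENNReal.ofReal G.ρ⁻¹ * (ENNReal.ofReal G.ρ * lineSobolev (-k) G.ρ v)) := by
          gcongr
          refine (lineSobolev_sub_le _ _ _ _).trans (add_le_add (lineSobolev_derivCLM_le hρ u) ?_)
          rw [lineSobolev_smul, e2]
          gcongr
          exact lineSobolev_sub_one_le hρ v
      _ = ENNReal.ofReal (2 * Real.pi) * (ENNReal.ofReal (G.N ^ k) * lineSobolev (-k) G.ρ u) +
          ENNReal.ofReal (G.N ^ k) * lineSobolev (-k) G.ρ v := by
          rw [← mul_assoc (ENNReal.ofReal G.ρ⁻¹), e4]; ring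
      _ ≤ ENNReal.ofReal (2 * Real.pi) * (C1 * A) + C2 * A := by gcongr
      _ = _ := by
          rw [ENNReal.coe_add, ENNReal.coe_mul, ENNReal.ofReal]; ring

/-- Weighted bounds for the dyadic piece between negative Sobolev spaces. -/
theorem IsSymbol.lineSobolev_cutoff_le {b : ℕ → Regime δ κ → ℝ → ℂ} (hb : IsSymbol b)
    {Q : Regime δ κ → ℝ≥0∞} (hQ : ∀ i, WeightBound (b i) Q) (B : ℕ → ℝ) {α s : ℝ} (hα : 0 ≤ α)
    (hs : 0 ≤ s) (a : Amplitude) : ∃ C : ℝ≥0, ∀ (G : Regime δ κ) (χ : ℕ → ℝ → ℂ), G.IsCutoff B χ →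
      ∀ F : 𝓢(ℝ, ℂ),
        lineSobolev (-α) G.ρ (smulLeftCLM ℂ (b 0 G) (G.U a (smulLeftCLM ℂ (χ 0) F))) ≤
        C * ENNReal.ofReal (G.N ^ (s - α)) * Q G * lineSobolev (-s) G.ρ F := by
  obtain ⟨k, hk⟩ := exists_nat_ge α
  have hbm : ∀ i G, Measurable (b i G) := fun i G =>
    (hb.hasTemperateGrowth i G).1.continuous.measurable
  choose C hC using fun (a : Amplitude) (i : ℕ) => (hQ i).cutoff (hbm i) B hs a
  obtain ⟨C0, h0⟩ := hb.lineSobolev_le C 0 a 0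
  obtain ⟨C1, h1⟩ := hb.lineSobolev_le C k a 0
  refine ⟨C0 + C1, fun G χ hχ F => ?_⟩
  have hN := G.N_pos
  set A := Q G * (ENNReal.ofReal (G.N ^ s) * lineSobolev (-s) G.ρ F) with hA
  have hyp : ∀ a i, eLpNorm (fun x => b i G x * G.U a (smulLeftCLM ℂ (χ 0) F) x) 2 volume ≤
      C a i * A := fun a i => (hC a i G χ hχ F).trans (le_of_eq (by rw [hA]; ring))
  specialize h0 G _ A hyp
  specialize h1 G _ A hyp
  simp only [Nat.cast_zero, neg_zero, pow_zero, ENNReal.ofReal_one, one_mul] at h0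
  -- The orders `0` and `-k` are both controlled by `A`; interpolation at frequency `N` reaches the
  -- real order `-α`.
  calc _ ≤ _ := lineSobolev_neg_le hα hk G.ρ_pos hN _
    _ ≤ ENNReal.ofReal (G.N ^ (-α)) * (C0 * A + C1 * A) := by gcongr
    _ = _ := by
      rw [hA, sub_eq_add_neg, Real.rpow_add hN, ENNReal.ofReal_mul (by positivity), ENNReal.coe_add]
      ring

end Regime

/-! ### Bounds for weights, in particular ⟨x⟩⁻² and its derivatives -/

namespace Regime

variable {δ κ : ℝ}

theorem norm_bracket_ge (G : Regime δ κ) {x : ℝ} (hx : G.τ + G.ℓ + G.N * G.t < x) :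
    κ / 5 * G.D ≤ √(1 + x ^ 2) := by
  have hκ := G.κ_pos
  have hκ1 := G.κ_le_one
  have hNt := G.Nt_nonneg
  have hℓ := G.le_ℓ
  have hρ := G.ρ_pos
  have hκρ := mul_pos hκ hρ
  have h1 : 1 ≤ √(1 + x ^ 2) := Real.one_le_sqrt.2 (by nlinarith [sq_nonneg x])
  have h2 : x ≤ √(1 + x ^ 2) := Real.le_sqrt_of_sq_le (by linarith)
  have h3 : κ * (G.N * G.t) ≤ G.N * G.t := mul_le_of_le_one_left hNt hκ1
  unfold D
  rcases G.position with h | ⟨h, hr⟩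
  · rw [h] at hx
    nlinarith
  -- For R = 0 the shift by 3 is compensated by `⟨x⟩ ≥ 1`: `x + 3 ≤ 4⟨x⟩`, which the factor 5 in the
  -- statement accommodates.
  · rw [h] at hx
    rw [hr] at hℓ ⊢
    nlinarith

theorem weightBound_near (hκ : 0 < κ) {b : Regime δ κ → ℝ → ℂ} (B : ℝ) (hB : ∀ G x, ‖b G x‖ ≤ B)
    (hb : ∀ G x, G.τ + G.ℓ + G.N * G.t < x → b G x = 0) (K : ℕ) :
    WeightBound b fun G => ENNReal.ofReal ((G.N * G.D)⁻¹ ^ K) := by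
  intro a
  obtain ⟨C, hC⟩ := eLpNorm_near_le (δ := δ) hκ a K
  refine ⟨B.toNNReal * C, fun G g hg => ?_⟩
  have h : eLpNorm (fun x => b G x * G.U a g x) 2 volume ≤ ENNReal.ofReal B *
      eLpNorm (Set.indicator (Set.Iic (G.τ + G.ℓ + G.N * G.t)) (G.U a g)) 2 volume := by
    refine eLpNorm_le_mul_eLpNorm_of_ae_le_mul (Filter.Eventually.of_forall fun x => ?_) 2
    rcases le_or_gt x (G.τ + G.ℓ + G.N * G.t) with hx | hx
    · rw [Set.indicator_of_mem (Set.mem_Iic.2 hx), norm_mul]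
      exact mul_le_mul_of_nonneg_right (hB G x) (norm_nonneg _)
    · rw [hb G x hx, zero_mul, norm_zero]
      exact mul_nonneg ((norm_nonneg _).trans (hB G x)) (norm_nonneg _)
  refine h.trans ((mul_le_mul_right (hC G g hg) _).trans (le_of_eq ?_))
  rw [ENNReal.coe_mul, ENNReal.ofReal]
  ring

/-- Space is split at the edge of the region left by the wave. Behind it the weight may be as large
as `ρ^m`, against rapid decay of the wave; ahead of it the weight is small and the wave is merely
bounded in L². -/
theorem weightBound_decaying (hκ : 0 < κ) {b : Regime δ κ → ℝ → ℂ}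
    (hbm : ∀ G, Measurable (b G)) (B : ℝ) (m : ℕ)
    (hB : ∀ G x, ‖b G x‖ ≤ B * G.ρ ^ m)
    (hb : ∀ G x, G.τ + G.ℓ + G.N * G.t < x → ‖b G x‖ ≤ B * (G.D ^ 2)⁻¹) :
    WeightBound b fun G => ENNReal.ofReal (G.D ^ 2)⁻¹ := by
  intro a
  -- The number of powers comes from `D ≤ (ND)ρ`, so that `D² ρ^m ≤ (ND)² ρ^(m+2)`, and each `ρ`
  -- costs `⌈δ⁻¹⌉` further powers of `ND`.
  obtain ⟨C1, hC1⟩ := eLpNorm_near_le (δ := δ) hκ a (2 + ⌈δ⁻¹⌉₊ * (m + 2))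
  obtain ⟨C2, hC2⟩ := eLpNorm_U_le a
  refine ⟨B.toNNReal * C1 + B.toNNReal * C2, fun G g hg => ?_⟩
  set S := Set.Iic (G.τ + G.ℓ + G.N * G.t) with hS
  have hN := G.N_pos
  have hD := G.D_pos
  have hρ := G.ρ_pos
  have hB0 : 0 ≤ B := by
    have h := (norm_nonneg _).trans (hB G 0)
    by_contra! h0
    have := mul_neg_of_neg_of_pos h0 (pow_pos hρ m)
    linarith
  have hgm : AEStronglyMeasurable (fun x => b G x * G.U a g x) volume :=
    ((hbm G).mul (G.U a g).continuous.measurable).aestronglyMeasurable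
  have hsplit := eLpNorm_add_le (hgm.indicator (measurableSet_Iic : MeasurableSet S))
    (hgm.indicator (measurableSet_Iic : MeasurableSet S).compl) (p := 2) (by norm_num)
  rw [Set.indicator_self_add_compl] at hsplit
  refine hsplit.trans ?_
  have h1 : eLpNorm (S.indicator fun x => b G x * G.U a g x) 2 volume ≤
      ENNReal.ofReal (B * G.ρ ^ m) * eLpNorm (S.indicator (G.U a g)) 2 volume := by
    refine eLpNorm_le_mul_eLpNorm_of_ae_le_mul (Filter.Eventually.of_forall fun x => ?_) 2
    by_cases hx : x ∈ S
    · rw [Set.indicator_of_mem hx, Set.indicator_of_mem hx, norm_mul]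
      exact mul_le_mul_of_nonneg_right (hB G x) (norm_nonneg _)
    · rw [Set.indicator_of_notMem hx, Set.indicator_of_notMem hx]
      simp
  have h2 : eLpNorm (Sᶜ.indicator fun x => b G x * G.U a g x) 2 volume ≤
      ENNReal.ofReal (B * (G.D ^ 2)⁻¹) * eLpNorm (G.U a g) 2 volume := by
    refine eLpNorm_le_mul_eLpNorm_of_ae_le_mul (Filter.Eventually.of_forall fun x => ?_) 2
    by_cases hx : x ∈ Sᶜ
    · rw [Set.indicator_of_mem hx, norm_mul]
      exact mul_le_mul_of_nonneg_right (hb G x (not_le.1 hx)) (norm_nonneg _)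
    · rw [Set.indicator_of_notMem hx, norm_zero]
      positivity
  have h3 : G.ρ ^ m * (G.N * G.D)⁻¹ ^ (2 + ⌈δ⁻¹⌉₊ * (m + 2)) ≤ (G.D ^ 2)⁻¹ := by
    have hρp : G.ρ ≤ (G.N * G.D) ^ ⌈δ⁻¹⌉₊ := G.ρ_le_pow.trans
      (pow_le_pow_left₀ (by positivity) G.N_mul_ρ_le _)
    have hDle : G.D ≤ G.N * G.D * G.ρ := by
      have := mul_le_mul_of_nonneg_right G.one_le_N_mul_ρ hD.le
      nlinarith
    have key : G.D ^ 2 * G.ρ ^ m ≤ (G.N * G.D) ^ (2 + ⌈δ⁻¹⌉₊ * (m + 2)) := by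
      calc G.D ^ 2 * G.ρ ^ m ≤ (G.N * G.D * G.ρ) ^ 2 * G.ρ ^ m := by gcongr
        _ = (G.N * G.D) ^ 2 * G.ρ ^ (m + 2) := by ring
        _ ≤ (G.N * G.D) ^ 2 * ((G.N * G.D) ^ ⌈δ⁻¹⌉₊) ^ (m + 2) := by gcongr
        _ = _ := by rw [← pow_mul, ← pow_add]
    rw [inv_pow, ← div_eq_mul_inv, div_le_iff₀ (by positivity), ← div_eq_inv_mul,
      le_div_iff₀ (by positivity)]
    linarith
  calc _ ≤ ENNReal.ofReal (B * G.ρ ^ m) * (C1 * ENNReal.ofReal ((G.N * G.D)⁻¹ ^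
        (2 + ⌈δ⁻¹⌉₊ * (m + 2))) * eLpNorm g 2 volume) +
        ENNReal.ofReal (B * (G.D ^ 2)⁻¹) * (C2 * eLpNorm g 2 volume) :=
        add_le_add (h1.trans (mul_le_mul_right (hC1 G g hg) _))
          (h2.trans (mul_le_mul_right (hC2 δ κ G g) _))
    _ = (ENNReal.ofReal B * C1 * ENNReal.ofReal (G.ρ ^ m * (G.N * G.D)⁻¹ ^
        (2 + ⌈δ⁻¹⌉₊ * (m + 2))) + ENNReal.ofReal B * C2 * ENNReal.ofReal (G.D ^ 2)⁻¹) *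
          eLpNorm g 2 volume := by
        rw [ENNReal.ofReal_mul hB0, ENNReal.ofReal_mul hB0, ENNReal.ofReal_mul (by positivity)]
        ring
    _ ≤ (ENNReal.ofReal B * C1 * ENNReal.ofReal (G.D ^ 2)⁻¹ +
        ENNReal.ofReal B * C2 * ENNReal.ofReal (G.D ^ 2)⁻¹) * eLpNorm g 2 volume := by
        gcongr
    _ = _ := by
        rw [ENNReal.coe_add, ENNReal.coe_mul, ENNReal.coe_mul, ENNReal.ofReal]
        ring

end Regime

open Polynomial in
/-- The numerators of the derivatives of `(1 + x²)⁻¹`. -/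
def invSqNumerator : ℕ → Polynomial ℝ
  | 0 => 1
  | n + 1 => derivative (invSqNumerator n) * (1 + X ^ 2) -
      C (2 * ((n : ℝ) + 1)) * X * invSqNumerator n

/-- The derivatives of `(1 + x²)⁻¹`. -/
def invSqDeriv (n : ℕ) (x : ℝ) : ℝ := (invSqNumerator n).eval x / (1 + x ^ 2) ^ (n + 1)

/-- The degree bound is what makes every derivative of `(1 + x²)⁻¹` gain a power of `⟨x⟩⁻¹`. -/
theorem natDegree_invSqNumerator_le (n : ℕ) : (invSqNumerator n).natDegree ≤ n := by
  induction n with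
  | zero => simp [invSqNumerator]
  | succ n ih =>
    rw [invSqNumerator]
    refine (Polynomial.natDegree_sub_le _ _).trans (max_le ?_ ?_)
    -- The case `n = 0` is separate: the degree of a derivative does not drop below `0` for a
    -- constant, but there the derivative vanishes.
    · rcases n with _ | n
      · simp [invSqNumerator]
      · refine Polynomial.natDegree_mul_le.trans ?_
        have h1 := Polynomial.natDegree_derivative_le (invSqNumerator (n + 1))
        have h2 : (1 + Polynomial.X ^ 2 : Polynomial ℝ).natDegree ≤ 2 :=
          (Polynomial.natDegree_add_le _ _).trans (by simp)
        omega
    · refine Polynomial.natDegree_mul_le.trans ?_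
      have := (Polynomial.natDegree_C_mul_le (2 * ((n : ℝ) + 1)) Polynomial.X).trans
        Polynomial.natDegree_X_le
      omega

theorem hasDerivAt_invSqDeriv (n : ℕ) (x : ℝ) :
    HasDerivAt (invSqDeriv n) (invSqDeriv (n + 1) x) x := by
  have h0 : (1 + x ^ 2) ≠ 0 := by positivity
  have h1 := (invSqNumerator n).hasDerivAt x
  have h2 : HasDerivAt (fun x : ℝ => (1 + x ^ 2) ^ (n + 1)) (((n + 1 : ℕ) : ℝ) * (1 + x ^ 2) ^ n *
      (2 * x)) x := by
    have := (((hasDerivAt_id x).pow 2).const_add 1).pow (n + 1)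
    refine this.congr_deriv ?_
    simp
  refine (h1.div h2 (pow_ne_zero _ h0)).congr_deriv ?_
  rw [invSqDeriv, invSqNumerator]
  simp only [Polynomial.eval_sub, Polynomial.eval_mul, Polynomial.eval_add, Polynomial.eval_one,
    Polynomial.eval_pow, Polynomial.eval_X, Polynomial.eval_C]
  rw [div_eq_div_iff (by positivity) (by positivity)]
  push_cast
  ring

theorem abs_invSqDeriv_le (n : ℕ) : ∃ C : ℝ, 0 ≤ C ∧ ∀ x,
    |invSqDeriv n x| ≤ C * (√(1 + x ^ 2) ^ (n + 2))⁻¹ := by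
  refine ⟨∑ i ∈ Finset.range (n + 1), |(invSqNumerator n).coeff i|,
    Finset.sum_nonneg fun i _ => abs_nonneg _, fun x => ?_⟩
  set S := √(1 + x ^ 2) with hS
  have hS1 : 1 ≤ S := Real.one_le_sqrt.2 (by nlinarith [sq_nonneg x])
  have hSx : |x| ≤ S := Real.abs_le_sqrt (by linarith)
  have hS2 : 1 + x ^ 2 = S ^ 2 := (Real.sq_sqrt (by positivity)).symm
  have hS0 : 0 < S := by linarith
  have hP : |(invSqNumerator n).eval x| ≤
      (∑ i ∈ Finset.range (n + 1), |(invSqNumerator n).coeff i|) * S ^ n := by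
    rw [Polynomial.eval_eq_sum_range' (Nat.lt_succ_of_le (natDegree_invSqNumerator_le n)),
      Finset.sum_mul]
    refine (Finset.abs_sum_le_sum_abs _ _).trans (Finset.sum_le_sum fun i hi => ?_)
    rw [abs_mul, abs_pow]
    refine mul_le_mul_of_nonneg_left ?_ (abs_nonneg _)
    exact (pow_le_pow_left₀ (abs_nonneg _) hSx i).trans
      (pow_le_pow_right₀ hS1 (Nat.lt_succ_iff.1 (Finset.mem_range.1 hi)))
  rw [invSqDeriv, hS2, abs_div, abs_of_nonneg (by positivity : 0 ≤ (S ^ 2) ^ (n + 1)),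
    div_le_iff₀ (by positivity)]
  refine hP.trans (le_of_eq ?_)
  have : (S ^ 2) ^ (n + 1) = S ^ (n + 2) * S ^ n := by ring
  rw [this, mul_assoc, ← mul_assoc (S ^ (n + 2))⁻¹, inv_mul_cancel₀ (by positivity), one_mul]

namespace Regime

variable {δ κ : ℝ}

/-- The weight `⟨x⟩⁻²` and its scaled derivatives. -/
def decayWeight (i : ℕ) (G : Regime δ κ) (x : ℝ) : ℂ := ((G.ρ ^ i * invSqDeriv i x : ℝ) : ℂ)

theorem isSymbol_decayWeight : IsSymbol (decayWeight (δ := δ) (κ := κ)) where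
  hasDerivAt i G x := by
    have h := ((hasDerivAt_invSqDeriv i x).const_mul (G.ρ ^ i)).ofReal_comp
    refine h.congr_deriv ?_
    rw [decayWeight, ← Complex.ofReal_mul]
    congr 1
    rw [pow_succ]
    have := G.ρ_pos.ne'
    field_simp
  bound i G := by
    obtain ⟨C, hC0, hC⟩ := abs_invSqDeriv_le i
    refine ⟨G.ρ ^ i * C, fun x => ?_⟩
    have hρ := G.ρ_pos
    rw [decayWeight, Complex.norm_real, Real.norm_eq_abs, abs_mul, abs_of_pos (by positivity)]
    refine mul_le_mul_of_nonneg_left ((hC x).trans ?_) (by positivity)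
    refine mul_le_of_le_one_right hC0 (inv_le_one_of_one_le₀ (one_le_pow₀ ?_))
    exact Real.one_le_sqrt.2 (by nlinarith [sq_nonneg x])

/-- In the far region `ρ^i ⟨x⟩^(-i-2)` is bounded by a multiple of `D^i D^(-i-2)`, because both `ρ ≤
D` and `D` is controlled by `⟨x⟩`. Hence all scaled derivatives obey the same bound. -/
theorem weightBound_decayWeight (hκ : 0 < κ) (i : ℕ) :
    WeightBound (decayWeight (δ := δ) (κ := κ) i) fun G => ENNReal.ofReal (G.D ^ 2)⁻¹ := by
  obtain ⟨C, hC0, hC⟩ := abs_invSqDeriv_le i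
  have hn : ∀ (G : Regime δ κ) x, ‖decayWeight i G x‖ ≤ G.ρ ^ i * (C * (√(1 + x ^ 2) ^ (i + 2))⁻¹) := by
    intro G x
    have hρ := G.ρ_pos
    rw [decayWeight, Complex.norm_real, Real.norm_eq_abs, abs_mul, abs_of_pos (by positivity)]
    exact mul_le_mul_of_nonneg_left (hC x) (by positivity)
  have hB : C ≤ C * (1 + (5 / κ) ^ (i + 2)) := le_mul_of_one_le_right hC0 (by
    have : 0 ≤ (5 / κ) ^ (i + 2) := by positivity
    linarith)
  have hB' : C * (5 / κ) ^ (i + 2) ≤ C * (1 + (5 / κ) ^ (i + 2)) :=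
    mul_le_mul_of_nonneg_left (by linarith) hC0
  refine weightBound_decaying hκ (fun G => ?_) (C * (1 + (5 / κ) ^ (i + 2))) i (fun G x => ?_)
    (fun G x hx => ?_)
  · exact (isSymbol_decayWeight.hasTemperateGrowth i G).1.continuous.measurable
  · have hρ := G.ρ_pos
    refine (hn G x).trans ?_
    rw [mul_comm]
    refine mul_le_mul_of_nonneg_right (le_trans ?_ hB) (by positivity)
    refine mul_le_of_le_one_right hC0 (inv_le_one_of_one_le₀ (one_le_pow₀ ?_))
    exact Real.one_le_sqrt.2 (by nlinarith [sq_nonneg x])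
  · have hρ := G.ρ_pos
    have hD := G.D_pos
    have hx' := G.norm_bracket_ge hx
    refine (hn G x).trans ?_
    calc G.ρ ^ i * (C * (√(1 + x ^ 2) ^ (i + 2))⁻¹)
        ≤ G.D ^ i * (C * ((κ / 5 * G.D) ^ (i + 2))⁻¹) := by
          have := G.ρ_le_D
          gcongr
      _ = C * (5 / κ) ^ (i + 2) * (G.D ^ 2)⁻¹ := by
          rw [mul_pow, mul_inv, ← inv_pow, inv_div, pow_add G.D, mul_inv]
          have : G.D ^ i * (G.D ^ i)⁻¹ = 1 := mul_inv_cancel₀ (by positivity)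
          linear_combination (C * (5 / κ) ^ (i + 2) * (G.D ^ 2)⁻¹) * this
      _ ≤ _ := mul_le_mul_of_nonneg_right hB' (by positivity)

end Regime

/-! ### Smooth cutoffs and summation over dyadic frequencies -/

theorem iteratedDeriv_smoothTransition_of_neg (i : ℕ) {x : ℝ} (hx : x < 0) :
    iteratedDeriv i Real.smoothTransition x = 0 := by
  have h : Real.smoothTransition =ᶠ[nhds x] fun _ => (0 : ℝ) := by
    filter_upwards [Iio_mem_nhds hx] with y hy using Real.smoothTransition.zero_of_nonpos hy.le
  rw [h.iteratedDeriv_eq i]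
  simp

theorem exists_bound_iteratedDeriv_smoothTransition (i : ℕ) :
    ∃ C, 0 ≤ C ∧ ∀ x, |iteratedDeriv i Real.smoothTransition x| ≤ C := by
  have hc : Continuous (iteratedDeriv i Real.smoothTransition) :=
    (Real.smoothTransition.contDiff (n := (i : ℕ∞))).continuous_iteratedDeriv' i
  obtain ⟨C, hC⟩ := (isCompact_Icc (a := (0 : ℝ)) (b := 1)).exists_bound_of_continuousOn
    hc.continuousOn
  refine ⟨max C 1, le_max_of_le_right zero_le_one, fun x => ?_⟩
  rcases lt_or_ge x 0 with hx | hx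
  · rw [iteratedDeriv_smoothTransition_of_neg i hx, abs_zero]
    exact le_max_of_le_right zero_le_one
  rcases lt_or_ge 1 x with hx1 | hx1
  · have h : Real.smoothTransition =ᶠ[nhds x] fun _ => (1 : ℝ) := by
      filter_upwards [Ioi_mem_nhds hx1] with y hy using Real.smoothTransition.one_of_one_le hy.le
    rw [h.iteratedDeriv_eq i, iteratedDeriv_const]
    refine le_max_of_le_right ?_
    split_ifs <;> simp
  · exact le_max_of_le_left (hC x ⟨hx, hx1⟩)

/-- Needed for R = 0, where a cutoff and its reflection overlap and must add up to exactly one. -/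
theorem smoothTransition_add (x : ℝ) :
    Real.smoothTransition x + Real.smoothTransition (1 - x) = 1 := by
  have h := Real.smoothTransition.pos_denom x
  unfold Real.smoothTransition
  rw [sub_sub_cancel, add_comm (expNegInvGlue (1 - x)), ← add_div, div_self h.ne']

/-- A smooth function equal to `0` on `(-∞, 1]` and to `1` on `[2, ∞)`. -/
def highPass (s : ℝ) : ℂ := (Real.smoothTransition (s - 1) : ℂ)

theorem contDiff_highPass : ContDiff ℝ ∞ highPass := by
  have h1 : ContDiff ℝ ∞ (fun s : ℝ => Real.smoothTransition (s - 1)) :=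
    Real.smoothTransition.contDiff.comp (contDiff_id.sub contDiff_const)
  exact Complex.ofRealCLM.contDiff.comp h1

theorem highPass_of_le {s : ℝ} (h : s ≤ 1) : highPass s = 0 := by
  rw [highPass, Real.smoothTransition.zero_of_nonpos (by linarith), Complex.ofReal_zero]

theorem highPass_of_ge {s : ℝ} (h : 2 ≤ s) : highPass s = 1 := by
  rw [highPass, Real.smoothTransition.one_of_one_le (by linarith), Complex.ofReal_one]

theorem norm_highPass_le (s : ℝ) : ‖highPass s‖ ≤ 1 := by
  rw [highPass, Complex.norm_real, Real.norm_of_nonneg (Real.smoothTransition.nonneg _)]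
  exact Real.smoothTransition.le_one _

/-- Bounds high frequencies by a derivative, which makes the remainder of the dyadic decomposition
tend to zero. -/
theorem norm_highPass_le_abs (s : ℝ) : ‖highPass s‖ ≤ |s| := by
  rcases le_total s 1 with h | h
  · rw [highPass_of_le h, norm_zero]; exact abs_nonneg _
  · exact (norm_highPass_le s).trans (h.trans (le_abs_self s))

theorem hasTemperateGrowth_highPass : highPass.HasTemperateGrowth := by
  refine Function.HasTemperateGrowth.of_fderiv (k := 0) (C := 1) ?_
    (contDiff_highPass.differentiable (by simp)) (fun x => by simpa using norm_highPass_le x)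
  refine HasCompactSupport.hasTemperateGrowth ?_ (contDiff_highPass.fderiv_right (by simp))
  refine HasCompactSupport.intro (isCompact_Icc (a := (1 : ℝ)) (b := 2)) fun x hx => ?_
  rw [Set.mem_Icc, not_and_or, not_le, not_le] at hx
  have h : ∃ c : ℂ, highPass =ᶠ[nhds x] fun _ => c := by
    rcases hx with hx | hx
    · exact ⟨0, by filter_upwards [Iio_mem_nhds hx] with y hy using highPass_of_le hy.le⟩
    · exact ⟨1, by filter_upwards [Ioi_mem_nhds hx] with y hy using highPass_of_ge hy.le⟩
  obtain ⟨c, hc⟩ := h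
  rw [hc.fderiv_eq]
  simp

/-- The dyadic pieces of `highPass`. -/
def dyadicAmplitude : Amplitude where
  toFun s := highPass s - highPass (s / 2)
  smooth := contDiff_highPass.sub (contDiff_highPass.comp (contDiff_id.div_const 2))
  eq_zero x hx := by
    rw [Set.mem_Icc, not_and_or, not_le, not_le] at hx
    rcases hx with hx | hx
    · rw [highPass_of_le hx.le, highPass_of_le (by linarith), sub_self]
    · rw [highPass_of_ge (by linarith), highPass_of_ge (by linarith), sub_self]

theorem fourier_wavePiece (σ N t : ℝ) {a : ℝ → ℂ} (ha : a.HasTemperateGrowth) (g : 𝓢(ℝ, ℂ)) (ξ : ℝ) :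
    (𝓕 (wavePiece σ N t a g) : 𝓢(ℝ, ℂ)) ξ = waveSymbol σ N t a ξ * (𝓕 g : 𝓢(ℝ, ℂ)) ξ :=
  fourier_fourierMultiplierCLM (hasTemperateGrowth_waveSymbol σ N t ha) g ξ

theorem derivCLM_wavePiece (σ N t : ℝ) {a : ℝ → ℂ} (ha : a.HasTemperateGrowth) (g : 𝓢(ℝ, ℂ)) :
    derivCLM ℂ ℂ (wavePiece σ N t a g) = wavePiece σ N t a (derivCLM ℂ ℂ g) := by
  refine ext_of_fourier fun ξ => ?_
  rw [fourier_derivCLM, fourier_wavePiece _ _ _ ha, fourier_wavePiece _ _ _ ha, fourier_derivCLM]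
  ring

theorem wavePiece_highPass_eq (σ t : ℝ) {N : ℝ} (hN : N ≠ 0) (g : 𝓢(ℝ, ℂ)) :
    wavePiece σ N t highPass g =
      wavePiece σ N t dyadicAmplitude g + wavePiece σ (2 * N) t highPass g := by
  refine ext_of_fourier fun ξ => ?_
  rw [FourierTransform.fourier_add, add_apply, fourier_wavePiece _ _ _ hasTemperateGrowth_highPass,
    fourier_wavePiece _ _ _ hasTemperateGrowth_highPass,
    fourier_wavePiece _ _ _ dyadicAmplitude.hasTemperateGrowth]
  have h : σ / (2 * N) * ξ = σ / N * ξ / 2 := by field_simp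
  simp only [waveSymbol, dyadicAmplitude, h]
  ring

theorem eLpNorm_wavePiece_highPass_le {σ N : ℝ} (t : ℝ) (hσ : |σ| = 1) (hN : 0 < N) (g : 𝓢(ℝ, ℂ)) :
    eLpNorm (wavePiece σ N t highPass g) 2 volume ≤
      ENNReal.ofReal N⁻¹ * eLpNorm (derivCLM ℂ ℂ g) 2 volume := by
  rw [← eLpNorm_fourier, ← eLpNorm_fourier (derivCLM ℂ ℂ g)]
  refine eLpNorm_le_mul_eLpNorm_of_ae_le_mul (Filter.Eventually.of_forall fun ξ => ?_) 2
  rw [fourier_wavePiece _ _ _ hasTemperateGrowth_highPass, fourier_derivCLM, norm_mul, norm_mul,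
    Regime.norm_symbol, ← mul_assoc]
  refine mul_le_mul_of_nonneg_right ((norm_highPass_le_abs _).trans ?_) (norm_nonneg _)
  have h1 : ‖(2 * Real.pi * Complex.I * ξ : ℂ)‖ = 2 * Real.pi * |ξ| := by
    simp [abs_of_pos Real.pi_pos]
  rw [h1, abs_mul, abs_div, hσ, abs_of_pos hN, one_div]
  refine mul_le_mul_of_nonneg_left ?_ (by positivity)
  have := Real.pi_gt_three
  nlinarith [abs_nonneg ξ]

/-- A functional controlled by the `H¹` norm can be estimated on dyadic pieces. -/
theorem le_tsum_dyadic {Ψ : 𝓢(ℝ, ℂ) → ℝ≥0∞} (hadd : ∀ g h, Ψ (g + h) ≤ Ψ g + Ψ h) {A : ℝ≥0∞}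
    (hA : A ≠ ⊤)
    (hΨ : ∀ h, Ψ h ≤ A * (eLpNorm h 2 volume + eLpNorm (derivCLM ℂ ℂ h) 2 volume))
    {σ lam : ℝ} (t : ℝ) (hσ : |σ| = 1) (hlam : 0 < lam) (g : 𝓢(ℝ, ℂ)) :
    Ψ (wavePiece σ lam t highPass g) ≤
      ∑' j : ℕ, Ψ (wavePiece σ (2 ^ j * lam) t dyadicAmplitude g) := by
  set X := eLpNorm (derivCLM ℂ ℂ g) 2 volume +
    eLpNorm (derivCLM ℂ ℂ (derivCLM ℂ ℂ g)) 2 volume with hX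
  have hXt : X ≠ ⊤ := ENNReal.add_ne_top.2 ⟨(SchwartzMap.eLpNorm_lt_top _ 2 volume).ne,
    (SchwartzMap.eLpNorm_lt_top _ 2 volume).ne⟩
  -- Finite telescoping: each step splits off one dyadic annulus and doubles the frequency of the
  -- remainder.
  have hind : ∀ n : ℕ, Ψ (wavePiece σ lam t highPass g) ≤
      ∑ j ∈ Finset.range n, Ψ (wavePiece σ (2 ^ j * lam) t dyadicAmplitude g) +
        Ψ (wavePiece σ (2 ^ n * lam) t highPass g) := by
    intro n
    induction n with
    | zero => simp
    | succ n ih =>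
      refine ih.trans ?_
      rw [Finset.sum_range_succ, add_assoc]
      gcongr
      rw [wavePiece_highPass_eq σ t (N := 2 ^ n * lam) (by positivity)]
      refine (hadd _ _).trans (le_of_eq ?_)
      rw [pow_succ, mul_comm ((2 : ℝ) ^ n) 2, mul_assoc]
  -- Two derivatives of the fixed Schwartz function `g` control the H¹ norm of the remainder with a
  -- factor `(2^n lam)⁻¹`. This rate is only qualitative and leaves no trace in the result.
  have hrem : ∀ n : ℕ, Ψ (wavePiece σ (2 ^ n * lam) t highPass g) ≤
      A * (ENNReal.ofReal ((2 ^ n * lam)⁻¹) * X) := by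
    intro n
    refine (hΨ _).trans ?_
    rw [derivCLM_wavePiece _ _ _ hasTemperateGrowth_highPass, hX, mul_add (ENNReal.ofReal _)]
    gcongr
    · exact eLpNorm_wavePiece_highPass_le t hσ (by positivity) g
    · exact eLpNorm_wavePiece_highPass_le t hσ (by positivity) _
  have hlim : Filter.Tendsto (fun n : ℕ => ENNReal.ofReal ((2 ^ n * lam)⁻¹)) Filter.atTop (nhds 0) := by
    rw [← ENNReal.ofReal_zero]
    refine (ENNReal.continuous_ofReal.tendsto 0).comp ?_
    refine Filter.Tendsto.inv_tendsto_atTop ?_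
    exact (tendsto_pow_atTop_atTop_of_one_lt (by norm_num)).atTop_mul_const hlam
  have hlim2 : Filter.Tendsto (fun n : ℕ =>
      (∑' j : ℕ, Ψ (wavePiece σ (2 ^ j * lam) t dyadicAmplitude g)) +
        A * (ENNReal.ofReal ((2 ^ n * lam)⁻¹) * X)) Filter.atTop
      (nhds ((∑' j : ℕ, Ψ (wavePiece σ (2 ^ j * lam) t dyadicAmplitude g)) + A * (0 * X))) :=
    tendsto_const_nhds.add (ENNReal.Tendsto.const_mul
      (ENNReal.Tendsto.mul_const hlim (Or.inr hXt)) (Or.inr hA))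
  rw [zero_mul, mul_zero, add_zero] at hlim2
  refine ge_of_tendsto' hlim2 fun n => (hind n).trans (add_le_add (ENNReal.sum_le_tsum _) (hrem n))

/-! ### Local smoothing and time decay on the line -/

/-- The parameters of the decomposition at a given spatial scale: see `Regime`. -/
structure Setting (δ κ : ℝ) where
  ρ : ℝ
  τ : ℝ
  ℓ : ℝ
  δ_pos : 0 < δ
  κ_pos : 0 < κ
  one_le_ρ : 1 ≤ ρ
  le_ℓ : κ * ρ ≤ ℓ
  ℓ_le : ℓ ≤ ρ
  position : τ = 0 ∨ τ = -3 ∧ ρ = 1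

namespace Setting

variable {δ κ : ℝ} (E : Setting δ κ)

/-- The frequency threshold. -/
def threshold : ℝ := E.ρ ^ (δ - 1)

theorem ρ_pos : 0 < E.ρ := zero_lt_one.trans_le E.one_le_ρ

theorem threshold_pos : 0 < E.threshold := Real.rpow_pos_of_pos E.ρ_pos _

theorem ℓ_pos : 0 < E.ℓ := (mul_pos E.κ_pos E.ρ_pos).trans_le E.le_ℓ

/-- The regime of the dyadic piece of frequency `2 ^ j * threshold` at time `t`. -/
def regime {σ t : ℝ} (hσ : σ = 1 ∨ σ = -1) (ht : 0 ≤ t) (j : ℕ) : Regime δ κ where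
  ρ := E.ρ
  N := 2 ^ j * E.threshold
  τ := E.τ
  ℓ := E.ℓ
  t := t
  σ := σ
  δ_pos := E.δ_pos
  κ_pos := E.κ_pos
  one_le_ρ := E.one_le_ρ
  le_N := le_mul_of_one_le_left E.threshold_pos.le (one_le_pow₀ (by norm_num))
  le_ℓ := E.le_ℓ
  ℓ_le := E.ℓ_le
  t_nonneg := ht
  sign := hσ
  position := E.position

/-- A smooth cutoff to `{x | τ + 2 * ℓ ≤ x}`. -/
def cutoff (x : ℝ) : ℂ := (Real.smoothTransition ((x - (E.τ + 2 * E.ℓ)) / (2 * E.ℓ)) : ℂ)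

/-- The scaled derivatives of the cutoff. -/
def cutoffDeriv (N : ℝ) (i : ℕ) (x : ℝ) : ℂ :=
  ((((2 * E.ℓ * N)⁻¹) ^ i *
    iteratedDeriv i Real.smoothTransition ((x - (E.τ + 2 * E.ℓ)) / (2 * E.ℓ)) : ℝ) : ℂ)

theorem cutoffDeriv_zero (N : ℝ) : E.cutoffDeriv N 0 = E.cutoff := by
  funext x
  simp [cutoffDeriv, cutoff]

/-- The cutoff varies on the length `2ℓ`, and `Nℓ ≥ κNρ ≥ κ`, so derivatives measured in units of
`N` are bounded uniformly in the scale and the frequency. -/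
theorem exists_isCutoff (hκ : 0 < κ) : ∃ B : ℕ → ℝ, ∀ (E : Setting δ κ) {σ t : ℝ}
    (hσ : σ = 1 ∨ σ = -1) (ht : 0 ≤ t) (j : ℕ),
    (E.regime hσ ht j).IsCutoff B (E.cutoffDeriv (2 ^ j * E.threshold)) := by
  choose C hC0 hC using exists_bound_iteratedDeriv_smoothTransition
  refine ⟨fun i => ((2 * κ)⁻¹) ^ i * C i, fun E σ t hσ ht j => ⟨fun i x => ?_, fun i x => ?_,
    fun i x hx => ?_⟩⟩
  · have hℓ := E.ℓ_pos
    have hN := (E.regime hσ ht j).N_pos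
    change 0 < 2 ^ j * E.threshold at hN
    change HasDerivAt _ (((2 ^ j * E.threshold : ℝ) : ℂ) * _) x
    have hs : HasDerivAt (iteratedDeriv i Real.smoothTransition)
        (iteratedDeriv (i + 1) Real.smoothTransition ((x - (E.τ + 2 * E.ℓ)) / (2 * E.ℓ)))
        ((x - (E.τ + 2 * E.ℓ)) / (2 * E.ℓ)) := by
      rw [iteratedDeriv_succ]
      exact ((Real.smoothTransition.contDiff (n := ((i + 1 : ℕ) : ℕ∞))).differentiable_iteratedDeriv' i
        _).hasDerivAt
    have hl : HasDerivAt (fun x => (x - (E.τ + 2 * E.ℓ)) / (2 * E.ℓ)) (1 / (2 * E.ℓ)) x :=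
      ((hasDerivAt_id x).sub_const _).div_const _
    refine ((hs.comp x hl).const_mul (((2 * E.ℓ * (2 ^ j * E.threshold))⁻¹) ^ i)).ofReal_comp.congr_deriv ?_
    rw [cutoffDeriv, ← Complex.ofReal_mul]
    congr 1
    have hq : 1 / (2 * E.ℓ) = 2 ^ j * E.threshold * (2 * E.ℓ * (2 ^ j * E.threshold))⁻¹ := by
      have := E.threshold_pos.ne'
      field_simp
    rw [pow_succ, hq]
    ring
  · have hκℓ : κ ≤ E.ℓ * (2 ^ j * E.threshold) := by
      have h1 := (E.regime hσ ht j).one_le_N_mul_ρ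
      change 1 ≤ 2 ^ j * E.threshold * E.ρ at h1
      have hN := (E.regime hσ ht j).N_pos
      change 0 < 2 ^ j * E.threshold at hN
      calc κ ≤ κ * (2 ^ j * E.threshold * E.ρ) := le_mul_of_one_le_right hκ.le h1
        _ = (κ * E.ρ) * (2 ^ j * E.threshold) := by ring
        _ ≤ _ := mul_le_mul_of_nonneg_right E.le_ℓ hN.le
    have h2 : 0 ≤ (2 * E.ℓ * (2 ^ j * E.threshold))⁻¹ :=
      inv_nonneg.2 (by rw [mul_assoc]; linarith)
    have h3 : (2 * E.ℓ * (2 ^ j * E.threshold))⁻¹ ≤ (2 * κ)⁻¹ :=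
      inv_anti₀ (by linarith) (by rw [mul_assoc]; linarith)
    rw [cutoffDeriv, Complex.norm_real, Real.norm_eq_abs, abs_mul, abs_of_nonneg (by positivity)]
    exact mul_le_mul (pow_le_pow_left₀ h2 h3 i) (hC i _) (abs_nonneg _) (by positivity)
  · change x < E.τ + 2 * E.ℓ at hx
    rw [cutoffDeriv, iteratedDeriv_smoothTransition_of_neg, mul_zero, Complex.ofReal_zero]
    exact div_neg_of_neg_of_pos (by linarith) (by linarith [E.ℓ_pos])

theorem hasTemperateGrowth_cutoff : E.cutoff.HasTemperateGrowth := by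
  obtain ⟨B, hB⟩ := exists_isCutoff (δ := δ) E.κ_pos
  rw [← E.cutoffDeriv_zero (2 ^ 0 * E.threshold)]
  exact (hB E (Or.inl rfl) le_rfl 0).hasTemperateGrowth 0

theorem norm_cutoff_le (x : ℝ) : ‖E.cutoff x‖ ≤ 1 := by
  rw [cutoff, Complex.norm_real, Real.norm_of_nonneg (Real.smoothTransition.nonneg _)]
  exact Real.smoothTransition.le_one _

/-- The part of `cutoff * F` with frequencies above the threshold in the direction `σ`, evolved for
a time `t` in the direction `σ`. -/
def wave (σ t : ℝ) (F : 𝓢(ℝ, ℂ)) : 𝓢(ℝ, ℂ) :=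
  wavePiece σ E.threshold t highPass (smulLeftCLM ℂ E.cutoff F)

end Setting

/-- The weight `(1 + x²)⁻¹` on the line. -/
def lineWeight (x : ℝ) : ℂ := (((1 + x ^ 2)⁻¹ : ℝ) : ℂ)

theorem Regime.decayWeight_zero {δ κ : ℝ} (G : Regime δ κ) : Regime.decayWeight 0 G = lineWeight := by
  funext x
  simp [Regime.decayWeight, invSqDeriv, invSqNumerator, lineWeight]

theorem norm_lineWeight_le (x : ℝ) : ‖lineWeight x‖ ≤ 1 := by
  have : 1 ≤ 1 + x ^ 2 := by nlinarith [sq_nonneg x]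
  rw [lineWeight, Complex.norm_real, Real.norm_of_nonneg (by positivity)]
  exact inv_le_one_of_one_le₀ this

theorem hasTemperateGrowth_lineWeight : lineWeight.HasTemperateGrowth := by
  have h := Function.Complex.hasTemperateGrowth_ofReal.comp
    (Function.hasTemperateGrowth_one_add_norm_sq_rpow ℝ (-1))
  have e : (Complex.ofReal ∘ fun x : ℝ => (1 + ‖x‖ ^ 2) ^ (-1 : ℝ)) = lineWeight := by
    funext x
    simp [lineWeight, Real.rpow_neg_one]
  rwa [e] at h

theorem lineSobolev_le_pow_mul_eLpNorm {α ρ : ℝ} (hα : 0 ≤ α) (hρ : 0 < ρ) (h : 𝓢(ℝ, ℂ)) :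
    lineSobolev (-α) ρ h ≤ ENNReal.ofReal (ρ ^ α) * eLpNorm h 2 volume := by
  rw [← lineSobolev_zero ρ]
  refine lineSobolev_le_of_symbol fun ξ => ?_
  rw [← mul_assoc]
  refine mul_le_mul_of_nonneg_right ?_ (norm_nonneg _)
  rw [zero_div, Real.rpow_zero, mul_one]
  have h1 : (ρ ^ 2)⁻¹ ≤ ξ ^ 2 + 1 / ρ ^ 2 := by
    rw [one_div]; nlinarith [sq_nonneg ξ]
  calc (ξ ^ 2 + 1 / ρ ^ 2) ^ (-α / 2) ≤ ((ρ ^ 2)⁻¹) ^ (-α / 2) :=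
        Real.rpow_le_rpow_of_nonpos (by positivity) h1 (by linarith)
    _ = ρ ^ α := by
        rw [← Real.rpow_natCast, ← Real.rpow_neg hρ.le, ← Real.rpow_mul hρ.le]
        congr 1; push_cast; ring

namespace Setting

variable {δ κ : ℝ}

theorem threshold_mul_ρ (E : Setting δ κ) : E.threshold * E.ρ = E.ρ ^ δ := by
  rw [threshold, ← Real.rpow_add_one E.ρ_pos.ne', sub_add_cancel]

/-- Weighted decay of the outgoing (incoming) waves, pointwise in time. -/
theorem lineSobolev_wave_le (hκ : 0 < κ) {α s : ℝ} (hα : 0 ≤ α) (hs : 0 ≤ s) :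
    ∃ C : ℝ≥0, ∀ (E : Setting δ κ) (σ t : ℝ), (σ = 1 ∨ σ = -1) → 0 ≤ t → ∀ F : 𝓢(ℝ, ℂ),
      lineSobolev (-α) E.ρ (smulLeftCLM ℂ lineWeight (E.wave σ t F)) ≤
        C * (∑' j : ℕ, ENNReal.ofReal ((2 ^ j * E.threshold) ^ (s - α) *
          ((E.ρ + 2 ^ j * E.threshold * t) ^ 2)⁻¹)) * lineSobolev (-s) E.ρ F := by
  obtain ⟨B, hB⟩ := exists_isCutoff (δ := δ) hκ
  obtain ⟨C, hC⟩ := Regime.isSymbol_decayWeight.lineSobolev_cutoff_le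
    (Regime.weightBound_decayWeight (δ := δ) hκ) B hα hs dyadicAmplitude
  refine ⟨C, fun E σ t hσ ht F => ?_⟩
  have hρ := E.ρ_pos
  have hth := E.threshold_pos
  have hσ1 : |σ| = 1 := by rcases hσ with rfl | rfl <;> simp
  have h := le_tsum_dyadic (Ψ := fun h => lineSobolev (-α) E.ρ (smulLeftCLM ℂ lineWeight h))
    (A := ENNReal.ofReal (E.ρ ^ α)) (fun g h => ?_) ENNReal.ofReal_ne_top (fun h => ?_)
    (lam := E.threshold) t hσ1 hth (smulLeftCLM ℂ E.cutoff F)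
  · refine h.trans ?_
    rw [← ENNReal.tsum_mul_left, ← ENNReal.tsum_mul_right]
    refine ENNReal.tsum_le_tsum fun j => ?_
    have h1 := hC (E.regime hσ ht j) _ (hB E hσ ht j) F
    rw [cutoffDeriv_zero, Regime.decayWeight_zero] at h1
    refine h1.trans (le_of_eq ?_)
    rw [ENNReal.ofReal_mul (by positivity)]
    simp only [regime, Regime.D]
    ring
  · rw [map_add]
    exact lineSobolev_add_le _ _ _ _
  · refine (lineSobolev_le_pow_mul_eLpNorm hα hρ _).trans ?_
    gcongr
    refine le_trans ?_ le_self_add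
    have := Regime.eLpNorm_smulLeftCLM_le hasTemperateGrowth_lineWeight norm_lineWeight_le h
    simpa using this

/-- For negative `r` both sides vanish, as `ENNReal.ofReal` truncates; this spares a sign
hypothesis. -/
theorem lintegral_inv_sq_le {ρ N : ℝ} (hρ : 0 < ρ) (hN : 0 < N) (r : ℝ) :
    ∫⁻ t in Set.Ioi (0 : ℝ), ENNReal.ofReal (r * ((ρ + N * t) ^ 2)⁻¹) =
      ENNReal.ofReal (r * (N * ρ)⁻¹) := by
  rcases lt_or_ge r 0 with hr | hr
  · rw [ENNReal.ofReal_of_nonpos (by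
      have : 0 ≤ (N * ρ)⁻¹ := by positivity
      nlinarith)]
    refine (lintegral_congr fun t => ?_).trans (lintegral_zero)
    rw [ENNReal.ofReal_of_nonpos]
    have : 0 ≤ ((ρ + N * t) ^ 2)⁻¹ := by positivity
    nlinarith
  have hpos : ∀ t ∈ Set.Ici (0 : ℝ), 0 < ρ + N * t := fun t ht => by
    have : 0 ≤ N * t := mul_nonneg hN.le ht
    linarith
  have hderiv : ∀ t ∈ Set.Ici (0 : ℝ), HasDerivAt (fun t => -(r * N⁻¹) * (ρ + N * t)⁻¹)
      (r * ((ρ + N * t) ^ 2)⁻¹) t := by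
    intro t ht
    have h := ((((hasDerivAt_id t).const_mul N).const_add ρ).inv (hpos t ht).ne').const_mul
      (-(r * N⁻¹))
    refine h.congr_deriv ?_
    simp only [id, mul_one]
    field_simp
  have hlim : Filter.Tendsto (fun t => -(r * N⁻¹) * (ρ + N * t)⁻¹) Filter.atTop
      (nhds (-(r * N⁻¹) * 0)) := by
    refine Filter.Tendsto.const_mul _ (Filter.Tendsto.inv_tendsto_atTop ?_)
    exact Filter.tendsto_atTop_add_const_left _ _ (Filter.tendsto_id.const_mul_atTop hN)
  have hnn : ∀ t ∈ Set.Ioi (0 : ℝ), 0 ≤ r * ((ρ + N * t) ^ 2)⁻¹ := fun t _ => by positivity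
  have hint := integrableOn_Ioi_deriv_of_nonneg' hderiv hnn hlim
  have hval := integral_Ioi_of_hasDerivAt_of_nonneg' hderiv hnn hlim
  rw [← ofReal_integral_eq_lintegral_ofReal hint
    ((ae_restrict_iff' measurableSet_Ioi).2 (Filter.Eventually.of_forall hnn)), hval]
  congr 1
  rw [mul_inv]
  ring

theorem tsum_ofReal_geometric {q : ℝ} (hq0 : 0 ≤ q) (hq : q < 1) (c : ℝ) (hc : 0 ≤ c) :
    ∑' j : ℕ, ENNReal.ofReal (c * q ^ j) = ENNReal.ofReal (c * (1 - q)⁻¹) := by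
  rw [← ENNReal.ofReal_tsum_of_nonneg (fun j => by positivity)
    ((summable_geometric_of_lt_one hq0 hq).mul_left c), tsum_mul_left, tsum_geometric_of_lt_one hq0 hq]

/-- The term of frequency `N` integrates to `N^(1-δ) (Nρ)⁻¹ = N^(-δ) ρ⁻¹`, which is geometric in the
dyadic index with ratio `2^(-δ)`. The lowest frequency dominates. -/
theorem lintegral_tsum_decay_le (hδ : 0 < δ) : ∃ C : ℝ≥0, ∀ E : Setting δ κ,
    ∫⁻ t in Set.Ioi (0 : ℝ), ∑' j : ℕ, ENNReal.ofReal ((2 ^ j * E.threshold) ^ (1 - δ) *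
      ((E.ρ + 2 ^ j * E.threshold * t) ^ 2)⁻¹) ≤ C * ENNReal.ofReal (E.ρ ^ (-1 + δ)) := by
  set q : ℝ := 2 ^ (-δ) with hq
  have hq0 : 0 ≤ q := by positivity
  have hq1 : q < 1 := Real.rpow_lt_one_of_one_lt_of_neg (by norm_num) (by linarith)
  refine ⟨((1 - q)⁻¹).toNNReal, fun E => ?_⟩
  have hρ := E.ρ_pos
  have hth := E.threshold_pos
  rw [lintegral_tsum fun j => by fun_prop]
  have h : ∀ j : ℕ, ∫⁻ t in Set.Ioi (0 : ℝ), ENNReal.ofReal ((2 ^ j * E.threshold) ^ (1 - δ) *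
      ((E.ρ + 2 ^ j * E.threshold * t) ^ 2)⁻¹) =
      ENNReal.ofReal (E.threshold ^ (-δ) * E.ρ⁻¹ * q ^ j) := by
    intro j
    rw [lintegral_inv_sq_le hρ (by positivity)]
    congr 1
    have hN : 0 < 2 ^ j * E.threshold := by positivity
    have e1 : (2 ^ j * E.threshold) ^ (1 - δ) * (2 ^ j * E.threshold)⁻¹ =
        (2 ^ j * E.threshold) ^ (-δ) := by
      rw [← Real.rpow_neg_one (2 ^ j * E.threshold), ← Real.rpow_add hN]
      congr 1; ring
    have e2 : (2 ^ j * E.threshold) ^ (-δ) = q ^ j * E.threshold ^ (-δ) := by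
      rw [Real.mul_rpow (by positivity) hth.le, hq, ← Real.rpow_natCast, ← Real.rpow_natCast,
        ← Real.rpow_mul (by norm_num), ← Real.rpow_mul (by norm_num), mul_comm (j : ℝ)]
    rw [mul_inv, ← mul_assoc, e1, e2]
    ring
  simp_rw [h]
  rw [tsum_ofReal_geometric hq0 hq1 _ (by positivity), mul_comm,
    ENNReal.ofReal_mul (inv_nonneg.2 (by linarith))]
  refine mul_le_mul_right (ENNReal.ofReal_le_ofReal ?_) _
  rw [threshold, ← Real.rpow_mul hρ.le, ← Real.rpow_neg_one, ← Real.rpow_add hρ]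
  -- The exponent obtained is `-δ(δ - 1) - 1 = -1 + δ - δ²`.
  exact Real.rpow_le_rpow_of_exponent_le E.one_le_ρ (by nlinarith)

/-- Local smoothing for outgoing (incoming) waves on the line. -/
theorem lintegral_lineSobolev_wave_le (hδ : 0 < δ) (hδ1 : δ < 1) (hκ : 0 < κ) {α : ℝ} (hα : 0 ≤ α) :
    ∃ C : ℝ≥0, ∀ (E : Setting δ κ) (σ : ℝ), (σ = 1 ∨ σ = -1) → ∀ F : 𝓢(ℝ, ℂ),
      ∫⁻ t in Set.Ioi (0 : ℝ), lineSobolev (-α) E.ρ (smulLeftCLM ℂ lineWeight (E.wave σ t F)) ≤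
        C * ENNReal.ofReal (E.ρ ^ (-1 + δ)) * lineSobolev (-α - 1 + δ) E.ρ F := by
  -- The order `s = α + 1 - δ` of the data makes the power of `N` equal to `1 - δ`; it is
  -- nonnegative because δ < 1.
  obtain ⟨C1, h1⟩ := lineSobolev_wave_le (δ := δ) hκ hα (show 0 ≤ α + 1 - δ by linarith)
  obtain ⟨C2, h2⟩ := lintegral_tsum_decay_le (κ := κ) hδ
  refine ⟨C1 * C2, fun E σ hσ F => ?_⟩
  have e1 : α + 1 - δ - α = 1 - δ := by ring
  have e2 : -(α + 1 - δ) = -α - 1 + δ := by ring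
  rw [e1, e2] at h1
  calc _ ≤ ∫⁻ t in Set.Ioi (0 : ℝ), C1 * (∑' j : ℕ, ENNReal.ofReal ((2 ^ j * E.threshold) ^ (1 - δ) *
          ((E.ρ + 2 ^ j * E.threshold * t) ^ 2)⁻¹)) * lineSobolev (-α - 1 + δ) E.ρ F :=
        setLIntegral_mono' measurableSet_Ioi fun t ht => h1 E σ t hσ (le_of_lt ht) F
    _ = C1 * (∫⁻ t in Set.Ioi (0 : ℝ), ∑' j : ℕ, ENNReal.ofReal ((2 ^ j * E.threshold) ^ (1 - δ) *
          ((E.ρ + 2 ^ j * E.threshold * t) ^ 2)⁻¹)) * lineSobolev (-α - 1 + δ) E.ρ F := by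
        have hm : Measurable fun t : ℝ => ∑' j : ℕ, ENNReal.ofReal ((2 ^ j * E.threshold) ^ (1 - δ) *
          ((E.ρ + 2 ^ j * E.threshold * t) ^ 2)⁻¹) := Measurable.tsum fun j => by fun_prop
        rw [lintegral_mul_const _ (hm.const_mul _), lintegral_const_mul _ hm]
    _ ≤ C1 * (C2 * ENNReal.ofReal (E.ρ ^ (-1 + δ))) * lineSobolev (-α - 1 + δ) E.ρ F := by
        gcongr
        exact h2 E
    _ = _ := by rw [ENNReal.coe_mul]; ring

/-- Decay in time of the weighted `L²` norm of outgoing (incoming) waves. -/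
theorem eLpNorm_wave_decay (hκ : 0 < κ) : ∃ C : ℝ≥0, ∀ (E : Setting δ κ) (σ t : ℝ),
    (σ = 1 ∨ σ = -1) → 0 < t → ∀ F : 𝓢(ℝ, ℂ),
      eLpNorm (smulLeftCLM ℂ lineWeight (E.wave σ t F)) 2 volume ≤
        C * ENNReal.ofReal ((E.threshold * t) ^ 2)⁻¹ * eLpNorm F 2 volume := by
  obtain ⟨C, h⟩ := lineSobolev_wave_le (δ := δ) hκ le_rfl le_rfl
  refine ⟨C * ((1 - (4 : ℝ)⁻¹)⁻¹).toNNReal, fun E σ t hσ ht F => ?_⟩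
  have hρ := E.ρ_pos
  have hth := E.threshold_pos
  specialize h E σ t hσ ht.le F
  rw [neg_zero, lineSobolev_zero, lineSobolev_zero] at h
  refine h.trans ?_
  rw [ENNReal.coe_mul, mul_assoc (C : ℝ≥0∞) _ (ENNReal.ofReal _)]
  gcongr
  calc _ ≤ ∑' j : ℕ, ENNReal.ofReal (((E.threshold * t) ^ 2)⁻¹ * (4 : ℝ)⁻¹ ^ j) := by
        refine ENNReal.tsum_le_tsum fun j => ENNReal.ofReal_le_ofReal ?_
        rw [sub_zero, Real.rpow_zero, one_mul, inv_pow, ← mul_inv]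
        refine inv_anti₀ (by positivity) ?_
        calc (E.threshold * t) ^ 2 * 4 ^ j = (2 ^ j * E.threshold * t) ^ 2 := by
              rw [show (4 : ℝ) = 2 ^ 2 by norm_num, ← pow_mul, mul_comm 2 j, pow_mul]; ring
          _ ≤ _ := by
              gcongr
              linarith
    _ = _ := by
        rw [tsum_ofReal_geometric (by norm_num) (by norm_num) _ (by positivity), mul_comm,
          ENNReal.ofReal_mul (by norm_num)]
        rfl

end Setting

/-! ### Decay near the origin on the line -/

/-- An even smooth function equal to `1` on `[-1/2, 1/2]` and to `0` outside `(-1, 1)`. -/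
def bump (s : ℝ) : ℝ := Real.smoothTransition ((1 - s ^ 2) * (4 / 3))

theorem contDiff_bump : ContDiff ℝ ∞ bump := by
  have h : ContDiff ℝ ∞ fun s : ℝ => (1 - s ^ 2) * (4 / 3 : ℝ) := by fun_prop
  exact Real.smoothTransition.contDiff.comp h

theorem bump_of_abs_le {s : ℝ} (h : |s| ≤ 1 / 2) : bump s = 1 := by
  refine Real.smoothTransition.one_of_one_le ?_
  have : s ^ 2 ≤ (1 / 2) ^ 2 := sq_le_sq' (abs_le.1 h).1 (abs_le.1 h).2
  linarith

theorem bump_of_le_abs {s : ℝ} (h : 1 ≤ |s|) : bump s = 0 := by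
  refine Real.smoothTransition.zero_of_nonpos ?_
  have : 1 ≤ s ^ 2 := by rw [← sq_abs]; nlinarith
  linarith

theorem bump_neg (s : ℝ) : bump (-s) = bump s := by simp [bump]

theorem norm_bump_le (s : ℝ) : ‖bump s‖ ≤ 1 := by
  rw [bump, Real.norm_of_nonneg (Real.smoothTransition.nonneg _)]
  exact Real.smoothTransition.le_one _

theorem hasCompactSupport_bump : HasCompactSupport bump := by
  refine HasCompactSupport.intro (isCompact_Icc (a := (-1 : ℝ)) (b := 1)) fun x hx => ?_
  refine bump_of_le_abs ?_
  by_contra! h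
  exact hx (Set.mem_Icc.2 (abs_le.1 h.le))

theorem exists_norm_deriv_bump_le : ∃ B : ℝ, ∀ s, ‖deriv bump s‖ ≤ B :=
  (contDiff_bump.continuous_deriv (by simp)).bounded_above_of_compact_support
    hasCompactSupport_bump.deriv

theorem deriv_bump_of_lt {s : ℝ} (h : 1 < s) : deriv bump s = 0 := by
  have h' : bump =ᶠ[nhds s] fun _ => (0 : ℝ) := by
    filter_upwards [Ioi_mem_nhds h] with y hy
    exact bump_of_le_abs (le_of_lt (hy.trans_le (le_abs_self y)))
  rw [h'.deriv_eq, deriv_const]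

theorem hasTemperateGrowth_ofReal_comp_affine {f : ℝ → ℝ} (hf : f.HasTemperateGrowth) (τ ℓ : ℝ) :
    (fun x : ℝ => ((f ((x - τ) / ℓ) : ℝ) : ℂ)).HasTemperateGrowth := by
  have h : (fun x : ℝ => (x - τ) / ℓ).HasTemperateGrowth := by
    simp_rw [div_eq_mul_inv]
    fun_prop
  exact Function.Complex.hasTemperateGrowth_ofReal.comp (hf.comp h)

theorem hasTemperateGrowth_bump : bump.HasTemperateGrowth :=
  hasCompactSupport_bump.hasTemperateGrowth contDiff_bump

theorem hasTemperateGrowth_deriv_bump : (deriv bump).HasTemperateGrowth :=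
  hasCompactSupport_bump.deriv.hasTemperateGrowth
    (contDiff_infty_iff_deriv.1 contDiff_bump).2

/-- A cutoff to the region within `ℓ` of `τ`. -/
def nearWeight (τ ℓ x : ℝ) : ℂ := (bump ((x - τ) / ℓ) : ℂ)

/-- The scaled derivative of `nearWeight`. -/
def nearWeightDeriv (τ ℓ x : ℝ) : ℂ := ((deriv bump ((x - τ) / ℓ) : ℝ) : ℂ)

theorem hasTemperateGrowth_nearWeight (τ ℓ : ℝ) : (nearWeight τ ℓ).HasTemperateGrowth :=
  hasTemperateGrowth_ofReal_comp_affine hasTemperateGrowth_bump τ ℓ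

theorem hasTemperateGrowth_nearWeightDeriv (τ ℓ : ℝ) : (nearWeightDeriv τ ℓ).HasTemperateGrowth :=
  hasTemperateGrowth_ofReal_comp_affine hasTemperateGrowth_deriv_bump τ ℓ

theorem norm_nearWeight_le (τ ℓ x : ℝ) : ‖nearWeight τ ℓ x‖ ≤ 1 := by
  rw [nearWeight, Complex.norm_real]
  exact norm_bump_le _

theorem derivCLM_nearWeight (τ ℓ : ℝ) (h : 𝓢(ℝ, ℂ)) :
    derivCLM ℂ ℂ (smulLeftCLM ℂ (nearWeight τ ℓ) h) =
      ((ℓ⁻¹ : ℝ) : ℂ) • smulLeftCLM ℂ (nearWeightDeriv τ ℓ) h +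
        smulLeftCLM ℂ (nearWeight τ ℓ) (derivCLM ℂ ℂ h) := by
  have ht : (fun x => ((ℓ⁻¹ : ℝ) : ℂ) * nearWeightDeriv τ ℓ x).HasTemperateGrowth := by
    have := hasTemperateGrowth_nearWeightDeriv τ ℓ
    fun_prop
  have hd : ∀ x, HasDerivAt (nearWeight τ ℓ) (((ℓ⁻¹ : ℝ) : ℂ) * nearWeightDeriv τ ℓ x) x := by
    intro x
    have hl : HasDerivAt (fun x => (x - τ) / ℓ) (1 / ℓ) x :=
      ((hasDerivAt_id x).sub_const _).div_const _
    have hb : HasDerivAt bump (deriv bump ((x - τ) / ℓ)) ((x - τ) / ℓ) :=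
      (contDiff_bump.differentiable (by simp) _).hasDerivAt
    refine (hb.comp x hl).ofReal_comp.congr_deriv ?_
    rw [nearWeightDeriv, ← Complex.ofReal_mul]
    congr 1
    rw [one_div]; ring
  rw [derivCLM_smulLeftCLM (hasTemperateGrowth_nearWeight τ ℓ) ht hd]
  congr 1
  ext x
  rw [smul_apply, smulLeftCLM_apply_apply ht,
    smulLeftCLM_apply_apply (hasTemperateGrowth_nearWeightDeriv τ ℓ)]
  simp only [smul_eq_mul]
  ring

namespace Regime

variable {δ κ : ℝ}

/-- Places the support of `nearWeight` inside the region that the wave has left, at every time. -/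
theorem div_of_far (G : Regime δ κ) {x : ℝ} (hx : G.τ + G.ℓ + G.N * G.t < x) :
    1 < (x - G.τ) / G.ℓ := by
  have hℓ : 0 < G.ℓ := (mul_pos G.κ_pos G.ρ_pos).trans_le G.le_ℓ
  have := G.Nt_nonneg
  rw [lt_div_iff₀ hℓ]
  linarith

theorem weightBound_nearWeight (hκ : 0 < κ) (K : ℕ) :
    WeightBound (fun G : Regime δ κ => nearWeight G.τ G.ℓ)
      fun G => ENNReal.ofReal ((G.N * G.D)⁻¹ ^ K) := by
  refine weightBound_near hκ 1 (fun G x => norm_nearWeight_le _ _ x) (fun G x hx => ?_) K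
  rw [nearWeight, bump_of_le_abs ((G.div_of_far hx).le.trans (le_abs_self _)), Complex.ofReal_zero]

theorem weightBound_nearWeightDeriv (hκ : 0 < κ) (K : ℕ) :
    WeightBound (fun G : Regime δ κ => nearWeightDeriv G.τ G.ℓ)
      fun G => ENNReal.ofReal ((G.N * G.D)⁻¹ ^ K) := by
  obtain ⟨B, hB⟩ := exists_norm_deriv_bump_le
  refine weightBound_near hκ B (fun G x => ?_) (fun G x hx => ?_) K
  · rw [nearWeightDeriv, Complex.norm_real]
    exact hB _
  · rw [nearWeightDeriv, deriv_bump_of_lt (G.div_of_far hx), Complex.ofReal_zero]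

/-- The derivative falls on the weight at the cost of `ℓ⁻¹ ≤ κ⁻¹N`, or on the wave at the cost of
`N`. Both terms then live where the wave decays rapidly. -/
theorem eLpNorm_derivCLM_near_le (hκ : 0 < κ) {s : ℝ} (hs : 0 ≤ s) (B : ℕ → ℝ) (K : ℕ)
    (a : Amplitude) : ∃ C : ℝ≥0, ∀ (G : Regime δ κ) (χ : ℕ → ℝ → ℂ), G.IsCutoff B χ →
      ∀ F : 𝓢(ℝ, ℂ), eLpNorm (derivCLM ℂ ℂ (smulLeftCLM ℂ (nearWeight G.τ G.ℓ)
        (G.U a (smulLeftCLM ℂ (χ 0) F)))) 2 volume ≤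
      C * ENNReal.ofReal (G.N ^ (1 + s) * (G.N * G.D)⁻¹ ^ K) * lineSobolev (-s) G.ρ F := by
  have hm : ∀ {f : ℝ → ℂ}, f.HasTemperateGrowth → Measurable f := fun h => h.1.continuous.measurable
  obtain ⟨C1, h1⟩ := (weightBound_nearWeightDeriv (δ := δ) hκ K).cutoff
    (fun G => hm (hasTemperateGrowth_nearWeightDeriv _ _)) B hs a
  obtain ⟨C2, h2⟩ := (weightBound_nearWeight (δ := δ) hκ K).cutoff
    (fun G => hm (hasTemperateGrowth_nearWeight _ _)) B hs a.mulFreq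
  refine ⟨(κ⁻¹).toNNReal * C1 + C2, fun G χ hχ F => ?_⟩
  have hN := G.N_pos
  have hD := G.D_pos
  specialize h1 G χ hχ F
  specialize h2 G χ hχ F
  set g := smulLeftCLM ℂ (χ 0) F
  have hu : derivCLM ℂ ℂ (G.U a g) = ((G.σ * G.N : ℝ) : ℂ) • G.U a.mulFreq g := by
    rw [← U_derivCLM]
    exact derivCLM_wavePiece _ _ _ a.hasTemperateGrowth g
  have e1 : eLpNorm (smulLeftCLM ℂ (nearWeightDeriv G.τ G.ℓ) (G.U a g)) 2 volume =
      eLpNorm (fun x => nearWeightDeriv G.τ G.ℓ x * G.U a g x) 2 volume := by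
    congr 1
    funext x
    rw [smulLeftCLM_apply_apply (hasTemperateGrowth_nearWeightDeriv _ _), smul_eq_mul]
  have e2 : eLpNorm (smulLeftCLM ℂ (nearWeight G.τ G.ℓ) (G.U a.mulFreq g)) 2 volume =
      eLpNorm (fun x => nearWeight G.τ G.ℓ x * G.U a.mulFreq g x) 2 volume := by
    congr 1
    funext x
    rw [smulLeftCLM_apply_apply (hasTemperateGrowth_nearWeight _ _), smul_eq_mul]
  rw [← lineSobolev_zero G.ρ] at e1 e2 ⊢
  rw [derivCLM_nearWeight, hu, map_smul]
  refine (lineSobolev_add_le _ _ _ _).trans ?_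
  rw [lineSobolev_smul, lineSobolev_smul, e1, e2]
  have hℓ : ‖((G.ℓ⁻¹ : ℝ) : ℂ)‖ₑ ≤ (κ⁻¹).toNNReal * ENNReal.ofReal G.N := by
    have hℓ0 : 0 < G.ℓ := (mul_pos G.κ_pos G.ρ_pos).trans_le G.le_ℓ
    change _ ≤ ENNReal.ofReal _ * _
    rw [← ofReal_norm, Complex.norm_real, Real.norm_of_nonneg (by positivity),
      ← ENNReal.ofReal_mul (by positivity)]
    refine ENNReal.ofReal_le_ofReal ?_
    calc G.ℓ⁻¹ ≤ (κ * G.ρ)⁻¹ := inv_anti₀ (mul_pos hκ G.ρ_pos) G.le_ℓ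
      _ = κ⁻¹ * G.ρ⁻¹ := mul_inv _ _
      _ ≤ _ := by gcongr; exact G.inv_ρ_le_N
  have hσ : ‖((G.σ * G.N : ℝ) : ℂ)‖ₑ = ENNReal.ofReal G.N := by
    rw [← ofReal_norm, Complex.norm_real, norm_mul, Real.norm_eq_abs, G.abs_σ, one_mul,
      Real.norm_of_nonneg hN.le]
  rw [hσ]
  have hq : ENNReal.ofReal (G.N ^ (1 + s) * (G.N * G.D)⁻¹ ^ K) =
      ENNReal.ofReal G.N * (ENNReal.ofReal ((G.N * G.D)⁻¹ ^ K) * ENNReal.ofReal (G.N ^ s)) := by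
    rw [← ENNReal.ofReal_mul (by positivity), ← ENNReal.ofReal_mul hN.le, Real.rpow_add hN,
      Real.rpow_one]
    congr 1; ring
  rw [hq, ENNReal.coe_add, ENNReal.coe_mul]
  calc _ ≤ (κ⁻¹).toNNReal * ENNReal.ofReal G.N * (C1 * ENNReal.ofReal ((G.N * G.D)⁻¹ ^ K) *
        (ENNReal.ofReal (G.N ^ s) * lineSobolev (-s) G.ρ F)) +
        ENNReal.ofReal G.N * (C2 * ENNReal.ofReal ((G.N * G.D)⁻¹ ^ K) *
        (ENNReal.ofReal (G.N ^ s) * lineSobolev (-s) G.ρ F)) := by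
        gcongr
    _ = _ := by ring

end Regime

namespace Setting

variable {δ κ : ℝ}

theorem eLpNorm_derivCLM_near_wave_le (hκ : 0 < κ) {s : ℝ} (hs : 0 ≤ s) (K : ℕ) :
    ∃ C : ℝ≥0, ∀ (E : Setting δ κ) (σ t : ℝ), (σ = 1 ∨ σ = -1) → 0 ≤ t → ∀ F : 𝓢(ℝ, ℂ),
      eLpNorm (derivCLM ℂ ℂ (smulLeftCLM ℂ (nearWeight E.τ E.ℓ) (E.wave σ t F))) 2 volume ≤
        C * (∑' j : ℕ, ENNReal.ofReal ((2 ^ j * E.threshold) ^ (1 + s) *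
          (2 ^ j * E.threshold * (E.ρ + 2 ^ j * E.threshold * t))⁻¹ ^ K)) *
          lineSobolev (-s) E.ρ F := by
  obtain ⟨B, hB⟩ := exists_isCutoff (δ := δ) hκ
  obtain ⟨C, hC⟩ := Regime.eLpNorm_derivCLM_near_le (δ := δ) hκ hs B K dyadicAmplitude
  obtain ⟨M, hM⟩ := exists_norm_deriv_bump_le
  refine ⟨C, fun E σ t hσ ht F => ?_⟩
  have hth := E.threshold_pos
  have hσ1 : |σ| = 1 := by rcases hσ with rfl | rfl <;> simp
  have h := le_tsum_dyadic
    (Ψ := fun h => eLpNorm (derivCLM ℂ ℂ (smulLeftCLM ℂ (nearWeight E.τ E.ℓ) h)) 2 volume)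
    (A := max (‖((E.ℓ⁻¹ : ℝ) : ℂ)‖ₑ * ENNReal.ofReal M) 1) (fun g h => ?_)
    (by simp [ENNReal.mul_eq_top]) (fun h => ?_)
    (lam := E.threshold) t hσ1 hth (smulLeftCLM ℂ E.cutoff F)
  · refine h.trans ?_
    rw [← ENNReal.tsum_mul_left, ← ENNReal.tsum_mul_right]
    refine ENNReal.tsum_le_tsum fun j => ?_
    have h1 := hC (E.regime hσ ht j) _ (hB E hσ ht j) F
    rw [cutoffDeriv_zero] at h1
    exact h1
  · rw [map_add, map_add]
    simp only [← lineSobolev_zero 1]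
    exact lineSobolev_add_le _ _ _ _
  · rw [derivCLM_nearWeight]
    simp only [← lineSobolev_zero 1]
    refine (lineSobolev_add_le _ _ _ _).trans ?_
    rw [lineSobolev_smul, mul_add]
    simp only [lineSobolev_zero]
    refine add_le_add ?_ ?_
    · have := Regime.eLpNorm_smulLeftCLM_le (hasTemperateGrowth_nearWeightDeriv E.τ E.ℓ)
        (B := M) (fun x => by rw [nearWeightDeriv, Complex.norm_real]; exact hM _) h
      refine (mul_le_mul_right this _).trans ?_
      rw [← mul_assoc]
      exact mul_le_mul_left (le_max_left _ _) _
    · have := Regime.eLpNorm_smulLeftCLM_le (hasTemperateGrowth_nearWeight E.τ E.ℓ)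
        (norm_nearWeight_le _ _) (derivCLM ℂ ℂ h)
      refine this.trans ?_
      rw [ENNReal.ofReal_one]
      exact mul_le_mul_left (le_max_right _ _) _

/-- Two of the `K` powers give the integrable `D⁻²`. The others are bounded at t = 0, where `Nρ =
2^j ρ^δ`: they beat the growth in `N` and produce any prescribed power of `ρ`. -/
theorem lintegral_tsum_near_le (hδ : 0 < δ) {s β : ℝ} (hs : 0 ≤ s) (hβ : 0 ≤ β) :
    ∃ K : ℕ, ∀ E : Setting δ κ, ∫⁻ t in Set.Ioi (0 : ℝ), ∑' j : ℕ,
      ENNReal.ofReal ((2 ^ j * E.threshold) ^ (1 + s) *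
        (2 ^ j * E.threshold * (E.ρ + 2 ^ j * E.threshold * t))⁻¹ ^ K) ≤
      2 * ENNReal.ofReal (E.ρ ^ (-β)) := by
  -- With this choice `δ(s - k - 2) ≤ -(1 + β)`; the extra `1` absorbs the factor `ρ^(1-s)`, and the
  -- `-2` leaves enough decay in `2^j`.
  set k := ⌈s + (1 + β) / δ⌉₊ with hk
  have hkle : s + (1 + β) / δ ≤ k := Nat.le_ceil _
  refine ⟨k + 2, fun E => ?_⟩
  have hρ := E.ρ_pos
  have hth := E.threshold_pos
  rw [lintegral_tsum fun j => by fun_prop]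
  have h : ∀ j : ℕ, ∫⁻ t in Set.Ioi (0 : ℝ), ENNReal.ofReal ((2 ^ j * E.threshold) ^ (1 + s) *
        (2 ^ j * E.threshold * (E.ρ + 2 ^ j * E.threshold * t))⁻¹ ^ (k + 2)) ≤
      ENNReal.ofReal (E.ρ ^ (-β) * (1 / 2) ^ j) := by
    intro j
    have hN : 0 < 2 ^ j * E.threshold := by positivity
    have hNρ : 2 ^ j * E.threshold * E.ρ = 2 ^ j * E.ρ ^ δ := by
      rw [mul_assoc, threshold_mul_ρ]
    set N := 2 ^ j * E.threshold with hNdef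
    calc _ ≤ ∫⁻ t in Set.Ioi (0 : ℝ), ENNReal.ofReal (N ^ (1 + s) * (N ^ 2)⁻¹ * ((N * E.ρ) ^ k)⁻¹ *
          ((E.ρ + N * t) ^ 2)⁻¹) := by
          refine setLIntegral_mono' measurableSet_Ioi fun t ht => ENNReal.ofReal_le_ofReal ?_
          have ht0 : 0 ≤ N * t := mul_nonneg hN.le (le_of_lt ht)
          have h1 : N * E.ρ ≤ N * (E.ρ + N * t) := mul_le_mul_of_nonneg_left (by linarith) hN.le
          have h2 : ((N * (E.ρ + N * t)) ^ k)⁻¹ ≤ ((N * E.ρ) ^ k)⁻¹ :=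
            inv_anti₀ (by positivity) (pow_le_pow_left₀ (by positivity) h1 k)
          have e : (N * (E.ρ + N * t))⁻¹ ^ (k + 2) =
              (N ^ 2)⁻¹ * ((N * (E.ρ + N * t)) ^ k)⁻¹ * ((E.ρ + N * t) ^ 2)⁻¹ := by
            rw [pow_add, inv_pow, inv_pow, mul_pow _ _ 2, mul_inv (N ^ 2)]; ring
          rw [e, mul_assoc (N ^ (1 + s)), mul_assoc (N ^ (1 + s)) _ (((E.ρ + N * t) ^ 2)⁻¹)]
          gcongr
      _ = ENNReal.ofReal (N ^ (1 + s) * (N ^ 2)⁻¹ * ((N * E.ρ) ^ k)⁻¹ * (N * E.ρ)⁻¹) :=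
          lintegral_inv_sq_le hρ hN _
      _ ≤ _ := ENNReal.ofReal_le_ofReal ?_
    have hX : 0 < N * E.ρ := by positivity
    have e1 : N ^ (1 + s) * (N ^ 2)⁻¹ = (N * E.ρ) ^ (s - 1) * E.ρ ^ (1 - s) := by
      rw [← Real.rpow_natCast N 2, ← Real.rpow_neg hN.le, ← Real.rpow_add hN,
        Real.mul_rpow hN.le hρ.le, mul_assoc, ← Real.rpow_add hρ]
      have : s - 1 + (1 - s) = 0 := by ring
      rw [this, Real.rpow_zero, mul_one]
      congr 1
      push_cast; ring
    have e2 : ((N * E.ρ) ^ k)⁻¹ * (N * E.ρ)⁻¹ = (N * E.ρ) ^ (-(k : ℝ) - 1) := by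
      rw [← Real.rpow_natCast, ← Real.rpow_neg hX.le, ← Real.rpow_neg_one (N * E.ρ),
        ← Real.rpow_add hX]
      congr 1
    have e3 : (N * E.ρ) ^ (s - 1) * (N * E.ρ) ^ (-(k : ℝ) - 1) = (N * E.ρ) ^ (s - k - 2) := by
      rw [← Real.rpow_add hX]; congr 1; ring
    have hj : (2 : ℝ) ^ j ≠ 0 := by positivity
    calc N ^ (1 + s) * (N ^ 2)⁻¹ * ((N * E.ρ) ^ k)⁻¹ * (N * E.ρ)⁻¹
        = (N * E.ρ) ^ (s - k - 2) * E.ρ ^ (1 - s) := by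
          rw [mul_assoc _ _ ((N * E.ρ)⁻¹), e2, e1, ← e3]; ring
      _ = (2 ^ j : ℝ) ^ (s - k - 2) * (E.ρ ^ (δ * (s - k - 2)) * E.ρ ^ (1 - s)) := by
          rw [hNρ, Real.mul_rpow (by positivity) (by positivity), ← Real.rpow_mul hρ.le, mul_assoc]
      _ ≤ (1 / 2) ^ j * E.ρ ^ (-β) := by
          gcongr
          · rw [one_div, inv_pow, ← Real.rpow_neg_one ((2 : ℝ) ^ j)]
            refine Real.rpow_le_rpow_of_exponent_le (one_le_pow₀ (by norm_num)) ?_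
            have : 0 ≤ (1 + β) / δ := by positivity
            linarith
          · rw [← Real.rpow_add hρ]
            refine Real.rpow_le_rpow_of_exponent_le E.one_le_ρ ?_
            have h3 : δ * (s - k - 2) ≤ δ * (-((1 + β) / δ)) :=
              mul_le_mul_of_nonneg_left (by linarith) hδ.le
            have h4 : δ * (-((1 + β) / δ)) = -(1 + β) := by field_simp
            linarith
      _ = _ := mul_comm _ _
  refine (ENNReal.tsum_le_tsum h).trans (le_of_eq ?_)
  rw [tsum_ofReal_geometric (by norm_num) (by norm_num) _ (by positivity), mul_comm,
    ENNReal.ofReal_mul (by norm_num)]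
  congr 1
  norm_num

/-- Decay near the origin for outgoing (incoming) waves on the line. -/
theorem lintegral_derivCLM_near_le (hδ : 0 < δ) (hκ : 0 < κ) {s β : ℝ} (hs : 0 ≤ s) (hβ : 0 ≤ β) :
    ∃ C : ℝ≥0, ∀ (E : Setting δ κ) (σ : ℝ), (σ = 1 ∨ σ = -1) → ∀ F : 𝓢(ℝ, ℂ),
      ∫⁻ t in Set.Ioi (0 : ℝ),
        eLpNorm (derivCLM ℂ ℂ (smulLeftCLM ℂ (nearWeight E.τ E.ℓ) (E.wave σ t F))) 2 volume ≤
        C * ENNReal.ofReal (E.ρ ^ (-β)) * lineSobolev (-s) E.ρ F := by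
  obtain ⟨K, hK⟩ := lintegral_tsum_near_le (δ := δ) (κ := κ) hδ hs hβ
  obtain ⟨C, hC⟩ := eLpNorm_derivCLM_near_wave_le (δ := δ) hκ hs K
  refine ⟨C * 2, fun E σ hσ F => ?_⟩
  have hm : Measurable fun t : ℝ => ∑' j : ℕ, ENNReal.ofReal ((2 ^ j * E.threshold) ^ (1 + s) *
      (2 ^ j * E.threshold * (E.ρ + 2 ^ j * E.threshold * t))⁻¹ ^ K) :=
    Measurable.tsum fun j => by fun_prop
  refine (setLIntegral_mono' measurableSet_Ioi fun t ht => hC E σ t hσ (le_of_lt ht) F).trans ?_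
  rw [lintegral_mul_const _ (hm.const_mul _), lintegral_const_mul _ hm]
  refine (mul_le_mul_left (mul_le_mul_right (hK E) _) _).trans (le_of_eq ?_)
  rw [ENNReal.coe_mul, ← mul_assoc]
  rfl

end Setting

/-! ### Radial functions on ℝ³ and odd functions on the line -/

/-- Integration of a radial function in polar coordinates. -/
theorem lintegral_fun_norm_addHaar {E : Type*} [NormedAddCommGroup E] [NormedSpace ℝ E]
    [MeasurableSpace E] [BorelSpace E] [FiniteDimensional ℝ E] [Nontrivial E] (μ : Measure E)
    [μ.IsAddHaarMeasure] {f : ℝ → ℝ≥0∞} (hf : Measurable f) :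
    ∫⁻ x, f ‖x‖ ∂μ = Module.finrank ℝ E * μ (Metric.ball 0 1) *
      ∫⁻ y in Set.Ioi (0 : ℝ), ENNReal.ofReal (y ^ (Module.finrank ℝ E - 1)) * f y :=
  calc
    ∫⁻ x, f ‖x‖ ∂μ = ∫⁻ x : ({0}ᶜ : Set E), f ‖x.1‖ ∂(μ.comap (↑)) := by
      rw [lintegral_subtype_comap (measurableSet_singleton _).compl fun x => f ‖x‖,
        restrict_compl_singleton]
    _ = ∫⁻ x, f x.2 ∂μ.toSphere.prod (.volumeIoiPow (Module.finrank ℝ E - 1)) := by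
      rw [← μ.measurePreserving_homeomorphUnitSphereProd.lintegral_comp_emb
        (Homeomorph.measurableEmbedding _)]
      simp
    _ = μ.toSphere Set.univ * ∫⁻ x : Set.Ioi (0 : ℝ), f x ∂.volumeIoiPow (Module.finrank ℝ E - 1) := by
      have h := lintegral_prod_mul (μ := μ.toSphere)
        (ν := Measure.volumeIoiPow (Module.finrank ℝ E - 1)) (f := fun _ => 1)
        (g := fun x : Set.Ioi (0 : ℝ) => f x) aemeasurable_const
        (hf.comp measurable_subtype_coe).aemeasurable
      simpa using h
    _ = _ := by
      rw [μ.toSphere_apply_univ, Measure.volumeIoiPow,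
        lintegral_withDensity_eq_lintegral_mul _ (by fun_prop)
          (g := fun x : Set.Ioi (0 : ℝ) => f x) (hf.comp measurable_subtype_coe)]
      congr 1
      exact lintegral_subtype_comap measurableSet_Ioi
        fun y => ENNReal.ofReal (y ^ (Module.finrank ℝ E - 1)) * f y

theorem lintegral_fun_norm_R3 {f : ℝ → ℝ≥0∞} (hf : Measurable f) :
    ∫⁻ x : R3, f ‖x‖ = ENNReal.ofReal (4 * Real.pi) *
      ∫⁻ y in Set.Ioi (0 : ℝ), ENNReal.ofReal (y ^ 2) * f y := by
  rw [lintegral_fun_norm_addHaar volume hf, EuclideanSpace.volume_ball_fin_three]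
  simp only [finrank_euclideanSpace, Fintype.card_fin]
  congr 1
  rw [ENNReal.ofReal_one, one_pow, one_mul, ← ENNReal.ofReal_natCast, ← ENNReal.ofReal_mul (by simp)]
  congr 1
  push_cast; ring

/-- The point of `ℝ³` with first coordinate `a` and remaining coordinates `y`. -/
def sliceEquiv : ℝ × EuclideanSpace ℝ (Fin 2) ≃ᵐ R3 :=
  ((MeasurableEquiv.refl ℝ).prodCongr (MeasurableEquiv.toLp 2 (Fin 2 → ℝ)).symm).trans
    ((MeasurableEquiv.piFinSuccAbove (fun _ : Fin 3 => ℝ) 0).symm.trans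
      (MeasurableEquiv.toLp 2 (Fin 3 → ℝ)))

theorem measurePreserving_sliceEquiv : MeasurePreserving sliceEquiv volume volume := by
  have h1 : MeasurePreserving ((MeasurableEquiv.refl ℝ).prodCongr
      (MeasurableEquiv.toLp 2 (Fin 2 → ℝ)).symm) (volume : Measure (ℝ × EuclideanSpace ℝ (Fin 2)))
      volume := (MeasurePreserving.id volume).prod (PiLp.volume_preserving_ofLp (Fin 2))
  exact (PiLp.volume_preserving_toLp (Fin 3)).comp
    (((volume_preserving_piFinSuccAbove (fun _ : Fin 3 => ℝ) 0).symm _).comp h1)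

theorem sliceEquiv_apply_zero (p : ℝ × EuclideanSpace ℝ (Fin 2)) : sliceEquiv p 0 = p.1 := rfl

theorem norm_sliceEquiv (p : ℝ × EuclideanSpace ℝ (Fin 2)) :
    ‖sliceEquiv p‖ = √(p.1 ^ 2 + ‖p.2‖ ^ 2) := by
  rw [EuclideanSpace.norm_eq, Fin.sum_univ_succ, EuclideanSpace.norm_sq_eq]
  simp only [Real.norm_eq_abs, sq_abs]
  rfl

theorem integral_slice {F : R3 → ℂ} (hF : Integrable F) :
    ∫ x, F x = ∫ a : ℝ, ∫ y : EuclideanSpace ℝ (Fin 2), F (sliceEquiv (a, y)) := by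
  rw [← measurePreserving_sliceEquiv.integral_comp sliceEquiv.measurableEmbedding]
  exact integral_prod _ ((measurePreserving_sliceEquiv.integrable_comp_emb
    sliceEquiv.measurableEmbedding).2 hF)

/-- `H(r) - H(-r)`. -/
def oddPart (H : 𝓢(ℝ, ℂ)) : 𝓢(ℝ, ℂ) :=
  H - compCLMOfContinuousLinearEquiv ℂ (ContinuousLinearEquiv.neg ℝ) H

theorem oddPart_apply (H : 𝓢(ℝ, ℂ)) (r : ℝ) : oddPart H r = H r - H (-r) := rfl

theorem oddPart_neg (H : 𝓢(ℝ, ℂ)) (r : ℝ) : oddPart H (-r) = -oddPart H r := by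
  simp [oddPart_apply]

theorem fourier_oddPart (H : 𝓢(ℝ, ℂ)) :
    (𝓕 (oddPart H) : 𝓢(ℝ, ℂ)) = oddPart (𝓕 H) := by
  ext ξ
  have h : (𝓕 (compCLMOfContinuousLinearEquiv ℂ (ContinuousLinearEquiv.neg ℝ) H) : 𝓢(ℝ, ℂ)) ξ =
      (𝓕 H : 𝓢(ℝ, ℂ)) (-ξ) := by
    rw [fourier_coe, fourier_coe]
    exact Real.fourier_comp_linearIsometry (LinearIsometryEquiv.neg ℝ) H ξ
  have h2 : (𝓕 (oddPart H) : 𝓢(ℝ, ℂ)) = 𝓕 H - 𝓕 (compCLMOfContinuousLinearEquiv ℂ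
      (ContinuousLinearEquiv.neg ℝ) H) := (fourierTransformCLM ℂ).map_sub H _
  rw [h2, oddPart_apply, sub_apply, h]

theorem exists_norm_le_inv_one_add_sq (h : 𝓢(ℝ, ℂ)) :
    ∃ M, 0 ≤ M ∧ ∀ u, ‖h u‖ ≤ M * (1 + u ^ 2)⁻¹ := by
  obtain ⟨C0, h0⟩ := h.decay 0 0
  obtain ⟨C2, h2⟩ := h.decay 2 0
  refine ⟨C0 + C2, add_nonneg h0.1.le h2.1.le, fun u => ?_⟩
  have e0 := h0.2 u
  have e2 := h2.2 u
  rw [norm_iteratedFDeriv_zero] at e0 e2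
  rw [← div_eq_mul_inv, le_div_iff₀ (by positivity)]
  rw [Real.norm_eq_abs, sq_abs] at e2
  nlinarith

/-- The antiderivative of an odd Schwartz function, decaying at infinity. -/
structure IsAntiderivative (h : 𝓢(ℝ, ℂ)) (P : ℝ → ℂ) : Prop where
  hasDerivAt : ∀ s, HasDerivAt P (h s) s
  even : ∀ s, P (-s) = P s
  bound : ∃ M, 0 ≤ M ∧ ∀ s, ‖P s‖ ≤ M * (1 + s ^ 2)⁻¹

theorem exists_isAntiderivative (h : 𝓢(ℝ, ℂ)) (hodd : ∀ s, h (-s) = -h s) :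
    ∃ P, IsAntiderivative h P := by
  set P : ℝ → ℂ := fun s => ∫ u in Set.Iic s, h u
  have hP : ∀ s, P s = P 0 + ∫ u in (0 : ℝ)..s, h u := fun s => by
    rw [← intervalIntegral.integral_Iic_sub_Iic h.integrable.integrableOn h.integrable.integrableOn]
    exact (add_sub_cancel _ _).symm
  have hd : ∀ s, HasDerivAt P (h s) s := fun s => by
    have h1 := (intervalIntegral.integral_hasDerivAt_right
      (h.continuous.intervalIntegrable 0 s) h.continuous.stronglyMeasurable.stronglyMeasurableAtFilter
      h.continuous.continuousAt).const_add (P 0)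
    rwa [← funext hP] at h1
  have heven : ∀ s, P (-s) = P s := by
    have hQ : ∀ s, HasDerivAt (fun s => P s - P (-s)) 0 s := fun s => by
      have h2 := (hd s).sub ((hd (-s)).scomp s (hasDerivAt_neg s))
      refine h2.congr_deriv ?_
      rw [hodd]
      simp
    intro s
    have h3 := is_const_of_deriv_eq_zero (fun s => (hQ s).differentiableAt)
      (fun s => (hQ s).deriv) s 0
    simp only [neg_zero, sub_self] at h3
    exact (sub_eq_zero.1 h3).symm
  have hint : Integrable fun u => (1 + u ^ 2) * ‖h u‖ := by
    have h2 := h.integrable_pow_mul volume 2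
    refine (h.integrable.norm.add h2).congr (Filter.Eventually.of_forall fun u => ?_)
    simp only [Pi.add_apply, Real.norm_eq_abs, sq_abs]
    ring
  -- On the left `P` is a tail integral, on which `s² ≤ u²`; evenness of `P` then gives the decay on
  -- the right.
  have hneg : ∀ s, s ≤ 0 → ‖P s‖ ≤ (∫ u, (1 + u ^ 2) * ‖h u‖) * (1 + s ^ 2)⁻¹ := by
    intro s hs
    rw [← div_eq_mul_inv, le_div_iff₀ (by positivity), mul_comm]
    calc (1 + s ^ 2) * ‖P s‖ ≤ (1 + s ^ 2) * ∫ u in Set.Iic s, ‖h u‖ := by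
          gcongr
          exact norm_integral_le_integral_norm _
      _ = ∫ u in Set.Iic s, (1 + s ^ 2) * ‖h u‖ := (integral_const_mul _ _).symm
      _ ≤ ∫ u in Set.Iic s, (1 + u ^ 2) * ‖h u‖ := by
          refine setIntegral_mono_on (h.integrable.norm.const_mul _).integrableOn hint.integrableOn
            measurableSet_Iic fun u hu => ?_
          have : s ^ 2 ≤ u ^ 2 := by nlinarith [Set.mem_Iic.1 hu]
          gcongr
      _ ≤ _ := setIntegral_le_integral hint (Filter.Eventually.of_forall fun u => by positivity)
  refine ⟨P, hd, heven, ∫ u, (1 + u ^ 2) * ‖h u‖, integral_nonneg fun u => by positivity, fun s => ?_⟩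
  rcases le_total s 0 with hs | hs
  · exact hneg s hs
  · rw [← heven, ← neg_sq]
    exact hneg (-s) (by linarith)

theorem integrable_const_mul_inv_one_add_sq (M : ℝ) : Integrable fun s : ℝ => M * (1 + s ^ 2)⁻¹ :=
  integrable_inv_one_add_sq.const_mul M

namespace IsAntiderivative

variable {h : 𝓢(ℝ, ℂ)} {P : ℝ → ℂ}

theorem integrable (hP : IsAntiderivative h P) : Integrable P := by
  obtain ⟨M, -, hM⟩ := hP.bound
  refine (integrable_const_mul_inv_one_add_sq M).mono' ?_ (Filter.Eventually.of_forall hM)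
  exact (continuous_iff_continuousAt.2 fun s =>
    (hP.hasDerivAt s).continuousAt).aestronglyMeasurable

theorem fourier (hP : IsAntiderivative h P) (k : ℝ) :
    (𝓕 h : 𝓢(ℝ, ℂ)) k = 2 * Real.pi * Complex.I * k * 𝓕 P k := by
  have hd : deriv P = h := funext fun s => (hP.hasDerivAt s).deriv
  rw [fourier_coe, ← hd, Real.fourier_deriv hP.integrable
    (fun s => (hP.hasDerivAt s).differentiableAt) (hd ▸ h.integrable)]
  rfl

/-- In polar coordinates the integrand `r h(√(a² + r²)) / √(a² + r²)` is the r-derivative of `P(√(a²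
+ r²))`, so only the value at `r = 0` remains. This is the projection of a radial function of ℝ³ to
a line. -/
theorem integral_plane (hP : IsAntiderivative h P) (a : ℝ) :
    ∫ y : EuclideanSpace ℝ (Fin 2), h √(a ^ 2 + ‖y‖ ^ 2) / (√(a ^ 2 + ‖y‖ ^ 2) : ℝ) =
      -(2 * Real.pi) * P a := by
  obtain ⟨M, hM0, hM⟩ := exists_norm_le_inv_one_add_sq h
  obtain ⟨M', -, hM'⟩ := hP.bound
  rw [integral_fun_norm_addHaar volume fun r : ℝ => h √(a ^ 2 + r ^ 2) / (√(a ^ 2 + r ^ 2) : ℝ)]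
  have hcP : Continuous P := continuous_iff_continuousAt.2 fun s => (hP.hasDerivAt s).continuousAt
  have hpos : ∀ r ∈ Set.Ioi (0 : ℝ), 0 < a ^ 2 + r ^ 2 := fun r hr => by
    have : 0 < r ^ 2 := pow_pos hr 2
    positivity
  have hderiv : ∀ r ∈ Set.Ioi (0 : ℝ), HasDerivAt (fun r => P √(a ^ 2 + r ^ 2))
      (r • (h √(a ^ 2 + r ^ 2) / (√(a ^ 2 + r ^ 2) : ℝ))) r := by
    intro r hr
    have h1 : HasDerivAt (fun r : ℝ => a ^ 2 + r ^ 2) (2 * r) r := by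
      simpa using ((hasDerivAt_id r).pow 2).const_add (a ^ 2)
    have h2 := (hP.hasDerivAt √(a ^ 2 + r ^ 2)).scomp r (h1.sqrt (hpos r hr).ne')
    refine h2.congr_deriv ?_
    have h3 : ((√(a ^ 2 + r ^ 2) : ℝ) : ℂ) ≠ 0 :=
      Complex.ofReal_ne_zero.2 (Real.sqrt_ne_zero'.2 (hpos r hr))
    simp only [Complex.real_smul]
    push_cast
    field_simp
  have hint : IntegrableOn (fun r : ℝ => r • (h √(a ^ 2 + r ^ 2) / (√(a ^ 2 + r ^ 2) : ℝ)))
      (Set.Ioi 0) := by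
    refine Integrable.mono' (integrable_const_mul_inv_one_add_sq M).integrableOn ?_
      ((ae_restrict_iff' measurableSet_Ioi).2 (Filter.Eventually.of_forall fun r hr => ?_))
    · refine Measurable.aestronglyMeasurable ?_
      have := h.continuous.measurable
      fun_prop
    · have hs : r ≤ √(a ^ 2 + r ^ 2) := Real.le_sqrt_of_sq_le (by nlinarith [sq_nonneg a])
      have hr0 : 0 < r := hr
      have h4 := hM √(a ^ 2 + r ^ 2)
      rw [Real.sq_sqrt (hpos r hr).le] at h4
      rw [norm_smul, norm_div, Complex.norm_real, Real.norm_of_nonneg hr0.le,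
        Real.norm_of_nonneg (Real.sqrt_nonneg _), ← mul_div_assoc,
        div_le_iff₀ (hr0.trans_le hs), mul_comm]
      refine mul_le_mul (h4.trans ?_) hs hr0.le (by positivity)
      gcongr
      nlinarith [sq_nonneg a]
  have hlim : Filter.Tendsto (fun r => P √(a ^ 2 + r ^ 2)) Filter.atTop (nhds 0) := by
    have h0 : Filter.Tendsto P Filter.atTop (nhds 0) := by
      refine squeeze_zero_norm hM' ?_
      rw [← mul_zero M']
      refine Filter.Tendsto.const_mul _ (Filter.Tendsto.inv_tendsto_atTop ?_)
      exact Filter.tendsto_atTop_add_const_left _ _ (Filter.tendsto_pow_atTop (by norm_num))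
    refine h0.comp (Filter.tendsto_atTop_mono (fun r => ?_) Filter.tendsto_id)
    exact Real.le_sqrt_of_sq_le (by simp only [id]; nlinarith [sq_nonneg a])
  have hval := integral_Ioi_of_hasDerivAt_of_tendsto
    (f := fun r => P √(a ^ 2 + r ^ 2)) (by fun_prop) hderiv hint hlim
  have hb : (volume : Measure (EuclideanSpace ℝ (Fin 2))).real (Metric.ball 0 1) = Real.pi := by
    rw [Measure.real, EuclideanSpace.volume_ball_fin_two]
    simp [Real.pi_pos.le]
  simp only [finrank_euclideanSpace, Fintype.card_fin, pow_one, Nat.add_one_sub_one] at hval ⊢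
  rw [hval, hb]
  have hPa : P √(a ^ 2 + 0 ^ 2) = P a := by
    rw [zero_pow two_ne_zero, add_zero, Real.sqrt_sq_eq_abs]
    rcases abs_choice a with h | h <;> rw [h]
    exact hP.even a
  rw [hPa]
  simp only [nsmul_eq_mul, Complex.real_smul]
  push_cast; ring

end IsAntiderivative

/-- The radial function `(H(r) - H(-r)) / r` on `ℝ³`. -/
def radialLift (H : 𝓢(ℝ, ℂ)) (x : R3) : ℂ := oddPart H ‖x‖ / (‖x‖ : ℝ)

theorem measurable_radialLift (H : 𝓢(ℝ, ℂ)) : Measurable (radialLift H) := by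
  have := (oddPart H).continuous.measurable
  unfold radialLift
  fun_prop

theorem lintegral_comp_odd {f : ℝ → ℝ≥0∞} (hf : ∀ r, f (-r) = f r) :
    ∫⁻ r, f r = 2 * ∫⁻ r in Set.Ioi (0 : ℝ), f r := by
  rw [← lintegral_add_compl f (measurableSet_Ioi (a := (0 : ℝ))), two_mul]
  congr 1
  rw [Set.compl_Ioi, ← lintegral_indicator measurableSet_Iic, ← lintegral_neg_eq_self,
    setLIntegral_congr Ioi_ae_eq_Ici, ← lintegral_indicator measurableSet_Ici]
  refine lintegral_congr fun r => ?_
  by_cases hr : 0 ≤ r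
  · rw [Set.indicator_of_mem (by simpa using hr), Set.indicator_of_mem (by simpa using hr), hf]
  · rw [Set.indicator_of_notMem (by simpa using hr), Set.indicator_of_notMem (by simpa using hr)]

theorem eLpNorm_two_eq {X F : Type*} [MeasurableSpace X] [NormedAddCommGroup F] (μ : Measure X)
    (f : X → F) :
    eLpNorm f 2 μ = (∫⁻ x, ‖f x‖ₑ ^ (2 : ℝ) ∂μ) ^ (1 / 2 : ℝ) := by
  rw [eLpNorm_eq_lintegral_rpow_enorm_toReal (by norm_num) (by norm_num)]
  simp

/-- Weighted norms of the radial lift. -/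
theorem eLpNorm_mul_radialLift {w : ℝ → ℂ} (hw : Measurable w) (heven : ∀ r, w (-r) = w r)
    (H : 𝓢(ℝ, ℂ)) : eLpNorm (fun x : R3 => w ‖x‖ * radialLift H x) 2 volume =
      ENNReal.ofReal √(2 * Real.pi) * eLpNorm (fun r => w r * oddPart H r) 2 volume := by
  have hm := (oddPart H).continuous.measurable
  unfold radialLift
  rw [eLpNorm_two_eq, eLpNorm_two_eq,
    lintegral_fun_norm_R3 (f := fun r => ‖w r * (oddPart H r / (r : ℝ))‖ₑ ^ (2 : ℝ)) (by fun_prop),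
    lintegral_comp_odd (f := fun r => ‖w r * oddPart H r‖ₑ ^ (2 : ℝ))
      (fun r => by rw [heven, oddPart_neg, mul_neg, enorm_neg])]
  have h1 : ∫⁻ r in Set.Ioi (0 : ℝ), ENNReal.ofReal (r ^ 2) *
      ‖w r * (oddPart H r / (r : ℝ))‖ₑ ^ (2 : ℝ) =
      ∫⁻ r in Set.Ioi (0 : ℝ), ‖w r * oddPart H r‖ₑ ^ (2 : ℝ) := by
    refine setLIntegral_congr_fun measurableSet_Ioi fun r hr => ?_
    have hr0 : (0 : ℝ) < r := hr
    have e : w r * oddPart H r = (r : ℂ) * (w r * (oddPart H r / (r : ℝ))) := by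
      have : (r : ℂ) ≠ 0 := Complex.ofReal_ne_zero.2 hr0.ne'
      field_simp
    rw [e, enorm_mul (r : ℂ), ENNReal.mul_rpow_of_nonneg _ _ (by norm_num)]
    congr 1
    rw [← ofReal_norm, Complex.norm_real, Real.norm_of_nonneg hr0.le,
      ENNReal.ofReal_rpow_of_nonneg hr0.le (by norm_num)]
    norm_num
  rw [h1, Real.sqrt_eq_rpow, ← ENNReal.ofReal_rpow_of_nonneg (by positivity) (by norm_num),
    ← ENNReal.mul_rpow_of_nonneg _ _ (by norm_num)]
  congr 1
  rw [← mul_assoc]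
  congr 1
  rw [← ENNReal.ofReal_ofNat, ← ENNReal.ofReal_mul (by positivity)]
  congr 1; ring

theorem eLpNorm_mul_oddPart_le {w : ℝ → ℂ} (hw : Measurable w) (heven : ∀ r, w (-r) = w r)
    (H : 𝓢(ℝ, ℂ)) : eLpNorm (fun r => w r * oddPart H r) 2 volume ≤
      2 * eLpNorm (fun r => w r * H r) 2 volume := by
  have hm : AEStronglyMeasurable (fun r => w r * H r) volume :=
    (hw.mul H.continuous.measurable).aestronglyMeasurable
  have hmp := Measure.measurePreserving_neg (volume : Measure ℝ)
  have h1 : eLpNorm (fun r => w r * H (-r)) 2 volume = eLpNorm (fun r => w r * H r) 2 volume := by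
    rw [← eLpNorm_comp_measurePreserving hm hmp]
    congr 1
    funext r
    simp [heven]
  have h2 : AEStronglyMeasurable (fun r => w r * H (-r)) volume :=
    (hw.mul (H.continuous.measurable.comp measurable_neg)).aestronglyMeasurable
  have h3 := eLpNorm_sub_le hm h2 (p := 2) (by norm_num)
  rw [h1, ← two_mul] at h3
  refine le_trans (le_of_eq ?_) h3
  congr 1
  funext r
  rw [oddPart_apply, Pi.sub_apply, mul_sub]

theorem eLpNorm_radialLift (H : 𝓢(ℝ, ℂ)) : eLpNorm (radialLift H) 2 volume =
    ENNReal.ofReal √(2 * Real.pi) * eLpNorm (oddPart H) 2 volume := by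
  simpa using eLpNorm_mul_radialLift (w := fun _ => 1) measurable_const (fun _ => rfl) H

theorem memLp_radialLift (H : 𝓢(ℝ, ℂ)) : MemLp (radialLift H) 2 volume := by
  refine ⟨(measurable_radialLift H).aestronglyMeasurable, ?_⟩
  rw [eLpNorm_radialLift]
  exact ENNReal.mul_lt_top ENNReal.ofReal_lt_top (SchwartzMap.eLpNorm_lt_top _ 2 volume)

theorem integrable_radialLift (H : 𝓢(ℝ, ℂ)) : Integrable (radialLift H) := by
  unfold radialLift
  rw [integrable_fun_norm_addHaar volume (f := fun r : ℝ => oddPart H r / (r : ℝ))]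
  have h := ((oddPart H).integrable_pow_mul volume 1).integrableOn (s := Set.Ioi 0)
  refine Integrable.mono' h ?_ ((ae_restrict_iff' measurableSet_Ioi).2
    (Filter.Eventually.of_forall fun r hr => ?_))
  · refine Measurable.aestronglyMeasurable ?_
    have := (oddPart H).continuous.measurable
    fun_prop
  · have hr0 : (0 : ℝ) < r := hr
    simp only [finrank_euclideanSpace, Fintype.card_fin, Nat.add_one_sub_one]
    rw [norm_smul, norm_div, Complex.norm_real, norm_pow, Real.norm_of_nonneg hr0.le]
    refine le_of_eq ?_
    field_simp

/-- The Fourier transform of the radial lift. -/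
theorem fourier_radialLift (H : 𝓢(ℝ, ℂ)) {ξ : R3} (hξ : ξ ≠ 0) :
    𝓕 (radialLift H) ξ = Complex.I * radialLift (𝓕 H) ξ := by
  set k := ‖ξ‖ with hk
  have hk0 : (k : ℂ) ≠ 0 := Complex.ofReal_ne_zero.2 (norm_ne_zero_iff.2 hξ)
  set e : R3 := EuclideanSpace.single 0 k with he
  have hnorm : ‖ξ‖ = ‖e‖ := by
    rw [he, PiLp.norm_single, Real.norm_of_nonneg (norm_nonneg _)]
  obtain ⟨P, hP⟩ := exists_isAntiderivative (oddPart H) (oddPart_neg H)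
  -- Rotation invariance of `radialLift` allows `ξ` to be moved to the first axis by a reflection;
  -- the slice formula then leaves a one-dimensional transform of the antiderivative.
  set A : R3 ≃ₗᵢ[ℝ] R3 := Submodule.reflection (ℝ ∙ (ξ - e))ᗮ
  have hA : A ξ = e := Submodule.reflection_sub hnorm
  have h1 : 𝓕 (radialLift H) ξ = 𝓕 (radialLift H) e := by
    rw [← hA, ← Real.fourier_comp_linearIsometry A]
    have h : radialLift H ∘ A = radialLift H := by
      funext x
      simp [radialLift]
    rw [h]
  have h2 : 𝓕 (radialLift H) e = -(2 * Real.pi) * 𝓕 P k := by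
    rw [Real.fourier_eq', integral_slice, Real.fourier_eq', ← integral_const_mul]
    · refine integral_congr_ae (Filter.Eventually.of_forall fun a => ?_)
      simp only [radialLift, norm_sliceEquiv, he, EuclideanSpace.inner_single_right,
        sliceEquiv_apply_zero, smul_eq_mul]
      rw [integral_const_mul, hP.integral_plane]
      simp only [RCLike.inner_apply, conj_trivial]
      ring
    · have := (Real.fourierIntegral_convergent_iff (μ := volume) (f := radialLift H) e).2
        (integrable_radialLift H)
      refine this.congr (Filter.Eventually.of_forall fun x => ?_)
      simp only [Circle.smul_def, Real.fourierChar_apply]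
      congr 2
      push_cast; ring
  -- Undoing the antiderivative divides by `2πik`: here `-2π / (2πik) = i / k`.
  have h3 := hP.fourier k
  rw [fourier_oddPart] at h3
  rw [h1, h2, radialLift, ← hk, h3]
  field_simp
  rw [Complex.I_sq]
  ring

/-! ### The radial lift in L² and its intertwining properties -/

/-- The radial lift as an element of `L²`. -/
def liftL2 (H : 𝓢(ℝ, ℂ)) : L2R3 := (memLp_radialLift H).toLp

theorem coeFn_liftL2 (H : 𝓢(ℝ, ℂ)) : liftL2 H =ᵐ[volume] radialLift H := MemLp.coeFn_toLp _

theorem radialLift_add (H K : 𝓢(ℝ, ℂ)) (x : R3) :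
    radialLift (H + K) x = radialLift H x + radialLift K x := by
  simp only [radialLift, oddPart_apply, add_apply]
  ring

theorem liftL2_add (H K : 𝓢(ℝ, ℂ)) : liftL2 (H + K) = liftL2 H + liftL2 K := by
  refine Lp.ext ?_
  filter_upwards [coeFn_liftL2 H, coeFn_liftL2 K, coeFn_liftL2 (H + K),
    Lp.coeFn_add (liftL2 H) (liftL2 K)] with x h1 h2 h3 h4
  rw [h3, h4, Pi.add_apply, h1, h2, radialLift_add]

theorem enorm_liftL2 (H : 𝓢(ℝ, ℂ)) :
    ‖liftL2 H‖ₑ = ENNReal.ofReal √(2 * Real.pi) * eLpNorm (oddPart H) 2 volume := by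
  rw [Lp.enorm_def, eLpNorm_congr_ae (coeFn_liftL2 H), eLpNorm_radialLift]

theorem eLpNorm_oddPart_le (H : 𝓢(ℝ, ℂ)) :
    eLpNorm (oddPart H) 2 volume ≤ 2 * eLpNorm H 2 volume := by
  simpa using eLpNorm_mul_oddPart_le (w := fun _ => 1) measurable_const (fun _ => rfl) H

/-- The L² transform is identified with the integral one through tempered distributions: on test
functions the self-adjointness of the Fourier transform applies, the lift being integrable. -/
theorem fourier_liftL2 (H : 𝓢(ℝ, ℂ)) : (𝓕 (liftL2 H) : L2R3) = Complex.I • liftL2 (𝓕 H) := by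
  rw [← sub_eq_zero, ← Submodule.mem_bot (R := ℂ),
    ← Lp.ker_toTemperedDistributionCLM_eq_bot (μ := (volume : Measure R3))]
  rw [LinearMap.mem_ker, ContinuousLinearMap.coe_coe, map_sub, sub_eq_zero]
  ext g
  simp only [Lp.toTemperedDistributionCLM_apply]
  rw [← Lp.fourier_toTemperedDistribution_eq, TemperedDistribution.fourier_apply,
    Lp.toTemperedDistribution_apply, Lp.toTemperedDistribution_apply]
  have h1 : ∫ x, (𝓕 g : 𝓢(R3, ℂ)) x • liftL2 H x = ∫ x, 𝓕 (g : R3 → ℂ) x * radialLift H x := by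
    refine integral_congr_ae ?_
    filter_upwards [coeFn_liftL2 H] with x hx
    rw [hx, fourier_coe, smul_eq_mul]
  have h2 := VectorFourier.integral_bilin_fourierIntegral_eq_flip (ContinuousLinearMap.mul ℂ ℂ)
    (μ := volume) (ν := volume) (L := innerₗ R3) Real.continuous_fourierChar continuous_inner
    g.integrable (integrable_radialLift H)
  simp only [ContinuousLinearMap.mul_apply', flip_innerₗ] at h2
  rw [h1]
  refine h2.trans (integral_congr_ae ?_)
  have h0 : ∀ᵐ x : R3, x ≠ 0 := by simp [ae_iff]
  filter_upwards [coeFn_liftL2 (𝓕 H), Lp.coeFn_smul Complex.I (liftL2 (𝓕 H)), h0] with x hx hs hx0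
  rw [hs, Pi.smul_apply, hx, smul_eq_mul, smul_eq_mul, ← fourier_radialLift H hx0]
  rfl

theorem coeFn_fourier_liftL2 (H : 𝓢(ℝ, ℂ)) :
    (𝓕 (liftL2 H) : L2R3) =ᵐ[volume] fun ξ => Complex.I * radialLift (𝓕 H) ξ := by
  rw [fourier_liftL2]
  filter_upwards [coeFn_liftL2 (𝓕 H), Lp.coeFn_smul Complex.I (liftL2 (𝓕 H))] with x hx hs
  rw [hs, Pi.smul_apply, hx, smul_eq_mul]

theorem eLpNorm_mul_fourier_liftL2 {w : ℝ → ℂ} (hw : Measurable w) (heven : ∀ r, w (-r) = w r)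
    (H : 𝓢(ℝ, ℂ)) : eLpNorm (fun ξ => w ‖ξ‖ * (𝓕 (liftL2 H) : L2R3) ξ) 2 volume =
      ENNReal.ofReal √(2 * Real.pi) *
        eLpNorm (fun r => w r * (𝓕 (oddPart H) : 𝓢(ℝ, ℂ)) r) 2 volume := by
  rw [fourier_oddPart, ← eLpNorm_mul_radialLift hw heven]
  refine eLpNorm_congr_norm_ae ?_
  filter_upwards [coeFn_fourier_liftL2 H] with ξ hξ
  rw [hξ, norm_mul, norm_mul, norm_mul, Complex.norm_I, one_mul]

theorem sobolevNorm_eq_eLpNorm (s r : ℝ) (u : L2R3) : sobolevNorm s r u =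
    eLpNorm (fun ξ => (((‖ξ‖ ^ 2 + 1 / r ^ 2) ^ (s / 2) : ℝ) : ℂ) * (𝓕 u : L2R3) ξ) 2 volume := by
  rw [eLpNorm_two_eq, sobolevNorm]
  congr 1
  refine lintegral_congr fun ξ => ?_
  have h0 : 0 ≤ ‖ξ‖ ^ 2 + 1 / r ^ 2 := by positivity
  rw [enorm_mul, ENNReal.mul_rpow_of_nonneg _ _ (by norm_num)]
  congr 1
  rw [← ofReal_norm, Complex.norm_real, Real.norm_of_nonneg (by positivity),
    ENNReal.ofReal_rpow_of_nonneg (by positivity) (by norm_num), ← Real.rpow_mul h0]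
  congr 2
  ring

theorem sobolevNorm_liftL2 (s ρ : ℝ) (H : 𝓢(ℝ, ℂ)) :
    sobolevNorm s ρ (liftL2 H) = ENNReal.ofReal √(2 * Real.pi) * lineSobolev s ρ (oddPart H) := by
  rw [sobolevNorm_eq_eLpNorm]
  exact eLpNorm_mul_fourier_liftL2 (w := fun ξ => (((ξ ^ 2 + 1 / ρ ^ 2) ^ (s / 2) : ℝ) : ℂ))
    (measurable_lineSobolev_weight s ρ) (fun r => by rw [neg_sq]) H

theorem lineSobolev_oddPart_le (s ρ : ℝ) (H : 𝓢(ℝ, ℂ)) :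
    lineSobolev s ρ (oddPart H) ≤ 2 * lineSobolev s ρ H := by
  unfold lineSobolev
  rw [fourier_oddPart]
  exact eLpNorm_mul_oddPart_le (measurable_lineSobolev_weight s ρ) (fun r => by rw [neg_sq]) (𝓕 H)

theorem radialLift_eq_mul {b : ℝ → ℂ} (heven : ∀ r, b (-r) = b r) {H H' : 𝓢(ℝ, ℂ)}
    (h : ∀ r, H' r = b r * H r) (x : R3) : radialLift H' x = b ‖x‖ * radialLift H x := by
  simp only [radialLift, oddPart_apply, h, heven]
  ring

theorem coeFn_mulL2 {m : R3 → ℂ} (hm : Continuous m) (hb : ∀ x, ‖m x‖ ≤ 1) (u : L2R3) :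
    mulL2 m hm hb u =ᵐ[volume] fun x => m x * u x := MemLp.coeFn_toLp _

theorem mulL2_liftL2 {m : R3 → ℂ} (hm : Continuous m) (hb : ∀ x, ‖m x‖ ≤ 1) {b : ℝ → ℂ}
    (hmb : ∀ x, m x = b ‖x‖) (heven : ∀ r, b (-r) = b r) {H H' : 𝓢(ℝ, ℂ)}
    (h : ∀ r, H' r = b r * H r) : mulL2 m hm hb (liftL2 H) = liftL2 H' := by
  refine Lp.ext ?_
  filter_upwards [coeFn_mulL2 hm hb (liftL2 H), coeFn_liftL2 H, coeFn_liftL2 H'] with x h1 h2 h3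
  rw [h1, h2, h3, radialLift_eq_mul heven h, hmb]

theorem mulL2_smul {m : R3 → ℂ} (hm : Continuous m) (hb : ∀ x, ‖m x‖ ≤ 1) (c : ℂ) (u : L2R3) :
    mulL2 m hm hb (c • u) = c • mulL2 m hm hb u := by
  refine Lp.ext ?_
  filter_upwards [coeFn_mulL2 hm hb (c • u), coeFn_mulL2 hm hb u, Lp.coeFn_smul c u,
    Lp.coeFn_smul c (mulL2 m hm hb u)] with x h1 h2 h3 h4
  rw [h1, h4, h3, Pi.smul_apply, Pi.smul_apply, h2, smul_eq_mul, smul_eq_mul]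
  ring

/-- The Schrödinger propagator on the line. -/
def lineSchrodinger (t : ℝ) : 𝓢(ℝ, ℂ) →L[ℂ] 𝓢(ℝ, ℂ) :=
  fourierMultiplierCLM ℂ fun ξ : ℝ =>
    Complex.exp ((-(4 * Real.pi ^ 2 * t * ξ ^ 2) : ℝ) * Complex.I)

theorem fourier_lineSchrodinger (t : ℝ) (H : 𝓢(ℝ, ℂ)) (ξ : ℝ) :
    (𝓕 (lineSchrodinger t H) : 𝓢(ℝ, ℂ)) ξ =
      Complex.exp ((-(4 * Real.pi ^ 2 * t * ξ ^ 2) : ℝ) * Complex.I) * (𝓕 H : 𝓢(ℝ, ℂ)) ξ :=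
  fourier_fourierMultiplierCLM (hasTemperateGrowth_schrodinger t) H ξ

/-- The symbol is even and depends on `|ξ|` only, so multiplication by it commutes with the lift on
the Fourier side. -/
theorem freeSchrodinger_liftL2 (t : ℝ) (H : 𝓢(ℝ, ℂ)) :
    freeSchrodinger t (liftL2 H) = liftL2 (lineSchrodinger t H) := by
  have h : mulL2 (schrodingerSymbol t) (continuous_schrodingerSymbol t)
      (norm_schrodingerSymbol_le t) (𝓕 (liftL2 H)) = 𝓕 (liftL2 (lineSchrodinger t H)) := by
    rw [fourier_liftL2, fourier_liftL2, mulL2_smul]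
    congr 1
    exact mulL2_liftL2 _ _
      (b := fun ξ : ℝ => Complex.exp ((-(4 * Real.pi ^ 2 * t * ξ ^ 2) : ℝ) * Complex.I))
      (fun x => rfl) (fun r => by rw [neg_sq]) (fourier_lineSchrodinger t H)
  rw [freeSchrodinger, h, FourierTransform.fourierInv_fourier_eq]

theorem lineSchrodinger_wavePiece (σ N t : ℝ) {a : ℝ → ℂ} (ha : a.HasTemperateGrowth)
    (g : 𝓢(ℝ, ℂ)) : lineSchrodinger (σ * t) (wavePiece σ N 0 a g) = wavePiece σ N t a g := by
  refine ext_of_fourier fun ξ => ?_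
  rw [fourier_lineSchrodinger, fourier_wavePiece _ _ _ ha, fourier_wavePiece _ _ _ ha]
  simp only [waveSymbol]
  simp
  ring

theorem weighted_liftL2 (H : 𝓢(ℝ, ℂ)) :
    weighted (liftL2 H) = liftL2 (smulLeftCLM ℂ lineWeight H) := by
  refine mulL2_liftL2 _ _ (b := lineWeight) (fun x => ?_) (fun r => by simp [lineWeight])
    (fun r => by rw [smulLeftCLM_apply_apply hasTemperateGrowth_lineWeight, smul_eq_mul])
  rw [inverseSquareWeight, lineWeight, bracket, Real.sqrt_eq_rpow, ← Real.rpow_mul (by positivity)]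
  norm_num [Real.rpow_neg_one]

/-! ### Weak gradients -/

/-- A weak gradient of `v` on all of space also serves `u` on `U`, because test functions supported
in `U` cannot distinguish them. This permits replacing a wave near the origin by its truncation. -/
theorem gradNorm_mono_of_eqOn {u v : L2R3} {U : Set R3}
    (h : ∀ᵐ x, x ∈ U → u x = v x) : gradNorm u U ≤ gradNorm v Set.univ := by
  refine le_iInf₂ fun G hG => ?_
  have hG' : IsWeakGradient u U G := by
    refine ⟨hG.1.mono_measure (Measure.restrict_mono (Set.subset_univ U) le_rfl), fun φ h1 h2 h3 j => ?_⟩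
    have e1 : ∫ x, u x * fderiv ℝ φ x (EuclideanSpace.single j 1) =
        ∫ x, v x * fderiv ℝ φ x (EuclideanSpace.single j 1) := by
      refine integral_congr_ae ?_
      filter_upwards [h] with x hx
      by_cases hxU : x ∈ U
      · rw [hx hxU]
      · have : fderiv ℝ φ x = 0 := by
          refine image_eq_zero_of_notMem_tsupport fun hx' => hxU (h3 (tsupport_fderiv_subset ℝ hx'))
        rw [this]
        simp
    have e2 : ∫ x in U, G x j * φ x = ∫ x in Set.univ, G x j * φ x := by
      rw [setIntegral_univ]
      refine setIntegral_eq_integral_of_forall_compl_eq_zero fun x hx => ?_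
      rw [image_eq_zero_of_notMem_tsupport fun hx' => hx (h3 hx'), mul_zero]
    rw [e1, e2]
    exact hG.2 φ h1 h2 (Set.subset_univ _) j
  exact (iInf₂_le G hG').trans (eLpNorm_mono_measure _ (Measure.restrict_mono (Set.subset_univ U) le_rfl))

theorem gradNorm_empty (u : L2R3) : gradNorm u ∅ = 0 := by
  refine le_antisymm ((iInf₂_le (fun _ => 0) ⟨by simp, fun φ _ _ h j => ?_⟩).trans (by simp)) zero_le
  have hφ : φ = 0 := tsupport_eq_empty_iff.1 (Set.subset_empty_iff.1 h)
  rw [hφ, fderiv_zero]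
  simp

/-- Integration by parts on the Fourier side. -/
theorem integral_mul_fderiv_eq (u v : L2R3) (j : Fin 3)
    (hv : v =ᵐ[volume] fun ξ => (2 * Real.pi * Complex.I * (ξ j : ℝ)) * (𝓕 u : L2R3) ξ)
    {φ : R3 → ℂ} (h1 : ContDiff ℝ ∞ φ) (h2 : HasCompactSupport φ) :
    ∫ x, u x * fderiv ℝ φ x (EuclideanSpace.single j 1) = -∫ x, (𝓕⁻ v : L2R3) x * φ x := by
  set ψ : 𝓢(R3, ℂ) := h2.toSchwartzMap h1
  set m : R3 := EuclideanSpace.single j 1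
  have hm : (fun x : R3 => inner ℝ x m).HasTemperateGrowth := by fun_prop
  have e1 : ∫ x, u x * fderiv ℝ φ x m =
      Lp.toTemperedDistribution u (LineDeriv.lineDerivOp m ψ) := by
    rw [Lp.toTemperedDistribution_apply]
    refine integral_congr_ae (Filter.Eventually.of_forall fun x => ?_)
    simp only [lineDerivOp_apply_eq_fderiv, smul_eq_mul]
    exact mul_comm _ _
  have e2 : ∫ x, (𝓕⁻ v : L2R3) x * φ x = Lp.toTemperedDistribution (𝓕⁻ v : L2R3) ψ := by
    rw [Lp.toTemperedDistribution_apply]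
    refine integral_congr_ae (Filter.Eventually.of_forall fun x => ?_)
    simp only [smul_eq_mul]
    exact mul_comm _ _
  have e3 : u = (𝓕⁻ (𝓕 u : L2R3) : L2R3) := (FourierTransform.fourierInv_fourier_eq u).symm
  rw [e1, e2, ← Lp.fourierInv_toTemperedDistribution_eq, TemperedDistribution.fourierInv_apply]
  conv_lhs => rw [e3]
  rw [← Lp.fourierInv_toTemperedDistribution_eq, TemperedDistribution.fourierInv_apply,
    fourierInv_lineDerivOp_eq, Lp.toTemperedDistribution_apply, Lp.toTemperedDistribution_apply,
    ← integral_neg]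
  refine integral_congr_ae ?_
  filter_upwards [hv] with ξ hξ
  rw [hξ, smul_apply, smulLeftCLM_apply_apply hm]
  have : inner ℝ ξ m = ξ j := by
    simp [m, EuclideanSpace.inner_single_right]
  rw [this]
  simp only [smul_eq_mul, Complex.real_smul]
  ring

theorem norm_gradient_symbol (ξ : R3) (j : Fin 3) :
    ‖(2 * Real.pi * Complex.I * (ξ j : ℝ) : ℂ)‖ = 2 * Real.pi * |ξ j| := by
  simp [abs_of_pos Real.pi_pos]

/-- The inverse transforms of `2πiξ_j û` form a weak gradient, and Plancherel computes its norm.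
Only an upper bound is needed, as `gradNorm` is an infimum. -/
theorem gradNorm_univ_le (u : L2R3) : gradNorm u Set.univ ≤ ENNReal.ofReal (2 * Real.pi) *
    eLpNorm (fun ξ => ((‖ξ‖ : ℝ) : ℂ) * (𝓕 u : L2R3) ξ) 2 volume := by
  have hpi := Real.pi_pos
  by_cases htop : eLpNorm (fun ξ => ((‖ξ‖ : ℝ) : ℂ) * (𝓕 u : L2R3) ξ) 2 volume = ⊤
  · rw [htop, ENNReal.mul_top (by simpa using hpi)]
    exact le_top
  have hû := Lp.aestronglyMeasurable (𝓕 u : L2R3)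
  have hmem : MemLp (fun ξ => ((‖ξ‖ : ℝ) : ℂ) * (𝓕 u : L2R3) ξ) 2 volume :=
    ⟨AEStronglyMeasurable.mul (by fun_prop) hû, lt_top_iff_ne_top.2 htop⟩
  have hvj : ∀ j : Fin 3, MemLp (fun ξ : R3 => (2 * Real.pi * Complex.I * (ξ j : ℝ)) *
      (𝓕 u : L2R3) ξ) 2 volume := fun j => by
    refine hmem.of_le_mul (c := 2 * Real.pi) (AEStronglyMeasurable.mul (by fun_prop) hû)
      (Filter.Eventually.of_forall fun ξ => ?_)
    rw [norm_mul _ ((𝓕 u : L2R3) ξ), norm_gradient_symbol, norm_mul, Complex.norm_real, norm_norm, ← mul_assoc]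
    gcongr
    exact PiLp.norm_apply_le ξ j
  set v : Fin 3 → L2R3 := fun j => (hvj j).toLp
  set G : R3 → EuclideanSpace ℂ (Fin 3) := fun x => WithLp.toLp 2 fun j => (𝓕⁻ (v j) : L2R3) x
  have hG : MemLp G 2 volume := MemLp.of_eval_piLp fun j => Lp.memLp (𝓕⁻ (v j) : L2R3)
  have hweak : IsWeakGradient u Set.univ G := by
    rw [IsWeakGradient, Measure.restrict_univ]
    exact ⟨hG, fun φ h1 h2 _ j => integral_mul_fderiv_eq u (v j) j (MemLp.coeFn_toLp _) h1 h2⟩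
  refine (iInf₂_le G hweak).trans (le_of_eq ?_)
  have hnorm : ∀ w : L2R3, ∫⁻ x, ‖(𝓕⁻ w : L2R3) x‖ₑ ^ (2 : ℝ) = ∫⁻ x, ‖w x‖ₑ ^ (2 : ℝ) := by
    intro w
    have h1 : ‖(𝓕⁻ w : L2R3)‖ₑ = ‖w‖ₑ := by
      rw [enorm_eq_iff_norm_eq, ← Lp.norm_fourier_eq, FourierTransform.fourier_fourierInv_eq]
    rw [Lp.enorm_def, Lp.enorm_def, eLpNorm_two_eq, eLpNorm_two_eq] at h1
    exact (ENNReal.rpow_left_injective (by norm_num)) h1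
  have hsq : ∫⁻ x, ‖G x‖ₑ ^ (2 : ℝ) = ∑ j, ∫⁻ ξ, ‖v j ξ‖ₑ ^ (2 : ℝ) := by
    simp_rw [← hnorm (v _)]
    rw [← lintegral_finsetSum' _ fun j _ =>
      (Lp.aestronglyMeasurable (𝓕⁻ (v j) : L2R3)).enorm.pow_const _]
    refine lintegral_congr fun x => ?_
    simp only [← ofReal_norm]
    rw [ENNReal.ofReal_rpow_of_nonneg (norm_nonneg _) (by norm_num), Real.rpow_two,
      EuclideanSpace.norm_sq_eq, ENNReal.ofReal_sum_of_nonneg fun _ _ => by positivity]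
    refine Finset.sum_congr rfl fun j _ => ?_
    rw [ENNReal.ofReal_rpow_of_nonneg (norm_nonneg _) (by norm_num), Real.rpow_two]
  rw [Measure.restrict_univ, eLpNorm_two_eq, eLpNorm_two_eq, hsq]
  have hv : ∀ j, ∫⁻ ξ, ‖v j ξ‖ₑ ^ (2 : ℝ) =
      ∫⁻ ξ : R3, ENNReal.ofReal ((2 * Real.pi * |ξ j| * ‖(𝓕 u : L2R3) ξ‖) ^ 2) := fun j => by
    refine lintegral_congr_ae ?_
    filter_upwards [MemLp.coeFn_toLp (hvj j)] with ξ hξ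
    rw [hξ, ← ofReal_norm, norm_mul, norm_gradient_symbol,
      ENNReal.ofReal_rpow_of_nonneg (by positivity) (by norm_num), Real.rpow_two]
  simp_rw [hv]
  rw [← lintegral_finsetSum' _ fun j _ => ?_]
  · have h3 : ∀ ξ : R3, ∑ j, ENNReal.ofReal ((2 * Real.pi * |ξ j| * ‖(𝓕 u : L2R3) ξ‖) ^ 2) =
        ENNReal.ofReal (2 * Real.pi) ^ (2 : ℝ) *
          ‖((‖ξ‖ : ℝ) : ℂ) * (𝓕 u : L2R3) ξ‖ₑ ^ (2 : ℝ) := by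
      intro ξ
      rw [← ENNReal.ofReal_sum_of_nonneg fun _ _ => by positivity, ← ofReal_norm,
        ENNReal.ofReal_rpow_of_nonneg (by positivity) (by norm_num),
        ENNReal.ofReal_rpow_of_nonneg (by positivity) (by norm_num),
        ← ENNReal.ofReal_mul (by positivity), Real.rpow_two, Real.rpow_two, norm_mul,
        Complex.norm_real, norm_norm, mul_pow, mul_pow ‖ξ‖, EuclideanSpace.norm_sq_eq]
      congr 1
      rw [Finset.sum_mul, Finset.mul_sum]
      refine Finset.sum_congr rfl fun j _ => ?_
      rw [Real.norm_eq_abs]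
      ring
    simp_rw [h3]
    rw [lintegral_const_mul' _ _ (ENNReal.rpow_ne_top_of_nonneg (by norm_num) ENNReal.ofReal_ne_top), ENNReal.mul_rpow_of_nonneg _ _ (by norm_num),
      ← ENNReal.rpow_mul]
    norm_num
  · have := (Lp.aestronglyMeasurable (𝓕 u : L2R3)).norm.aemeasurable
    fun_prop

theorem gradNorm_liftL2_le (H : 𝓢(ℝ, ℂ)) : gradNorm (liftL2 H) Set.univ ≤
    ENNReal.ofReal (2 * √(2 * Real.pi)) * eLpNorm (derivCLM ℂ ℂ H) 2 volume := by
  have hpi := Real.pi_pos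
  have h1 : eLpNorm (fun ξ : ℝ => ((|ξ| : ℝ) : ℂ) * (𝓕 (oddPart H) : 𝓢(ℝ, ℂ)) ξ) 2 volume ≤
      2 * eLpNorm (fun ξ : ℝ => ((|ξ| : ℝ) : ℂ) * (𝓕 H : 𝓢(ℝ, ℂ)) ξ) 2 volume := by
    rw [fourier_oddPart]
    exact eLpNorm_mul_oddPart_le (w := fun ξ => ((|ξ| : ℝ) : ℂ)) (by fun_prop)
      (fun r => by rw [abs_neg]) (𝓕 H)
  have h2 : ENNReal.ofReal (2 * Real.pi) *
      eLpNorm (fun ξ : ℝ => ((|ξ| : ℝ) : ℂ) * (𝓕 H : 𝓢(ℝ, ℂ)) ξ) 2 volume =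
      eLpNorm (derivCLM ℂ ℂ H) 2 volume := by
    have h3 := eLpNorm_const_smul ((2 * Real.pi : ℝ) : ℂ)
      (fun ξ : ℝ => ((|ξ| : ℝ) : ℂ) * (𝓕 H : 𝓢(ℝ, ℂ)) ξ) 2 volume
    rw [← ofReal_norm, Complex.norm_real, Real.norm_of_nonneg (by positivity)] at h3
    rw [← h3, ← eLpNorm_fourier (derivCLM ℂ ℂ H)]
    refine eLpNorm_congr_norm_ae (Filter.Eventually.of_forall fun ξ => ?_)
    rw [fourier_derivCLM]
    simp [abs_of_pos hpi]
    ring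
  refine (gradNorm_univ_le _).trans ?_
  have h4 := eLpNorm_mul_fourier_liftL2 (w := fun ξ => ((|ξ| : ℝ) : ℂ)) (by fun_prop)
    (fun r => by rw [abs_neg]) H
  simp only [abs_norm] at h4
  rw [h4, ← h2]
  calc _ ≤ ENNReal.ofReal (2 * Real.pi) * (ENNReal.ofReal √(2 * Real.pi) *
        (2 * eLpNorm (fun ξ : ℝ => ((|ξ| : ℝ) : ℂ) * (𝓕 H : 𝓢(ℝ, ℂ)) ξ) 2 volume)) := by gcongr
    _ = _ := by
      rw [ENNReal.ofReal_mul (by norm_num : (0 : ℝ) ≤ 2) (q := √(2 * Real.pi)), ENNReal.ofReal_ofNat]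
      ring

/-! ### The low-frequency part -/

/-- A smooth function supported in `[-2, 2]`, multiplied by a power. -/
def lowPass (j : ℕ) (s : ℝ) : ℂ := (s : ℂ) ^ j * (1 - highPass s - highPass (-s))

theorem hasTemperateGrowth_lowPass_comp (j : ℕ) (c : ℝ) :
    (fun ξ : ℝ => lowPass j (ξ / c)).HasTemperateGrowth := by
  have h1 : (fun ξ : ℝ => highPass (c⁻¹ * ξ)).HasTemperateGrowth :=
    hasTemperateGrowth_highPass.comp (f := fun ξ : ℝ => c⁻¹ * ξ) (by fun_prop)
  have h2 : (fun ξ : ℝ => highPass (-c⁻¹ * ξ)).HasTemperateGrowth :=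
    hasTemperateGrowth_highPass.comp (f := fun ξ : ℝ => -c⁻¹ * ξ) (by fun_prop)
  have h0 : (fun ξ : ℝ => ((c⁻¹ : ℝ) : ℂ) * ((ξ : ℝ) : ℂ)).HasTemperateGrowth :=
    (Function.HasTemperateGrowth.const _).mul Function.Complex.hasTemperateGrowth_ofReal
  have h3 : (fun ξ : ℝ => (((c⁻¹ : ℝ) : ℂ) * ((ξ : ℝ) : ℂ)) ^ j).HasTemperateGrowth := by
    induction j with
    | zero => simp
    | succ j ih =>
      simp only [pow_succ]
      exact ih.mul h0
  have h4 := h3.mul (((Function.HasTemperateGrowth.const (1 : ℂ)).sub h1).sub h2)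
  refine Eq.mp (congrArg _ (funext fun ξ => ?_)) h4
  simp only [lowPass, Pi.mul_apply, Pi.sub_apply]
  rw [div_eq_inv_mul, neg_mul]
  push_cast
  rfl

theorem norm_lowPass_le (j : ℕ) (s : ℝ) : ‖lowPass j s‖ ≤ 2 ^ j * 3 := by
  rcases lt_or_ge 2 |s| with h | h
  · have h0 : lowPass j s = 0 := by
      rcases lt_abs.1 h with h | h
      · rw [lowPass, highPass_of_ge h.le, highPass_of_le (by linarith)]; simp
      · rw [lowPass, highPass_of_ge h.le, highPass_of_le (by linarith)]; simp
    rw [h0, norm_zero]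
    positivity
  · rw [lowPass, norm_mul, norm_pow, Complex.norm_real, Real.norm_eq_abs]
    refine mul_le_mul (pow_le_pow_left₀ (abs_nonneg _) h j) ?_ (norm_nonneg _) (by positivity)
    have h1 := norm_highPass_le s
    have h2 := norm_highPass_le (-s)
    calc _ ≤ ‖(1 : ℂ)‖ + ‖highPass s‖ + ‖highPass (-s)‖ :=
          (norm_sub_le _ _).trans (add_le_add_left (norm_sub_le _ _) _)
      _ ≤ _ := by rw [norm_one]; linarith

/-- The multiplier localizing to frequencies `|ξ| ≤ 2 N`. -/
def lowPiece (N : ℝ) (j : ℕ) : 𝓢(ℝ, ℂ) →L[ℂ] 𝓢(ℝ, ℂ) :=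
  fourierMultiplierCLM ℂ fun ξ : ℝ => lowPass j (ξ / N)

theorem fourier_lowPiece (N : ℝ) (j : ℕ) (g : 𝓢(ℝ, ℂ)) (ξ : ℝ) :
    (𝓕 (lowPiece N j g) : 𝓢(ℝ, ℂ)) ξ = lowPass j (ξ / N) * (𝓕 g : 𝓢(ℝ, ℂ)) ξ :=
  fourier_fourierMultiplierCLM (hasTemperateGrowth_lowPass_comp j N) g ξ

/-- The powers built into `lowPass` keep the family closed under differentiation, at the cost of `N`
per derivative. -/
theorem derivCLM_lowPiece {N : ℝ} (hN : N ≠ 0) (j : ℕ) (g : 𝓢(ℝ, ℂ)) :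
    derivCLM ℂ ℂ (lowPiece N j g) = (2 * Real.pi * Complex.I * (N : ℝ) : ℂ) • lowPiece N (j + 1) g := by
  refine ext_of_fourier fun ξ => ?_
  rw [fourier_derivCLM, fourier_lowPiece, FourierTransform.fourier_smul, smul_apply,
    fourier_lowPiece, lowPass, lowPass, smul_eq_mul]
  have : (N : ℂ) ≠ 0 := Complex.ofReal_ne_zero.2 hN
  push_cast
  rw [pow_succ]
  field_simp

theorem lowPiece_derivCLM {N : ℝ} (hN : N ≠ 0) (j : ℕ) (g : 𝓢(ℝ, ℂ)) :
    lowPiece N j (derivCLM ℂ ℂ g) = (2 * Real.pi * Complex.I * (N : ℝ) : ℂ) • lowPiece N (j + 1) g := by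
  rw [← derivCLM_lowPiece hN]
  refine ext_of_fourier fun ξ => ?_
  rw [fourier_derivCLM, fourier_lowPiece, fourier_lowPiece, fourier_derivCLM]
  ring

theorem eLpNorm_lowPiece_le (N : ℝ) (j : ℕ) (g : 𝓢(ℝ, ℂ)) :
    eLpNorm (lowPiece N j g) 2 volume ≤ ENNReal.ofReal (2 ^ j * 3) * eLpNorm g 2 volume := by
  rw [← eLpNorm_fourier, ← eLpNorm_fourier g]
  refine eLpNorm_le_mul_eLpNorm_of_ae_le_mul (Filter.Eventually.of_forall fun ξ => ?_) 2
  rw [fourier_lowPiece, norm_mul]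
  exact mul_le_mul_of_nonneg_right (norm_lowPass_le j _) (norm_nonneg _)

namespace Regime

variable {δ κ : ℝ}

/-- The same exchange as in `U_cutoff_eq`, with the power `j` in the role of the amplitude. -/
theorem lowPiece_cutoff_eq (G : Regime δ κ) {B : ℕ → ℝ} {χ : ℕ → ℝ → ℂ} (hχ : G.IsCutoff B χ)
    (i j : ℕ) (F : 𝓢(ℝ, ℂ)) : lowPiece G.N j (smulLeftCLM ℂ (χ i) F) =
      lowPiece G.N j (smulLeftCLM ℂ (χ i) (resolvent G.N F)) +
      (Complex.I • lowPiece G.N (j + 1) (smulLeftCLM ℂ (χ i) (resolvent G.N F)) +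
      ((-(2 * Real.pi)⁻¹ : ℝ) : ℂ) • lowPiece G.N j (smulLeftCLM ℂ (χ (i + 1)) (resolvent G.N F))) := by
  have hN := G.N_pos
  set Φ := resolvent G.N F with hΦ
  have h1 := derivCLM_smulLeftCLM (b' := fun x => (G.N : ℂ) * χ (i + 1) x) (hχ.hasTemperateGrowth i)
    (Function.HasTemperateGrowth.mul (Function.HasTemperateGrowth.const _)
      (hχ.hasTemperateGrowth (i + 1))) (hχ.hasDerivAt i) Φ
  have h2 : smulLeftCLM ℂ (fun x => (G.N : ℂ) * χ (i + 1) x) Φ =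
      (G.N : ℂ) • smulLeftCLM ℂ (χ (i + 1)) Φ :=
    congrArg (fun T => T Φ) (smulLeftCLM_smul (F := ℂ) (hχ.hasTemperateGrowth (i + 1)) (G.N : ℂ))
  have h3 : smulLeftCLM ℂ (χ i) (derivCLM ℂ ℂ Φ) =
      derivCLM ℂ ℂ (smulLeftCLM ℂ (χ i) Φ) - (G.N : ℂ) • smulLeftCLM ℂ (χ (i + 1)) Φ := by
    rw [h1, h2]; abel
  have hNc : (G.N : ℂ) ≠ 0 := Complex.ofReal_ne_zero.2 hN.ne'
  have hpi : (Real.pi : ℂ) ≠ 0 := Complex.ofReal_ne_zero.2 Real.pi_ne_zero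
  conv_lhs => rw [resolvent_add_deriv hN F, ← hΦ]
  rw [map_add, map_smul, h3, map_add, map_smul, map_sub, map_smul, lowPiece_derivCLM hN.ne',
    smul_sub, smul_smul, smul_smul, sub_eq_add_neg, ← neg_smul]
  congr 3
  · push_cast
    field_simp
  · push_cast
    field_simp

theorem eLpNorm_lowPiece_cutoff_iterate (B : ℕ → ℝ) (k : ℕ) : ∀ i j : ℕ, ∃ C : ℝ≥0,
    ∀ (G : Regime δ κ) (χ : ℕ → ℝ → ℂ), G.IsCutoff B χ → ∀ F : 𝓢(ℝ, ℂ),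
      eLpNorm (lowPiece G.N j (smulLeftCLM ℂ (χ i) F)) 2 volume ≤
        C * eLpNorm ((resolvent G.N)^[k] F) 2 volume := by
  induction k with
  | zero =>
    intro i j
    refine ⟨(2 ^ j * 3 : ℝ).toNNReal * (B i).toNNReal, fun G χ hχ F => ?_⟩
    refine (eLpNorm_lowPiece_le _ _ _).trans ((mul_le_mul_right
      (eLpNorm_smulLeftCLM_le (hχ.hasTemperateGrowth i) (hχ.bound i) F) _).trans (le_of_eq ?_))
    rw [Function.iterate_zero, id, ENNReal.coe_mul, ENNReal.ofReal, ENNReal.ofReal]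
    ring
  | succ k ih =>
    intro i j
    obtain ⟨C1, h1⟩ := ih i j
    obtain ⟨C2, h2⟩ := ih i (j + 1)
    obtain ⟨C3, h3⟩ := ih (i + 1) j
    refine ⟨C1 + (C2 + C3), fun G χ hχ F => ?_⟩
    have hpi : (2 * Real.pi)⁻¹ ≤ 1 := inv_le_one_of_one_le₀ (by linarith [Real.pi_gt_three])
    have hpi0 : 0 ≤ (2 * Real.pi)⁻¹ := by positivity
    rw [lowPiece_cutoff_eq G hχ, Function.iterate_succ_apply, ENNReal.coe_add, ENNReal.coe_add,
      add_mul, add_mul]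
    simp only [← lineSobolev_zero 1] at h1 h2 h3 ⊢
    refine (lineSobolev_add_le _ _ _ _).trans (add_le_add (h1 G χ hχ _) ?_)
    refine (lineSobolev_add_le _ _ _ _).trans (add_le_add ?_ ?_)
    · rw [lineSobolev_smul]
      refine (mul_le_of_le_one_left zero_le ?_).trans (h2 G χ hχ _)
      rw [← ofReal_norm, Complex.norm_I, ENNReal.ofReal_one]
    · rw [lineSobolev_smul]
      refine (mul_le_of_le_one_left zero_le ?_).trans (h3 G χ hχ _)
      rw [← ofReal_norm, Complex.norm_real, Real.norm_eq_abs, abs_neg, abs_of_nonneg hpi0]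
      exact ENNReal.ofReal_le_one.2 hpi

end Regime

namespace Setting

variable {δ κ : ℝ}

/-- The low frequency part of `cutoff * F`. -/
def low (E : Setting δ κ) (F : 𝓢(ℝ, ℂ)) : 𝓢(ℝ, ℂ) :=
  lowPiece E.threshold 0 (smulLeftCLM ℂ E.cutoff F)

/-- At time zero the three frequency cutoffs form a partition of unity. -/
theorem wave_add_wave_add_low (E : Setting δ κ) (F : 𝓢(ℝ, ℂ)) :
    E.wave 1 0 F + E.wave (-1) 0 F + E.low F = smulLeftCLM ℂ E.cutoff F := by
  refine ext_of_fourier fun ξ => ?_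
  rw [FourierTransform.fourier_add, FourierTransform.fourier_add, add_apply, add_apply, low, wave,
    wave, fourier_lowPiece, fourier_wavePiece _ _ _ hasTemperateGrowth_highPass,
    fourier_wavePiece _ _ _ hasTemperateGrowth_highPass, waveSymbol, waveSymbol, lowPass]
  have h1 : 1 / E.threshold * ξ = ξ / E.threshold := by ring
  have h2 : -1 / E.threshold * ξ = -(ξ / E.threshold) := by ring
  rw [h1, h2]
  simp
  ring

theorem eLpNorm_wave_le (E : Setting δ κ) (σ t : ℝ) (F : 𝓢(ℝ, ℂ)) :
    eLpNorm (E.wave σ t F) 2 volume ≤ eLpNorm F 2 volume := by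
  have h1 := Regime.eLpNorm_smulLeftCLM_le E.hasTemperateGrowth_cutoff E.norm_cutoff_le F
  rw [ENNReal.ofReal_one, one_mul] at h1
  refine le_trans ?_ h1
  rw [← eLpNorm_fourier, ← eLpNorm_fourier (smulLeftCLM ℂ E.cutoff F)]
  refine eLpNorm_mono fun ξ => ?_
  rw [wave, fourier_wavePiece _ _ _ hasTemperateGrowth_highPass, norm_mul, Regime.norm_symbol]
  exact mul_le_of_le_one_left (norm_nonneg _) (norm_highPass_le _)

/-- The derivative gives one factor of the threshold and the data of order `-α` give `α` more; this
is the source of the exponent `(δ - 1)(1 + α)`. -/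
theorem eLpNorm_derivCLM_low_le (hκ : 0 < κ) {α : ℝ} (hα : 0 ≤ α) :
    ∃ C : ℝ≥0, ∀ (E : Setting δ κ) (F : 𝓢(ℝ, ℂ)), eLpNorm (derivCLM ℂ ℂ (E.low F)) 2 volume ≤
      C * ENNReal.ofReal (E.ρ ^ ((δ - 1) * (1 + α))) * lineSobolev (-α) E.ρ F := by
  obtain ⟨B, hB⟩ := exists_isCutoff (δ := δ) hκ
  obtain ⟨k, hk⟩ := exists_nat_ge α
  obtain ⟨C, hC⟩ := Regime.eLpNorm_lowPiece_cutoff_iterate (δ := δ) (κ := κ) B k 0 1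
  refine ⟨(2 * Real.pi).toNNReal * C, fun E F => ?_⟩
  -- Only the frequency and the scale of this regime matter; its direction and time are arbitrary.
  set G := E.regime (σ := 1) (Or.inl rfl) le_rfl 0
  have hN : G.N = E.threshold := by simp [G, regime]
  have h1 := hC G _ (hB E (Or.inl rfl) le_rfl 0) F
  have h2 := Regime.eLpNorm_iterate_resolvent_le G.ρ_pos G.N_pos G.inv_ρ_le_N hα hk F
  rw [cutoffDeriv_zero, hN] at h1
  rw [hN] at h2
  have hth := E.threshold_pos
  rw [low, derivCLM_lowPiece hth.ne', ← lineSobolev_zero 1, lineSobolev_smul, lineSobolev_zero]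
  have e1 : ‖(2 * Real.pi * Complex.I * (E.threshold : ℝ) : ℂ)‖ₑ =
      ENNReal.ofReal (2 * Real.pi) * ENNReal.ofReal E.threshold := by
    rw [← ofReal_norm, ← ENNReal.ofReal_mul (by positivity)]
    congr 1
    simp [abs_of_pos Real.pi_pos, abs_of_pos hth]
  have e2 : ENNReal.ofReal (E.ρ ^ ((δ - 1) * (1 + α))) =
      ENNReal.ofReal E.threshold * ENNReal.ofReal (E.threshold ^ α) := by
    rw [← ENNReal.ofReal_mul hth.le, Real.rpow_mul E.ρ_pos.le, ← threshold, Real.rpow_add hth,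
      Real.rpow_one]
  rw [e1, e2]
  calc _ ≤ ENNReal.ofReal (2 * Real.pi) * ENNReal.ofReal E.threshold *
        (C * (ENNReal.ofReal (E.threshold ^ α) * lineSobolev (-α) E.ρ F)) := by
        gcongr
        exact h1.trans (mul_le_mul_right h2 _)
    _ = _ := by
        rw [ENNReal.coe_mul, ENNReal.ofReal]
        ring

end Setting

/-! ### The profile of a radial test function -/

/-- The point of `ℝ³` with coordinates `(r, 0, 0)`. -/
def axisPoint (r : ℝ) : R3 := EuclideanSpace.single 0 r

theorem norm_axisPoint (r : ℝ) : ‖axisPoint r‖ = |r| := by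
  rw [axisPoint, PiLp.norm_single, Real.norm_eq_abs]

theorem isometry_axisPoint : Isometry axisPoint := by
  refine Isometry.of_dist_eq fun a b => ?_
  simp [axisPoint]

theorem hasTemperateGrowth_axisPoint : axisPoint.HasTemperateGrowth := by
  have h : axisPoint = fun r : ℝ => (ContinuousLinearMap.toSpanSingleton ℝ (axisPoint 1)) r := by
    funext r
    ext i
    by_cases hi : i = 0 <;> simp [axisPoint, hi]
  rw [h]
  fun_prop

/-- The function `r ↦ r * f(r, 0, 0)` on the line. -/
def profile (f : 𝓢(R3, ℂ)) : 𝓢(ℝ, ℂ) :=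
  smulLeftCLM ℂ (fun r : ℝ => (r : ℂ))
    (compCLMOfAntilipschitz ℂ hasTemperateGrowth_axisPoint isometry_axisPoint.antilipschitz f)

theorem profile_apply (f : 𝓢(R3, ℂ)) (r : ℝ) : profile f r = r * f (axisPoint r) := by
  rw [profile, smulLeftCLM_apply_apply Function.Complex.hasTemperateGrowth_ofReal, smul_eq_mul]
  rfl

namespace IsRadialTestFunction

variable {R : ℝ} {f : 𝓢(R3, ℂ)}

theorem profile_neg (hf : IsRadialTestFunction R f) (r : ℝ) : profile f (-r) = -profile f r := by
  rw [profile_apply, profile_apply, hf.radial (axisPoint (-r)) (axisPoint r)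
    (by rw [norm_axisPoint, norm_axisPoint, abs_neg])]
  push_cast; ring

theorem apply_axisPoint_norm (hf : IsRadialTestFunction R f) (x : R3) : f (axisPoint ‖x‖) = f x :=
  hf.radial _ _ (by rw [norm_axisPoint, abs_norm])

/-- As the profile is odd, the lift of `χ` times it at radius `r` is `(χ(r) + χ(-r)) f`. Only radii
at least `R` matter, by the support of `f`. -/
theorem toLp_eq_liftL2 (hf : IsRadialTestFunction R f) {χ : ℝ → ℂ} (hχ : χ.HasTemperateGrowth)
    (hsum : ∀ r, 0 ≤ r → R ≤ r → χ r + χ (-r) = 1) :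
    f.toLp 2 = liftL2 (smulLeftCLM ℂ χ (profile f)) := by
  refine Lp.ext ?_
  have h0 : ∀ᵐ x : R3, x ≠ 0 := by simp [ae_iff]
  filter_upwards [f.coeFn_toLp 2 volume, coeFn_liftL2 (smulLeftCLM ℂ χ (profile f)), h0]
    with x h1 h2 hx
  have hx0 : ((‖x‖ : ℝ) : ℂ) ≠ 0 := Complex.ofReal_ne_zero.2 (norm_ne_zero_iff.2 hx)
  rw [h1, h2, radialLift, oddPart_apply, smulLeftCLM_apply_apply hχ, smulLeftCLM_apply_apply hχ,
    hf.profile_neg, profile_apply, hf.apply_axisPoint_norm, smul_eq_mul, smul_eq_mul]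
  have h3 : f x = (χ ‖x‖ + χ (-‖x‖)) * f x := by
    by_cases hR : R ≤ ‖x‖
    · rw [hsum _ (norm_nonneg _) hR, one_mul]
    · rw [image_eq_zero_of_notMem_tsupport fun h => hR (hf.support_subset h), mul_zero]
  rw [eq_div_iff hx0]
  linear_combination (‖x‖ : ℂ) * h3

/-- The choice `χ = 1/2` represents `f` by an odd function, which gives exact formulas for its
norms, unlike the one-sided cutoff used for the decomposition. -/
theorem toLp_eq_liftL2_half (hf : IsRadialTestFunction R f) :
    f.toLp 2 = liftL2 ((1 / 2 : ℂ) • profile f) := by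
  rw [hf.toLp_eq_liftL2 (χ := fun _ => (1 / 2 : ℂ)) (Function.HasTemperateGrowth.const _)
    fun r _ _ => by norm_num]
  congr 1
  ext r
  rw [smulLeftCLM_apply_apply (Function.HasTemperateGrowth.const _), smul_apply]

theorem oddPart_half (hf : IsRadialTestFunction R f) :
    oddPart ((1 / 2 : ℂ) • profile f) = profile f := by
  ext r
  rw [oddPart_apply, smul_apply, smul_apply, hf.profile_neg, smul_eq_mul, smul_eq_mul]
  ring

theorem enorm_toLp (hf : IsRadialTestFunction R f) : ‖(f.toLp 2 : L2R3)‖ₑ =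
    ENNReal.ofReal √(2 * Real.pi) * eLpNorm (profile f) 2 volume := by
  rw [hf.toLp_eq_liftL2_half, enorm_liftL2, hf.oddPart_half]

theorem sobolevNorm_toLp (hf : IsRadialTestFunction R f) (s ρ : ℝ) : sobolevNorm s ρ (f.toLp 2) =
    ENNReal.ofReal √(2 * Real.pi) * lineSobolev s ρ (profile f) := by
  rw [hf.toLp_eq_liftL2_half, sobolevNorm_liftL2, hf.oddPart_half]

end IsRadialTestFunction

/-! ### Changes of order and scale, and the choice of setting -/

theorem lineSobolev_le_of_order_le {s s' ρ : ℝ} (hρ : 0 < ρ) (h : s ≤ s') (g : 𝓢(ℝ, ℂ)) :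
    lineSobolev s ρ g ≤ ENNReal.ofReal (ρ ^ (s' - s)) * lineSobolev s' ρ g := by
  refine lineSobolev_le_of_symbol fun ξ => ?_
  rw [← mul_assoc]
  refine mul_le_mul_of_nonneg_right ?_ (norm_nonneg _)
  have h1 : (ρ ^ 2)⁻¹ ≤ ξ ^ 2 + 1 / ρ ^ 2 := by
    rw [one_div]; nlinarith [sq_nonneg ξ]
  have hX : 0 < ξ ^ 2 + 1 / ρ ^ 2 := by positivity
  have h2 : (ξ ^ 2 + 1 / ρ ^ 2) ^ ((s - s') / 2) ≤ ρ ^ (s' - s) := by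
    calc _ ≤ ((ρ ^ 2)⁻¹) ^ ((s - s') / 2) :=
          Real.rpow_le_rpow_of_nonpos (by positivity) h1 (by linarith)
      _ = ρ ^ (s' - s) := by
          rw [← Real.rpow_natCast, ← Real.rpow_neg hρ.le, ← Real.rpow_mul hρ.le]
          congr 1; push_cast; ring
  calc (ξ ^ 2 + 1 / ρ ^ 2) ^ (s / 2)
      = (ξ ^ 2 + 1 / ρ ^ 2) ^ ((s - s') / 2) * (ξ ^ 2 + 1 / ρ ^ 2) ^ (s' / 2) := by
        rw [← Real.rpow_add hX]; congr 1; ring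
    _ ≤ _ := mul_le_mul_of_nonneg_right h2 (by positivity)

theorem lineSobolev_le_of_scale {α ρ : ℝ} (hα : 0 ≤ α) (hρ : 1 ≤ ρ) (g : 𝓢(ℝ, ℂ)) :
    lineSobolev (-α) ρ g ≤ ENNReal.ofReal (ρ ^ α) * lineSobolev (-α) 1 g := by
  have hρ0 : 0 < ρ := zero_lt_one.trans_le hρ
  refine lineSobolev_le_of_symbol fun ξ => ?_
  rw [← mul_assoc]
  refine mul_le_mul_of_nonneg_right ?_ (norm_nonneg _)
  have h1 : (ρ ^ 2)⁻¹ * (ξ ^ 2 + 1 / 1 ^ 2) ≤ ξ ^ 2 + 1 / ρ ^ 2 := by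
    have : (ρ ^ 2)⁻¹ * ξ ^ 2 ≤ ξ ^ 2 :=
      mul_le_of_le_one_left (sq_nonneg _) (inv_le_one_of_one_le₀ (one_le_pow₀ hρ))
    rw [mul_add, one_div, one_div, one_pow, inv_one, mul_one]
    linarith
  calc (ξ ^ 2 + 1 / ρ ^ 2) ^ (-α / 2) ≤ ((ρ ^ 2)⁻¹ * (ξ ^ 2 + 1 / 1 ^ 2)) ^ (-α / 2) :=
        Real.rpow_le_rpow_of_nonpos (by positivity) h1 (by linarith)
    _ = _ := by
        rw [Real.mul_rpow (by positivity) (by positivity)]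
        congr 1
        rw [← Real.rpow_natCast, ← Real.rpow_neg hρ0.le, ← Real.rpow_mul hρ0.le]
        congr 1; push_cast; ring

/-- The lower bound for `ℓ / ρ` valid for all the settings in use. -/
def settingRatio (c : ℝ) : ℝ := c / (4 * √(1 + c ^ 2))

theorem settingRatio_pos {c : ℝ} (hc : 0 < c) : 0 < settingRatio c := by
  unfold settingRatio; positivity

theorem settingRatio_le_one {c : ℝ} (hc : 0 < c) : settingRatio c ≤ 1 := by
  have h : c ≤ √(1 + c ^ 2) := Real.le_sqrt_of_sq_le (by linarith)
  rw [settingRatio, div_le_one (by positivity)]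
  linarith

/-- `R / ⟨R⟩` increases with `R`, so its minimum over `R ≥ c` is attained at `c`; the 4 is that of
`ℓ = R / 4`. -/
theorem settingRatio_mul_bracket_le {c R : ℝ} (hc : 0 < c) (hR : c ≤ R) :
    settingRatio c * bracket R ≤ R / 4 := by
  have h0 : 0 < √(1 + c ^ 2) := by positivity
  have h : c * √(1 + R ^ 2) ≤ R * √(1 + c ^ 2) := by
    have hR0 : 0 ≤ R := hc.le.trans hR
    refine (sq_le_sq₀ (by positivity) (by positivity)).1 ?_
    rw [mul_pow, mul_pow, Real.sq_sqrt (by positivity), Real.sq_sqrt (by positivity)]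
    nlinarith
  rw [settingRatio, bracket, Real.norm_eq_abs, sq_abs, div_mul_eq_mul_div,
    div_le_div_iff₀ (by positivity) (by norm_num)]
  linarith

/-- For each radius there is a setting whose cutoff is adapted to radial functions supported
outside the ball of that radius. -/
theorem exists_setting {δ c : ℝ} (hδ : 0 < δ) (hc : 0 < c) {R : ℝ} (hR : R = 0 ∨ c ≤ R) :
    ∃ E : Setting δ (settingRatio c), E.ρ = bracket R ∧
      (∀ r, 0 ≤ r → R ≤ r → E.cutoff r + E.cutoff (-r) = 1) ∧
      (R = 0 ∨ 0 < R ∧ E.τ = 0 ∧ E.ℓ = R / 4) := by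
  rcases hR with rfl | hR
  · have h1 : bracket (0 : ℝ) = 1 := by simp [bracket]
    -- With τ = -3 and ℓ = 1 the cutoff rises on [-1, 1], symmetrically about the origin.
    refine ⟨⟨1, -3, 1, hδ, settingRatio_pos hc, le_rfl, by simpa using settingRatio_le_one hc, le_rfl,
      Or.inr ⟨rfl, rfl⟩⟩, h1.symm, fun r _ _ => ?_, Or.inl rfl⟩
    simp only [Setting.cutoff]
    have e : (-r - (-3 + 2 * 1)) / (2 * 1) = 1 - (r - (-3 + 2 * 1)) / (2 * 1) := by ring
    rw [e, ← Complex.ofReal_add, smoothTransition_add, Complex.ofReal_one]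
  · have hR0 : 0 < R := hc.trans_le hR
    have h1 : R ≤ bracket R := by
      rw [bracket, Real.norm_eq_abs, sq_abs]
      exact Real.le_sqrt_of_sq_le (by linarith)
    -- With τ = 0 and ℓ = R / 4 the cutoff rises on [R/2, R]: it is one on the support of `f` and
    -- zero on its reflection.
    refine ⟨⟨bracket R, 0, R / 4, hδ, settingRatio_pos hc, one_le_bracket R,
      settingRatio_mul_bracket_le hc hR, by linarith, Or.inl rfl⟩, rfl, fun r hr0 hr => ?_,
      Or.inr ⟨hR0, rfl, rfl⟩⟩
    simp only [Setting.cutoff]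
    rw [Real.smoothTransition.one_of_one_le, Real.smoothTransition.zero_of_nonpos]
    · simp
    · exact div_nonpos_of_nonpos_of_nonneg (by linarith) (by linarith)
    · rw [le_div_iff₀ (by linarith)]
      linarith

theorem setLIntegral_Ioi_comp_sub (Φ : ℝ → ℝ≥0∞) (t₀ : ℝ) :
    ∫⁻ t in Set.Ioi t₀, Φ (t - t₀) = ∫⁻ t in Set.Ioi (0 : ℝ), Φ t := by
  rw [← lintegral_indicator measurableSet_Ioi, ← lintegral_indicator measurableSet_Ioi,
    ← lintegral_sub_right_eq_self ((Set.Ioi (0 : ℝ)).indicator Φ) t₀]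
  refine lintegral_congr fun t => ?_
  simp [Set.indicator_apply]

theorem setLIntegral_Iio_comp_sub (Φ : ℝ → ℝ≥0∞) (t₀ : ℝ) :
    ∫⁻ t in Set.Iio t₀, Φ (t₀ - t) = ∫⁻ t in Set.Ioi (0 : ℝ), Φ t := by
  rw [← lintegral_indicator measurableSet_Iio, ← lintegral_indicator measurableSet_Ioi,
    ← lintegral_sub_left_eq_self ((Set.Ioi (0 : ℝ)).indicator Φ) t₀]
  refine lintegral_congr fun t => ?_
  simp [Set.indicator_apply]

/-! ### Transfer of the line estimates to ℝ³ -/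

namespace Setting

variable {δ κ : ℝ} (E : Setting δ κ)

theorem freeSchrodinger_wave (σ t : ℝ) (F : 𝓢(ℝ, ℂ)) :
    freeSchrodinger (σ * t) (liftL2 (E.wave σ 0 F)) = liftL2 (E.wave σ t F) := by
  rw [freeSchrodinger_liftL2, wave, lineSchrodinger_wavePiece _ _ _ hasTemperateGrowth_highPass, wave]

theorem setLIntegral_outgoing (Ψ : L2R3 → ℝ≥0∞) (t₀ : ℝ) (F : 𝓢(ℝ, ℂ)) :
    ∫⁻ t in Set.Ioi t₀, Ψ (freeSchrodinger (t - t₀) (liftL2 (E.wave 1 0 F))) =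
      ∫⁻ t in Set.Ioi (0 : ℝ), Ψ (liftL2 (E.wave 1 t F)) := by
  rw [← setLIntegral_Ioi_comp_sub _ t₀]
  refine lintegral_congr fun t => ?_
  rw [← E.freeSchrodinger_wave 1 (t - t₀), one_mul]

theorem setLIntegral_incoming (Ψ : L2R3 → ℝ≥0∞) (t₀ : ℝ) (F : 𝓢(ℝ, ℂ)) :
    ∫⁻ t in Set.Iio t₀, Ψ (freeSchrodinger (t - t₀) (liftL2 (E.wave (-1) 0 F))) =
      ∫⁻ t in Set.Ioi (0 : ℝ), Ψ (liftL2 (E.wave (-1) t F)) := by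
  rw [← setLIntegral_Iio_comp_sub _ t₀]
  refine lintegral_congr fun t => ?_
  rw [← E.freeSchrodinger_wave (-1) (t₀ - t), neg_one_mul, neg_sub]

theorem enorm_liftL2_wave_le {R : ℝ} {f : 𝓢(R3, ℂ)} (hf : IsRadialTestFunction R f) (σ t : ℝ) :
    ‖liftL2 (E.wave σ t (profile f))‖ₑ ≤ 2 * ‖(f.toLp 2 : L2R3)‖ₑ := by
  rw [enorm_liftL2, hf.enorm_toLp, mul_left_comm]
  gcongr
  exact (eLpNorm_oddPart_le _).trans (mul_le_mul_right (E.eLpNorm_wave_le σ t _) _)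

theorem norm_liftL2_wave_le {R : ℝ} {f : 𝓢(R3, ℂ)} (hf : IsRadialTestFunction R f) (σ t : ℝ) :
    ‖liftL2 (E.wave σ t (profile f))‖ ≤ 2 * ‖(f.toLp 2 : L2R3)‖ := by
  have h := ENNReal.toReal_mono (by finiteness) (E.enorm_liftL2_wave_le hf σ t)
  simpa using h

/-- When `τ = 0` and `ℓ = R / 4`, the weight `nearWeight` is even and equals one on `|x| ≤ R / 8`,
so the truncated wave lifts to a function agreeing with the original on the ball. For R = 0 the ball
is empty. -/
theorem gradNorm_wave_ball_le {R : ℝ} (hR : R = 0 ∨ 0 < R ∧ E.τ = 0 ∧ E.ℓ = R / 4) (σ t : ℝ)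
    (F : 𝓢(ℝ, ℂ)) : gradNorm (liftL2 (E.wave σ t F)) (Metric.ball 0 (R / 8)) ≤
      ENNReal.ofReal (2 * √(2 * Real.pi)) *
        eLpNorm (derivCLM ℂ ℂ (smulLeftCLM ℂ (nearWeight E.τ E.ℓ) (E.wave σ t F))) 2 volume := by
  rcases hR with rfl | ⟨hR0, hτ, hℓ⟩
  · rw [zero_div, Metric.ball_zero, gradNorm_empty]
    exact zero_le
  · refine le_trans (gradNorm_mono_of_eqOn ?_) (gradNorm_liftL2_le _)
    filter_upwards [coeFn_liftL2 (E.wave σ t F),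
      coeFn_liftL2 (smulLeftCLM ℂ (nearWeight E.τ E.ℓ) (E.wave σ t F))] with x h1 h2 hx
    rw [h1, h2, radialLift_eq_mul (b := nearWeight E.τ E.ℓ) (H := E.wave σ t F)
      (H' := smulLeftCLM ℂ (nearWeight E.τ E.ℓ) (E.wave σ t F)) (fun r => by rw [nearWeight, nearWeight, hτ, sub_zero, sub_zero, neg_div, bump_neg])
      (fun r => by rw [smulLeftCLM_apply_apply (hasTemperateGrowth_nearWeight _ _), smul_eq_mul])]
    rw [nearWeight, bump_of_abs_le, Complex.ofReal_one, one_mul]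
    rw [mem_ball_zero_iff] at hx
    rw [hτ, hℓ, sub_zero, abs_of_nonneg (by positivity), div_le_iff₀ (by positivity)]
    linarith

end Setting

namespace Setting

variable {δ κ : ℝ}

theorem gradNorm_low_le (hκ : 0 < κ) {α : ℝ} (hα : 0 ≤ α) :
    ∃ C : ℝ≥0, ∀ (E : Setting δ κ) (R : ℝ) (f : 𝓢(R3, ℂ)), IsRadialTestFunction R f →
      gradNorm (liftL2 (E.low (profile f))) Set.univ ≤
        C * ENNReal.ofReal (E.ρ ^ ((δ - 1) * (1 + α))) * sobolevNorm (-α) E.ρ (f.toLp 2) := by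
  obtain ⟨C, hC⟩ := eLpNorm_derivCLM_low_le (δ := δ) hκ hα
  refine ⟨2 * C, fun E R f hf => (gradNorm_liftL2_le _).trans
    ((mul_le_mul_right (hC E _) _).trans (le_of_eq ?_))⟩
  rw [hf.sobolevNorm_toLp, ENNReal.ofReal_mul (by norm_num), ENNReal.ofReal_ofNat, ENNReal.coe_mul,
    ENNReal.coe_ofNat]
  ring

theorem lintegral_gradNorm_wave_le (hδ : 0 < δ) (hκ : 0 < κ) {α β : ℝ} (hα : 0 ≤ α) (hβ : 0 ≤ β) :
    ∃ C : ℝ≥0, ∀ (E : Setting δ κ) (R : ℝ), (R = 0 ∨ 0 < R ∧ E.τ = 0 ∧ E.ℓ = R / 4) →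
      ∀ f : 𝓢(R3, ℂ), IsRadialTestFunction R f → ∀ σ : ℝ, (σ = 1 ∨ σ = -1) →
      ∫⁻ t in Set.Ioi (0 : ℝ), gradNorm (liftL2 (E.wave σ t (profile f))) (Metric.ball 0 (R / 8)) ≤
        C * ENNReal.ofReal (E.ρ ^ (-β)) * sobolevNorm (-α) 1 (f.toLp 2) := by
  -- The decay rate `α + β` allows for the loss `ρ^α` in passing from the scale `ρ` to the scale
  -- `1`.
  obtain ⟨C, hC⟩ := lintegral_derivCLM_near_le (δ := δ) hδ hκ hα (add_nonneg hα hβ)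
  refine ⟨2 * C, fun E R hR f hf σ hσ => ?_⟩
  refine (lintegral_mono fun t => E.gradNorm_wave_ball_le hR σ t (profile f)).trans ?_
  rw [lintegral_const_mul' _ _ ENNReal.ofReal_ne_top]
  have h2 : ENNReal.ofReal (E.ρ ^ (-(α + β))) * ENNReal.ofReal (E.ρ ^ α) =
      ENNReal.ofReal (E.ρ ^ (-β)) := by
    rw [← ENNReal.ofReal_mul (Real.rpow_nonneg E.ρ_pos.le _), ← Real.rpow_add E.ρ_pos]
    congr 2; ring
  calc _ ≤ ENNReal.ofReal (2 * √(2 * Real.pi)) * (C * ENNReal.ofReal (E.ρ ^ (-(α + β))) *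
        (ENNReal.ofReal (E.ρ ^ α) * lineSobolev (-α) 1 (profile f))) := by
        refine mul_le_mul_right ((hC E σ hσ (profile f)).trans (mul_le_mul_right ?_ _)) _
        exact lineSobolev_le_of_scale hα E.one_le_ρ _
    _ = _ := by
        rw [hf.sobolevNorm_toLp, ← h2, ENNReal.ofReal_mul (by norm_num), ENNReal.ofReal_ofNat,
          ENNReal.coe_mul, ENNReal.coe_ofNat]
        ring

/-- The decomposition needs an exponent below 1. A larger exponent `δ'` in the estimate is reached
afterwards: raising the order of the data costs `ρ^(δ' - δ)`, exactly what the prefactor gains. -/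
theorem lintegral_sobolevNorm_weighted_wave_le (hδ : 0 < δ) (hδ1 : δ < 1) (hκ : 0 < κ) {α : ℝ}
    (hα : 0 ≤ α) : ∃ C : ℝ≥0, ∀ (E : Setting δ κ) (R : ℝ) (f : 𝓢(R3, ℂ)),
      IsRadialTestFunction R f → ∀ σ : ℝ, (σ = 1 ∨ σ = -1) → ∀ δ' : ℝ, δ ≤ δ' →
      ∫⁻ t in Set.Ioi (0 : ℝ), sobolevNorm (-α) E.ρ (weighted (liftL2 (E.wave σ t (profile f)))) ≤
        C * ENNReal.ofReal (E.ρ ^ (-1 + δ')) * sobolevNorm (-α - 1 + δ') E.ρ (f.toLp 2) := by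
  obtain ⟨C, hC⟩ := lintegral_lineSobolev_wave_le (δ := δ) hδ hδ1 hκ hα
  refine ⟨2 * C, fun E R f hf σ hσ δ' hδ' => ?_⟩
  have h1 : ∀ t, sobolevNorm (-α) E.ρ (weighted (liftL2 (E.wave σ t (profile f)))) ≤
      ENNReal.ofReal √(2 * Real.pi) * 2 *
        lineSobolev (-α) E.ρ (smulLeftCLM ℂ lineWeight (E.wave σ t (profile f))) := fun t => by
    rw [weighted_liftL2, sobolevNorm_liftL2, mul_assoc]
    exact mul_le_mul_right (lineSobolev_oddPart_le _ _ _) _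
  refine (lintegral_mono h1).trans ?_
  rw [lintegral_const_mul' _ _ (by finiteness)]
  have h2 : ENNReal.ofReal (E.ρ ^ (-1 + δ)) * ENNReal.ofReal (E.ρ ^ (-α - 1 + δ' - (-α - 1 + δ))) =
      ENNReal.ofReal (E.ρ ^ (-1 + δ')) := by
    rw [← ENNReal.ofReal_mul (Real.rpow_nonneg E.ρ_pos.le _), ← Real.rpow_add E.ρ_pos]
    congr 2; ring
  calc _ ≤ ENNReal.ofReal √(2 * Real.pi) * 2 * (C * ENNReal.ofReal (E.ρ ^ (-1 + δ)) *
        (ENNReal.ofReal (E.ρ ^ (-α - 1 + δ' - (-α - 1 + δ))) *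
          lineSobolev (-α - 1 + δ') E.ρ (profile f))) := by
        refine mul_le_mul_right ((hC E σ hσ (profile f)).trans (mul_le_mul_right ?_ _)) _
        exact lineSobolev_le_of_order_le E.ρ_pos (by linarith) _
    _ = _ := by
        rw [hf.sobolevNorm_toLp, ← h2, ENNReal.coe_mul, ENNReal.coe_ofNat]
        ring

theorem norm_weighted_wave_le (E : Setting δ κ) : ∃ C : ℝ, ∀ (R : ℝ) (f : 𝓢(R3, ℂ)),
    IsRadialTestFunction R f → ∀ σ t : ℝ, (σ = 1 ∨ σ = -1) → 0 < t →
      ‖weighted (liftL2 (E.wave σ t (profile f)))‖ ≤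
        C * ((E.threshold * t) ^ 2)⁻¹ * ‖(f.toLp 2 : L2R3)‖ := by
  obtain ⟨C, hC⟩ := eLpNorm_wave_decay (δ := δ) E.κ_pos
  refine ⟨2 * C, fun R f hf σ t hσ ht => ?_⟩
  have h : ‖weighted (liftL2 (E.wave σ t (profile f)))‖ₑ ≤
      2 * C * ENNReal.ofReal ((E.threshold * t) ^ 2)⁻¹ * ‖(f.toLp 2 : L2R3)‖ₑ := by
    rw [weighted_liftL2, enorm_liftL2, hf.enorm_toLp]
    calc _ ≤ ENNReal.ofReal √(2 * Real.pi) * (2 * (C * ENNReal.ofReal ((E.threshold * t) ^ 2)⁻¹ *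
          eLpNorm (profile f) 2 volume)) := by
          gcongr
          exact (eLpNorm_oddPart_le _).trans (mul_le_mul_right (hC E σ t hσ ht _) _)
      _ = _ := by ring
  have h' := ENNReal.toReal_mono (by finiteness) h
  rw [ENNReal.toReal_mul, ENNReal.toReal_mul, ENNReal.toReal_ofReal (by positivity)] at h'
  simpa using h'

end Setting

/-! ### Weak decay of incoming waves -/

theorem inner_freeSchrodinger (t : ℝ) (u v : L2R3) :
    inner ℂ (freeSchrodinger t u) v = inner ℂ u (freeSchrodinger (-t) v) := by
  rw [← Lp.inner_fourier_eq, ← Lp.inner_fourier_eq u, freeSchrodinger, freeSchrodinger,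
    FourierTransform.fourier_fourierInv_eq, FourierTransform.fourier_fourierInv_eq, L2.inner_def,
    L2.inner_def]
  refine integral_congr_ae ?_
  filter_upwards [coeFn_mulL2 (continuous_schrodingerSymbol t) (norm_schrodingerSymbol_le t) (𝓕 u),
    coeFn_mulL2 (continuous_schrodingerSymbol (-t)) (norm_schrodingerSymbol_le (-t)) (𝓕 v)]
    with ξ h1 h2
  rw [h1, h2, RCLike.inner_apply, RCLike.inner_apply, map_mul]
  have h3 : (starRingEnd ℂ) (schrodingerSymbol t ξ) = schrodingerSymbol (-t) ξ := by
    rw [schrodingerSymbol, schrodingerSymbol, ← Complex.exp_conj, map_mul, Complex.conj_ofReal,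
      Complex.conj_I]
    congr 1
    push_cast
    ring
  rw [h3]
  ring

theorem inner_weighted (u v : L2R3) : inner ℂ (weighted u) v = inner ℂ u (weighted v) := by
  rw [L2.inner_def, L2.inner_def]
  refine integral_congr_ae ?_
  filter_upwards [coeFn_mulL2 continuous_inverseSquareWeight norm_inverseSquareWeight_le u,
    coeFn_mulL2 continuous_inverseSquareWeight norm_inverseSquareWeight_le v] with x h1 h2
  rw [weighted, weighted, h1, h2, RCLike.inner_apply, RCLike.inner_apply, map_mul]
  have h3 : (starRingEnd ℂ) (inverseSquareWeight x) = inverseSquareWeight x := Complex.conj_ofReal _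
  rw [h3]
  ring

/-- Multiplication by `1 + |x|²` preserves Schwartz functions, so the range of the weight contains a
dense set of states. -/
theorem exists_weighted_eq_toLp (v : 𝓢(R3, ℂ)) : ∃ w : L2R3, weighted w = v.toLp 2 := by
  have hg : (fun x : R3 => ((1 + ‖x‖ ^ 2 : ℝ) : ℂ)).HasTemperateGrowth := by
    have h := Function.Complex.hasTemperateGrowth_ofReal.comp
      (Function.hasTemperateGrowth_one_add_norm_sq_rpow R3 1)
    simp only [Real.rpow_one] at h
    exact h
  refine ⟨(smulLeftCLM ℂ (fun x : R3 => ((1 + ‖x‖ ^ 2 : ℝ) : ℂ)) v).toLp 2, Lp.ext ?_⟩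
  filter_upwards [v.coeFn_toLp 2 volume, (smulLeftCLM ℂ (fun x : R3 => ((1 + ‖x‖ ^ 2 : ℝ) : ℂ))
    v).coeFn_toLp 2 volume, coeFn_mulL2 continuous_inverseSquareWeight norm_inverseSquareWeight_le
    ((smulLeftCLM ℂ (fun x : R3 => ((1 + ‖x‖ ^ 2 : ℝ) : ℂ)) v).toLp 2)] with x h1 h2 h3
  have hx : (0 : ℝ) < 1 + ‖x‖ ^ 2 := by positivity
  rw [weighted, h3, h2, h1, smulLeftCLM_apply_apply hg, smul_eq_mul, ← mul_assoc,
    inverseSquareWeight, ← Complex.ofReal_mul, bracket, Real.sqrt_eq_rpow, ← Real.rpow_mul hx.le]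
  norm_num [Real.rpow_neg_one, inv_mul_cancel₀ hx.ne']

/-- Incoming waves decay weakly, uniformly on the unit ball. -/
theorem Setting.inner_incoming_decay {δ κ : ℝ} (E : Setting δ κ) (R : ℝ) (u₀ : L2R3) {ε : ℝ}
    (hε : 0 < ε) : ∃ T : ℝ, 0 < T ∧ ∀ t : ℝ, T ≤ t → ∀ f : 𝓢(R3, ℂ), IsRadialTestFunction R f →
      ‖inner ℂ (freeSchrodinger t u₀) (liftL2 (E.wave (-1) 0 (profile f)))‖ ≤
        ε * ‖(f.toLp 2 : L2R3)‖ := by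
  obtain ⟨v, hv⟩ := (denseRange_toLpCLM (F := ℂ) (p := 2) (μ := (volume : Measure R3))
    ENNReal.ofNat_ne_top).exists_dist_lt u₀ (show 0 < ε / 4 by positivity)
  rw [toLpCLM_apply] at hv
  obtain ⟨w, hw⟩ := exists_weighted_eq_toLp v
  obtain ⟨C, hC⟩ := E.norm_weighted_wave_le
  have hlim : Filter.Tendsto (fun t => ‖w‖ * (C * ((E.threshold * t) ^ 2)⁻¹)) Filter.atTop
      (nhds (‖w‖ * (C * 0))) := by
    refine Filter.Tendsto.const_mul _ (Filter.Tendsto.const_mul _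
      (Filter.Tendsto.inv_tendsto_atTop ?_))
    exact (Filter.tendsto_pow_atTop (by norm_num)).comp
      (Filter.tendsto_id.const_mul_atTop E.threshold_pos)
  rw [mul_zero, mul_zero] at hlim
  obtain ⟨T, hT⟩ := Filter.eventually_atTop.1
    (hlim.eventually (gt_mem_nhds (show (0 : ℝ) < ε / 2 by positivity)))
  refine ⟨max T 1, lt_max_of_lt_right one_pos, fun t ht f hf => ?_⟩
  have ht0 : 0 < t := one_pos.trans_le ((le_max_right _ _).trans ht)
  -- By duality the propagator runs backwards on the incoming wave, which is its favorable
  -- direction.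
  have hwave := E.freeSchrodinger_wave (-1) t (profile f)
  rw [neg_one_mul] at hwave
  rw [inner_freeSchrodinger, hwave]
  set W := liftL2 (E.wave (-1) t (profile f))
  have hW : ‖W‖ ≤ 2 * ‖(f.toLp 2 : L2R3)‖ := E.norm_liftL2_wave_le hf (-1) t
  -- The approximation error costs `ε/4` times the bound `2‖f‖`; the other half of `ε` is left for
  -- the decaying term. Every quantity entering the choice of `T` is independent of `f`.
  have hsplit : inner ℂ u₀ W = inner ℂ (u₀ - v.toLp 2 volume) W + inner ℂ w (weighted W) := by
    rw [← inner_weighted, hw, inner_sub_left, sub_add_cancel]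
  have h1 : ‖inner ℂ (u₀ - v.toLp 2 volume) W‖ ≤ ε / 4 * (2 * ‖(f.toLp 2 : L2R3)‖) := by
    refine (norm_inner_le_norm _ _).trans (mul_le_mul ?_ hW (norm_nonneg _) (by positivity))
    rw [← dist_eq_norm]
    exact hv.le
  have h2 : ‖inner ℂ w (weighted W)‖ ≤ ε / 2 * ‖(f.toLp 2 : L2R3)‖ := by
    refine (norm_inner_le_norm _ _).trans ?_
    calc ‖w‖ * ‖weighted W‖ ≤ ‖w‖ * (C * ((E.threshold * t) ^ 2)⁻¹ * ‖(f.toLp 2 : L2R3)‖) := by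
          gcongr
          exact hC R f hf (-1) t (Or.inr rfl) ht0
      _ = ‖w‖ * (C * ((E.threshold * t) ^ 2)⁻¹) * ‖(f.toLp 2 : L2R3)‖ := by ring
      _ ≤ _ := by
          gcongr
          exact (hT t ((le_max_left _ _).trans ht)).le
  rw [hsplit]
  calc _ ≤ _ := norm_add_le _ _
    _ ≤ _ := add_le_add h1 h2
    _ = _ := by ring

end

/-! ### Assembly -/

theorem proposition6p1 (δ : ℝ) (hδ : 0 < δ) (c : ℝ) (hc : 0 < c) :
    -- the implicit constants: they depend on `δ`, `α`, `β` (and on the lower bound `c`) only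
    ∃ (C₀ : ℝ≥0) (Csmooth : ℝ → ℝ≥0) (Corigin : ℝ → ℝ → ℝ≥0) (Cdisp : ℝ → ℝ≥0),
    ∀ R : ℝ, (R = 0 ∨ c ≤ R) →
    ∃ fplus fminus fsmooth : 𝓢(R3, ℂ) → L2R3,
      (∀ f : 𝓢(R3, ℂ), IsRadialTestFunction R f →
        f.toLp 2 = fplus f + fminus f + fsmooth f ∧
        -- boundedness on `L²`
        (‖fplus f‖ ≤ C₀ * ‖f.toLp 2‖ ∧ ‖fminus f‖ ≤ C₀ * ‖f.toLp 2‖ ∧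
          ‖fsmooth f‖ ≤ C₀ * ‖f.toLp 2‖) ∧
        -- smooth error
        (∀ α : ℝ, 0 ≤ α →
          gradNorm (fsmooth f) Set.univ ≤
            Csmooth α * ENNReal.ofReal (bracket R ^ ((δ - 1) * (1 + α))) *
              sobolevNorm (-α) (bracket R) (f.toLp 2)) ∧
        -- decay near the origin in the favorable time direction
        (∀ α β : ℝ, 0 ≤ α → 0 ≤ β → ∀ t₀ : ℝ,
          ∫⁻ t in Set.Ioi t₀,
              gradNorm (freeSchrodinger (t - t₀) (fplus f)) (Metric.ball 0 (R / 8)) ≤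
            Corigin α β * ENNReal.ofReal (bracket R ^ (-β)) *
              sobolevNorm (-α) 1 (f.toLp 2)) ∧
        (∀ α β : ℝ, 0 ≤ α → 0 ≤ β → ∀ t₀ : ℝ,
          ∫⁻ t in Set.Iio t₀,
              gradNorm (freeSchrodinger (t - t₀) (fminus f)) (Metric.ball 0 (R / 8)) ≤
            Corigin α β * ENNReal.ofReal (bracket R ^ (-β)) *
              sobolevNorm (-α) 1 (f.toLp 2)) ∧
        -- local smoothing in the favorable time direction
        (∀ α : ℝ, 0 ≤ α → ∀ t₀ : ℝ,
          ∫⁻ t in Set.Ioi t₀,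
              sobolevNorm (-α) (bracket R) (weighted (freeSchrodinger (t - t₀) (fplus f))) ≤
            Cdisp α * ENNReal.ofReal (bracket R ^ (-1 + δ)) *
              sobolevNorm (-α - 1 + δ) (bracket R) (f.toLp 2)) ∧
        (∀ α : ℝ, 0 ≤ α → ∀ t₀ : ℝ,
          ∫⁻ t in Set.Iio t₀,
              sobolevNorm (-α) (bracket R) (weighted (freeSchrodinger (t - t₀) (fminus f))) ≤
            Cdisp α * ENNReal.ofReal (bracket R ^ (-1 + δ)) *
              sobolevNorm (-α - 1 + δ) (bracket R) (f.toLp 2))) ∧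
      -- asymptotic decay of incoming waves, uniformly in `f`
      (∀ u₀ : L2R3, ∀ ε : ℝ, 0 < ε → ∃ T : ℝ, 0 < T ∧
        ∀ t : ℝ, T ≤ t → ∀ f : 𝓢(R3, ℂ), IsRadialTestFunction R f →
          ‖inner ℂ (freeSchrodinger t u₀) (fminus f)‖ ≤ ε * ‖f.toLp 2‖) := by
  have hκ := settingRatio_pos hc
  -- Local smoothing on the line requires an exponent below 1. The decomposition is made with `δ'`,
  -- and its estimates imply those for `δ` because `⟨R⟩ ≥ 1`.
  set δ' := min δ (1 / 2) with hδ'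
  have hδ0 : 0 < δ' := lt_min hδ (by norm_num)
  have hδ1 : δ' < 1 := (min_le_right _ _).trans_lt (by norm_num)
  have hle : δ' ≤ δ := min_le_left _ _
  -- The sign condition is placed after the constant so that constants can be chosen as functions on
  -- all of ℝ, before `R` is fixed.
  have hsmooth : ∀ α : ℝ, ∃ C : ℝ≥0, 0 ≤ α → ∀ (E : Setting δ' (settingRatio c)) (R : ℝ)
      (f : 𝓢(R3, ℂ)), IsRadialTestFunction R f →
      gradNorm (liftL2 (E.low (profile f))) Set.univ ≤
        C * ENNReal.ofReal (E.ρ ^ ((δ' - 1) * (1 + α))) * sobolevNorm (-α) E.ρ (f.toLp 2) := by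
    intro α
    by_cases hα : 0 ≤ α
    · obtain ⟨C, hC⟩ := Setting.gradNorm_low_le (δ := δ') hκ hα
      exact ⟨C, fun _ => hC⟩
    · exact ⟨0, fun h => absurd h hα⟩
  have horigin : ∀ α β : ℝ, ∃ C : ℝ≥0, 0 ≤ α → 0 ≤ β → ∀ (E : Setting δ' (settingRatio c)) (R : ℝ),
      (R = 0 ∨ 0 < R ∧ E.τ = 0 ∧ E.ℓ = R / 4) → ∀ f : 𝓢(R3, ℂ), IsRadialTestFunction R f →
      ∀ σ : ℝ, (σ = 1 ∨ σ = -1) → ∫⁻ t in Set.Ioi (0 : ℝ),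
        gradNorm (liftL2 (E.wave σ t (profile f))) (Metric.ball 0 (R / 8)) ≤
        C * ENNReal.ofReal (E.ρ ^ (-β)) * sobolevNorm (-α) 1 (f.toLp 2) := by
    intro α β
    by_cases hα : 0 ≤ α
    · by_cases hβ : 0 ≤ β
      · obtain ⟨C, hC⟩ := Setting.lintegral_gradNorm_wave_le hδ0 hκ hα hβ
        exact ⟨C, fun _ _ => hC⟩
      · exact ⟨0, fun _ h => absurd h hβ⟩
    · exact ⟨0, fun h => absurd h hα⟩
  have hdisp : ∀ α : ℝ, ∃ C : ℝ≥0, 0 ≤ α → ∀ (E : Setting δ' (settingRatio c)) (R : ℝ)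
      (f : 𝓢(R3, ℂ)), IsRadialTestFunction R f → ∀ σ : ℝ, (σ = 1 ∨ σ = -1) →
      ∫⁻ t in Set.Ioi (0 : ℝ), sobolevNorm (-α) E.ρ (weighted (liftL2 (E.wave σ t (profile f)))) ≤
        C * ENNReal.ofReal (E.ρ ^ (-1 + δ)) * sobolevNorm (-α - 1 + δ) E.ρ (f.toLp 2) := by
    intro α
    by_cases hα : 0 ≤ α
    · obtain ⟨C, hC⟩ := Setting.lintegral_sobolevNorm_weighted_wave_le hδ0 hδ1 hκ hα
      exact ⟨C, fun _ E R f hf σ hσ => hC E R f hf σ hσ δ hle⟩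
    · exact ⟨0, fun h => absurd h hα⟩
  choose Cs hCs using hsmooth
  choose Co hCo using horigin
  choose Cd hCd using hdisp
  -- The two waves are bounded by `2‖f‖` each; the smooth part is the difference, hence 1 + 2 + 2.
  refine ⟨5, Cs, Co, Cd, fun R hR => ?_⟩
  obtain ⟨E, hρ, hsum, hpos⟩ := exists_setting hδ0 hc hR
  refine ⟨fun f => liftL2 (E.wave 1 0 (profile f)), fun f => liftL2 (E.wave (-1) 0 (profile f)),
    fun f => liftL2 (E.low (profile f)), fun f hf => ?_,
    fun u₀ ε hε => E.inner_incoming_decay R u₀ hε⟩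
  have hdec : f.toLp 2 = liftL2 (E.wave 1 0 (profile f)) + liftL2 (E.wave (-1) 0 (profile f)) +
      liftL2 (E.low (profile f)) := by
    rw [hf.toLp_eq_liftL2 E.hasTemperateGrowth_cutoff hsum, ← E.wave_add_wave_add_low, liftL2_add,
      liftL2_add]
  have hplus := E.norm_liftL2_wave_le hf 1 0
  have hminus := E.norm_liftL2_wave_le hf (-1) 0
  have hnn := norm_nonneg (f.toLp 2 : L2R3)
  refine ⟨hdec, ⟨?_, ?_, ?_⟩, fun α hα => ?_, fun α β hα hβ t₀ => ?_, fun α β hα hβ t₀ => ?_,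
    fun α hα t₀ => ?_, fun α hα t₀ => ?_⟩
  · push_cast
    linarith
  · push_cast
    linarith
  · have h : liftL2 (E.low (profile f)) = (f.toLp 2 volume - liftL2 (E.wave 1 0 (profile f))) -
        liftL2 (E.wave (-1) 0 (profile f)) := by
      rw [hdec]; abel
    beta_reduce
    rw [h]
    have h1 := norm_sub_le (f.toLp 2 volume - liftL2 (E.wave 1 0 (profile f)))
      (liftL2 (E.wave (-1) 0 (profile f)))
    have h2 := norm_sub_le (f.toLp 2 volume) (liftL2 (E.wave 1 0 (profile f)))
    push_cast
    linarith
  · rw [← hρ]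
    refine (hCs α hα E R f hf).trans ?_
    gcongr
    exact E.one_le_ρ
  · rw [E.setLIntegral_outgoing (fun u => gradNorm u (Metric.ball 0 (R / 8))), ← hρ]
    exact hCo α β hα hβ E R hpos f hf 1 (Or.inl rfl)
  · rw [E.setLIntegral_incoming (fun u => gradNorm u (Metric.ball 0 (R / 8))), ← hρ]
    exact hCo α β hα hβ E R hpos f hf (-1) (Or.inr rfl)
  · rw [E.setLIntegral_outgoing (fun u => sobolevNorm (-α) (bracket R) (weighted u)), ← hρ]
    exact hCd α hα E R f hf 1 (Or.inl rfl)
  · rw [E.setLIntegral_incoming (fun u => sobolevNorm (-α) (bracket R) (weighted u)), ← hρ]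
    exact hCd α hα E R f hf (-1) (Or.inr rfl)
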